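/- Let $N\ge 1$. Let $\bar W=\mathfrak S_N$ act on $\bar P=\bigoplus_{i=1}^N\mathbb Z\epsilon_i$ by $\sigma(\epsilon_i)=\epsilon_{\sigma(i)}$, let $(\epsilon_i,\epsilon_j)=\delta_{ij}$, and let $W=\bar W\ltimes\bar P$ with $\sigma t_\eta\sigma^{-1}=t_{\sigma(\eta)}$. Let $\mathfrak t'=\bigoplus_{i=1}^N\mathbb C\epsilon_i^\vee\oplus\mathbb C c$, where $W$ acts by $\sigma(\epsilon_i^\vee)=\epsilon_{\sigma(i)}^\vee$, $\sigma(c)=c$, $t_\eta(\xi)=\xi-\eta(\xi)c$ (with $\eta(c)=0$), and on $(\mathfrak t')^*$ by the dual action, so that $t_\eta(\zeta)=\zeta+\zeta(c)\eta$. Put $\alpha_{ij}=\epsilon_i-\epsilon_j$. Let $R=\{\alpha_{ij}+k\delta\mid i\neq j,\ k\in\mathbb Z\}$ and $R_+=\{\alpha_{ij}+k\delta\in R\mid k\ge 0\text{ if }i<j,\ k>0\text{ if }i>j\}$; $W$ acts on $R$ by $\sigma(\alpha_{ij}+k\delta)=\alpha_{\sigma(i)\sigma(j)}+k\delta$ and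 $t_\eta(\alpha+k\delta)=\alpha+(k-(\eta,\alpha))\delta$. Put $S(w)=R_+\cap w^{-1}(R\setminus R_+)$ and $l(w)=\#S(w)$. For $\alpha=\sum_i a_i\epsilon_i+k\delta$ put $\alpha^\vee=\sum_i a_i\epsilon_i^\vee+kc$ and $(\zeta,\alpha)=\zeta(\alpha^\vee)$; thus $(\zeta,\delta)=\zeta(c)$. Put $\alpha_i=\alpha_{i,i+1}$ $(1\le i<N)$, $\alpha_0=\delta-(\epsilon_1-\epsilon_N)$, let $s_i$ $(1\le i<N)$ be the transposition of $i,i+1$, let $s_0=t_{\epsilon_1-\epsilon_N}\cdot(1\ N)$, and let $\pi=t_{\epsilon_1}s_1\cdots s_{N-1}$ (for $N=1$, $s_0=1$). An expression $w=\pi^k s_{j_1}\cdots s_{j_m}$ $(k\in\mathbb Z)$ is reduced if $m=l(w)$. The degenerate double affine Hecke algebra $\mathcal H$ is the unital associative $\mathbb C$-algebra generated by $\mathbb C[W]$ and the symmetric algebra $S[\mathfrak t']$ with the relations $s_i\xi-s_i(\xi)s_i=-\alpha_i(\xi)$ $(0\le i<N)$ and $\pi\xi=\pi(\xi)\pi$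 for $\xi\in\mathfrak t'$, where $\delta$ vanishes on $\mathfrak t'$. For a reduced expression $w=\pi^k s_{j_1}\cdots s_{j_m}$ put $\varphi_w=\pi^k\varphi_{j_1}\cdots\varphi_{j_m}$, where $\varphi_i=1+s_i\alpha_i^\vee$. Let $Q=\frac1{N!}\sum_{\sigma\in\bar W}\sigma$. Let $\beta$ be an ordered partition of $N$ into positive parts, which divides $\{1,\dots,N\}$ into consecutive blocks. Let $\bar R_+=\{\alpha_{ij}\mid i<j\}$, let $\bar R_{\beta,+}$ be the set of the $\alpha_{ij}\in\bar R_+$ with $i,j$ in the same block, and let $\bar W_\beta$ be the subgroup generated by the $s_i$, $1\le i<N$, with $\alpha_i\in\bar R_{\beta,+}$. Let $W^\beta=\{w\in W\mid l(wu)\ge l(w)\ \forall u\in\bar W_\beta\}$ and $\bar W^\beta=W^\beta\cap\bar W$. Let $\bar P_-=\{\eta\in\bar P\mid(\eta,\alpha)\le0\ \forall\alpha\in\bar R_+\}$. For $w\in\bar W^\beta$ let $\eta_w\in\bar P_-$ be given by $(\eta_w,\epsilon_1)=0$ and, for $1\le i<N$, $(\eta_w,\alpha_i)=-1$ if $\alpha_i\in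 w(\bar R_+\setminus\bar R_{\beta,+})$ and $(\eta_w,\alpha_i)=0$ otherwise. Put $X^\beta=\{t_{\eta+\eta_w}w\mid w\in\bar W^\beta,\ \eta\in\bar P_-\}$. Let $\zeta\in(\mathfrak t')^*$ satisfy $(\zeta,\alpha_i)=-1$ whenever $1\le i<N$ and $\alpha_i\in\bar R_{\beta,+}$. Let $\mathcal Y_\beta(\zeta)=\mathcal H\otimes_{\mathcal H_\beta}\mathbb C1_\zeta$, where $\mathcal H_\beta$ is the subalgebra generated by $\bar W_\beta$ and $\mathfrak t'$, which acts by $u1_\zeta=1_\zeta$ $(u\in\bar W_\beta)$ and $\xi1_\zeta=\zeta(\xi)1_\zeta$ $(\xi\in\mathfrak t')$, and let $\mathbf 1_\zeta=1\otimes1_\zeta$. For an $\mathcal H$-module $V$ and a character $\chi:S[\mathfrak t']^{\bar W}\to\mathbb C$ let $V^{\bar W}=\{v\in V\mid wv=v\ \forall w\in\bar W\}$ and $V^{\bar W}_\chi=\{v\in V^{\bar W}\mid pv=\chi(p)v\ \forall p\in S[\mathfrak t']^{\bar W}\}$. For $\zeta'\in(\mathfrak t')^*$ let $[\zeta']:S[\mathfrak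 t']^{\bar W}\to\mathbb C$ be the evaluation at $\zeta'$. Suppose that $\zeta$ is $\beta$-generic, that is, $(\zeta,\alpha)\notin\{1,0,-1\}$ for every $\alpha\in\bigcup_{w\in W^\beta}S(w)$, and that $(\zeta,\delta)\ne0$. Then $$\mathcal Y_\beta(\zeta)^{\bar W}=\bigoplus_{x\in X^\beta}\mathcal Y_\beta(\zeta)^{\bar W}_{[x(\zeta)]}.$$ Moreover, every $x\in X^\beta$ has a reduced expression, and for every reduced expression of $x$, with $\varphi_x$ formed from it, $$\mathcal Y_\beta(\zeta)^{\bar W}_{[x(\zeta)]}=\mathbb C\,Q\varphi_x\mathbf 1_\zeta\neq0.$$ -/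

import Mathlib

noncomputable section

namespace DDAHA

/-! ### The extended affine Weyl group

Indices are shifted by one: the index `i : Fin N` of a coordinate stands for `i + 1`, so
`ε_1, …, ε_N` are the coordinates `0, …, N - 1`. -/

/-- The weight lattice `P̄ = ⨁ ℤ ε_i`. -/
abbrev PBar (N : ℕ) := Fin N → ℤ

/-- The finite Weyl group `W̄`, the symmetric group. -/
abbrev WBar (N : ℕ) := Equiv.Perm (Fin N)

/-- The action of `W̄` on the group `P̄`: `σ (ε_i) = ε_{σ i}`. -/
def permAction (N : ℕ) : WBar N →* MulAut (Multiplicative (PBar N)) where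
  toFun σ :=
    { toFun := fun η => Multiplicative.ofAdd fun i => η.toAdd (σ⁻¹ i)
      invFun := fun η => Multiplicative.ofAdd fun i => η.toAdd (σ i)
      left_inv := fun η => by
        apply Multiplicative.toAdd.injective
        funext i
        simp
      right_inv := fun η => by
        apply Multiplicative.toAdd.injective
        funext i
        simp
      map_mul' := fun _ _ => rfl }
  map_one' := rfl
  map_mul' := fun _ _ => rfl

/-- The extended affine Weyl group `W = W̄ ⋉ P̄`. The element `⟨η, σ⟩` is `t_η · σ`. -/
abbrev W (N : ℕ) := SemidirectProduct (Multiplicative (PBar N)) (WBar N) (permAction N)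

/-- The translation `t_η`. -/
def transl {N : ℕ} (η : PBar N) : W N := SemidirectProduct.inl (Multiplicative.ofAdd η)

/-- The inclusion of `W̄` in `W`. -/
def ofPerm {N : ℕ} : WBar N →* W N := SemidirectProduct.inr

/-- The vector part `η` of `t_η · σ`. -/
def vec {N : ℕ} (w : W N) : PBar N := w.left.toAdd

/-- The permutation part `σ` of `t_η · σ`. -/
def perm {N : ℕ} (w : W N) : WBar N := w.right

/-- The element `ε_i` of `P̄`. -/
def eps {N : ℕ} (i : Fin N) : PBar N := Pi.single i 1

/-- The affine reflection `s_α = t_{-kᾱ} · s_ᾱ` for `α = ε_i - ε_j + k δ`. -/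
def affRefl {N : ℕ} (i j : Fin N) (k : ℤ) : W N :=
  transl (-k • (eps i - eps j)) * ofPerm (Equiv.swap i j)

/-! ### Affine roots and length -/

/-- The lattice `P̄ ⊕ ℤ δ`, in which the roots live; `(l, k)` stands for `l + k δ`. -/
abbrev RootLat (N : ℕ) := PBar N × ℤ

/-- The action of `W` on `P̄ ⊕ ℤ δ ⊂ 𝔱^*`: `σ (ε_i) = ε_{σ i}`, `σ (δ) = δ`,
`t_η (l + k δ) = l + (k - (η, l)) δ`. -/
def rootAct {N : ℕ} (w : W N) (a : RootLat N) : RootLat N :=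
  (fun i => a.1 ((perm w)⁻¹ i), a.2 - ∑ i, vec w i * a.1 ((perm w)⁻¹ i))

/-- The positive affine roots `ε_i - ε_j + k δ`, with `k ≥ 0` if `i < j`, and `k > 0` if `j < i`. -/
def posRoots (N : ℕ) : Set (RootLat N) :=
  {a | ∃ (i j : Fin N) (k : ℤ), ((i < j ∧ 0 ≤ k) ∨ (j < i ∧ 0 < k)) ∧ a = (eps i - eps j, k)}

/-- The affine roots `ε_i - ε_j + k δ`, `i ≠ j`. -/
def roots (N : ℕ) : Set (RootLat N) :=
  {a | ∃ (i j : Fin N) (k : ℤ), i ≠ j ∧ a = (eps i - eps j, k)}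

/-- `S(w) = R_+ ∩ w⁻¹(R_-)`, where `R_- = R \ R_+`. -/
def invSet {N : ℕ} (w : W N) : Set (RootLat N) :=
  {a | a ∈ posRoots N ∧ rootAct w a ∈ roots N \ posRoots N}

/-- The length `l(w) = #S(w)`. -/
def length {N : ℕ} (w : W N) : ℕ := (invSet w).ncard

/-! ### The Cartan subalgebra `𝔱'` -/

/-- `𝔱' = 𝔱̄ ⊕ ℂ c`; the pair `(h, z)` stands for `∑ h_i ε_i^∨ + z c`. -/
abbrev TPrime (N : ℕ) := (Fin N → ℂ) × ℂ

/-- The central element `c` of `𝔱'`. -/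
def cElt (N : ℕ) : TPrime N := (0, 1)

/-- The action of `W` on `𝔱'`: `σ (ε_i^∨) = ε_{σ i}^∨`, `σ (c) = c`, `t_η (ξ) = ξ - η(ξ) c`. -/
def actT {N : ℕ} (w : W N) : TPrime N →ₗ[ℂ] TPrime N where
  toFun ξ := (fun i => ξ.1 ((perm w)⁻¹ i), ξ.2 - ∑ i, (vec w i : ℂ) * ξ.1 ((perm w)⁻¹ i))
  map_add' ξ ξ' := by
    ext <;> simp [mul_add, Finset.sum_add_distrib]
    ring
  map_smul' a ξ := by
    ext <;> simp [mul_sub, Finset.mul_sum, mul_left_comm]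

/-- The dual space `(𝔱')^*`. -/
abbrev TDual (N : ℕ) := Module.Dual ℂ (TPrime N)

/-- An element `η` of `P̄` as a linear functional on `𝔱'`. -/
def etaFun {N : ℕ} (η : PBar N) : TDual N :=
  ∑ i, (η i : ℂ) • ((LinearMap.proj i : (Fin N → ℂ) →ₗ[ℂ] ℂ) ∘ₗ
    LinearMap.fst ℂ (Fin N → ℂ) ℂ)

/-- The affine action of `W` on `(𝔱')^*`: `σ (ζ) = ζ ∘ σ⁻¹` and `t_η (ζ) = ζ + (δ, ζ) η`,
where `(δ, ζ) = ζ(c)`. -/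
def affAct {N : ℕ} (w : W N) (ζ : TDual N) : TDual N :=
  ζ ∘ₗ actT (ofPerm (perm w)⁻¹) + ζ (cElt N) • etaFun (vec w)

/-- The pairing `(ζ, l + k δ) = ζ(l^∨ + k c)`. -/
def pairing {N : ℕ} (ζ : TDual N) (a : RootLat N) : ℂ := ζ (fun i => (a.1 i : ℂ), (a.2 : ℂ))

/-! ### Simple reflections

The simple affine roots are indexed by `i : Fin N`, with subtraction modulo `N`:
for `i ≠ 0` the root `α_i` is `ε_i - ε_{i+1}` in one-based numbering,
and `α_0 = δ - (ε_1 - ε_N)`. -/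

section Simple

variable {N : ℕ} [NeZero N]

/-- The simple root `α_i`, `i = 0, …, N - 1`. -/
def simpleRoot (i : Fin N) : RootLat N := (eps (i - 1) - eps i, if i = 0 then 1 else 0)

/-- The simple reflection `s_i`, `i = 0, …, N - 1`. -/
def simpleRefl (i : Fin N) : W N := affRefl (i - 1) i (if i = 0 then 1 else 0)

/-- The coroot `α_i^∨ ∈ 𝔱'`. -/
def simpleCoroot (i : Fin N) : TPrime N :=
  (fun j => ((simpleRoot i).1 j : ℂ), ((simpleRoot i).2 : ℂ))

/-- The element `π = t_{ε_1} s_1 ⋯ s_{N-1}`; the product `s_1 ⋯ s_{N-1}` is the cyclic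
permutation `i ↦ i + 1`. -/
def piElt (N : ℕ) [NeZero N] : W N :=
  transl (eps (0 : Fin N)) * ofPerm (Equiv.addRight (1 : Fin N))

/-- `w = π^k s_{j_1} ⋯ s_{j_m}` is a reduced expression, that is, `m = l(w)`. -/
def IsReducedExpr (w : W N) (k : ℤ) (L : List (Fin N)) : Prop :=
  w = piElt N ^ k * (L.map simpleRefl).prod ∧ L.length = length w

end Simple

/-! ### The degenerate double affine Hecke algebra -/

section Algebra

variable (N : ℕ) [NeZero N]

/-- The defining relations: `W` and `𝔱'` generate copies of `ℂ[W]` and `S[𝔱']`, and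
`s_i ξ - s_i(ξ) s_i = -α_i(ξ)`, `π ξ = π(ξ) π`. Here `α_i` acts on `𝔱'` through its part
in `P̄`, since `δ` vanishes on `𝔱'`. -/
inductive Rel : FreeAlgebra ℂ (W N ⊕ TPrime N) → FreeAlgebra ℂ (W N ⊕ TPrime N) → Prop
  | w_one : Rel (FreeAlgebra.ι ℂ (Sum.inl 1)) 1
  | w_mul (u v : W N) : Rel (FreeAlgebra.ι ℂ (Sum.inl (u * v)))
      (FreeAlgebra.ι ℂ (Sum.inl u) * FreeAlgebra.ι ℂ (Sum.inl v))
  | t_add (ξ ξ' : TPrime N) : Rel (FreeAlgebra.ι ℂ (Sum.inr (ξ + ξ')))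
      (FreeAlgebra.ι ℂ (Sum.inr ξ) + FreeAlgebra.ι ℂ (Sum.inr ξ'))
  | t_smul (a : ℂ) (ξ : TPrime N) : Rel (FreeAlgebra.ι ℂ (Sum.inr (a • ξ)))
      (a • FreeAlgebra.ι ℂ (Sum.inr ξ))
  | t_comm (ξ ξ' : TPrime N) :
      Rel (FreeAlgebra.ι ℂ (Sum.inr ξ) * FreeAlgebra.ι ℂ (Sum.inr ξ'))
        (FreeAlgebra.ι ℂ (Sum.inr ξ') * FreeAlgebra.ι ℂ (Sum.inr ξ))
  | cross (i : Fin N) (ξ : TPrime N) :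
      Rel (FreeAlgebra.ι ℂ (Sum.inl (simpleRefl i)) * FreeAlgebra.ι ℂ (Sum.inr ξ)
          - FreeAlgebra.ι ℂ (Sum.inr (actT (simpleRefl i) ξ))
            * FreeAlgebra.ι ℂ (Sum.inl (simpleRefl i)))
        (-algebraMap ℂ _ (etaFun (simpleRoot i).1 ξ))
  | pi_cross (ξ : TPrime N) :
      Rel (FreeAlgebra.ι ℂ (Sum.inl (piElt N)) * FreeAlgebra.ι ℂ (Sum.inr ξ))
        (FreeAlgebra.ι ℂ (Sum.inr (actT (piElt N) ξ)) * FreeAlgebra.ι ℂ (Sum.inl (piElt N)))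

/-- The degenerate double affine Hecke algebra `ℋ`. -/
def Hecke := RingQuot (Rel N)

instance : Ring (Hecke N) := inferInstanceAs (Ring (RingQuot (Rel N)))

instance : Algebra ℂ (Hecke N) := inferInstanceAs (Algebra ℂ (RingQuot (Rel N)))

/-- The quotient map from the free algebra. -/
def Hecke.mk : FreeAlgebra ℂ (W N ⊕ TPrime N) →ₐ[ℂ] Hecke N := RingQuot.mkAlgHom ℂ (Rel N)

variable {N}

/-- The map `W → ℋ`. -/
def ofW : W N →* Hecke N where
  toFun w := Hecke.mk N (FreeAlgebra.ι ℂ (Sum.inl w))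
  map_one' := (RingQuot.mkAlgHom_rel ℂ Rel.w_one).trans (map_one (RingQuot.mkAlgHom ℂ (Rel N)))
  map_mul' u v := (RingQuot.mkAlgHom_rel ℂ (Rel.w_mul u v)).trans
    (map_mul (RingQuot.mkAlgHom ℂ (Rel N)) _ _)

/-- The map `𝔱' → ℋ`. -/
def ofT : TPrime N →ₗ[ℂ] Hecke N where
  toFun ξ := Hecke.mk N (FreeAlgebra.ι ℂ (Sum.inr ξ))
  map_add' ξ ξ' := (RingQuot.mkAlgHom_rel ℂ (Rel.t_add ξ ξ')).trans
    (map_add (RingQuot.mkAlgHom ℂ (Rel N)) _ _)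
  map_smul' a ξ := (RingQuot.mkAlgHom_rel ℂ (Rel.t_smul a ξ)).trans
    (map_smul (RingQuot.mkAlgHom ℂ (Rel N)) _ _)

theorem ofT_comm (ξ ξ' : TPrime N) : ofT ξ * ofT ξ' = ofT ξ' * ofT ξ :=
  ((map_mul (RingQuot.mkAlgHom ℂ (Rel N)) _ _).symm.trans
    (RingQuot.mkAlgHom_rel ℂ (Rel.t_comm ξ ξ'))).trans
    (map_mul (RingQuot.mkAlgHom ℂ (Rel N)) _ _)

/-- The algebra homomorphism `S[𝔱'] → ℋ` that extends `𝔱' → ℋ`. -/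
def ofSym : SymmetricAlgebra ℂ (TPrime N) →ₐ[ℂ] Hecke N :=
  RingCon.liftₐ (TensorAlgebra.symRingCon ℂ (TPrime N)) (TensorAlgebra.lift ℂ ofT) (by
    refine RingCon.ringConGen_le.2 fun x y h => ?_
    induction h with
    | mul_comm x y =>
      rw [RingCon.ker_apply]
      simp [ofT_comm x y])

theorem ofSym_ι (ξ : TPrime N) : ofSym (SymmetricAlgebra.ι ℂ (TPrime N) ξ) = ofT ξ := by
  exact TensorAlgebra.lift_ι_apply ofT ξ

/-- `φ_i = 1 + s_i α_i^∨`. -/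
def phiSimple (i : Fin N) : Hecke N := 1 + ofW (simpleRefl i) * ofT (simpleCoroot i)

/-- `φ_π^k φ_{j_1} ⋯ φ_{j_m}`, where `φ_π = π`. It is the intertwiner `φ_w` if
`w = π^k s_{j_1} ⋯ s_{j_m}` is a reduced expression. -/
def phiExpr (k : ℤ) (L : List (Fin N)) : Hecke N :=
  ofW (piElt N ^ k) * (L.map phiSimple).prod

/-- The symmetrizer `Q = (1 / N!) ∑_{σ ∈ W̄} σ`. -/
def symmetrizer (N : ℕ) [NeZero N] : Hecke N :=
  ((N.factorial : ℂ)⁻¹) • ∑ σ : WBar N, ofW (ofPerm σ)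

end Algebra

/-! ### Parabolic data attached to an ordered partition `β` of `N` -/

section Parabolic

variable {N : ℕ}

/-- `α_{ij} ∈ R̄_+ \ R̄_{β,+}`: `i < j`, and `i`, `j` lie in different blocks of `β`. -/
def PosNotBeta (β : Composition N) (i j : Fin N) : Prop := i < j ∧ β.index i ≠ β.index j

/-- The parabolic subgroup `W̄_β`, generated by the reflections `s_i` with `α_i ∈ Π̄_β`. -/
def parabolic [NeZero N] (β : Composition N) : Subgroup (WBar N) :=
  Subgroup.closure {σ | ∃ i : Fin N, i ≠ 0 ∧ β.index (i - 1) = β.index i ∧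
    σ = Equiv.swap (i - 1) i}

/-- `W^β = {w ∈ W | l(w u) ≥ l(w) for all u ∈ W̄_β}`. -/
def minReps [NeZero N] (β : Composition N) : Set (W N) :=
  {w | ∀ u ∈ parabolic β, length w ≤ length (w * ofPerm u)}

/-- `W̄^β = W^β ∩ W̄`. -/
def minRepsBar [NeZero N] (β : Composition N) : Set (WBar N) :=
  {σ | ofPerm σ ∈ minReps β}

/-- `P̄_- = {η | (η, α) ≤ 0 for all α ∈ R̄_+}`. -/
def antidominant (N : ℕ) : Set (PBar N) := {η | ∀ i j : Fin N, i < j → η i - η j ≤ 0}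

open Classical in
/-- The weight `η_σ`, characterized by `etaOf_zero` and `etaOf_step` below. -/
def etaOf [NeZero N] (β : Composition N) (σ : WBar N) : PBar N := fun m =>
  ((Finset.univ.filter fun j : Fin N =>
    j ≠ 0 ∧ j ≤ m ∧ PosNotBeta β (σ⁻¹ (j - 1)) (σ⁻¹ j)).card : ℤ)

/-- `(η_σ, ε_1) = 0`. -/
theorem etaOf_zero [NeZero N] (β : Composition N) (σ : WBar N) : etaOf β σ 0 = 0 := by
  simp only [etaOf, Nat.cast_eq_zero, Finset.card_eq_zero, Finset.filter_eq_empty_iff]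
  rintro j - ⟨h, h', -⟩
  exact h (Fin.ext (by simpa [Fin.le_def] using h'))

open Classical in
/-- `(η_σ, α_i) = -1` if `α_i ∈ σ(R̄_+ \ R̄_{β,+})`, and `(η_σ, α_i) = 0` otherwise. -/
theorem etaOf_step [NeZero N] (β : Composition N) (σ : WBar N) (i : Fin N) (hi : i ≠ 0) :
    etaOf β σ (i - 1) - etaOf β σ i =
      if PosNotBeta β (σ⁻¹ (i - 1)) (σ⁻¹ i) then -1 else 0 := by
  have hlt : ∀ j : Fin N, j ≤ i ↔ j ≤ i - 1 ∨ j = i := by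
    intro j
    have h1 : ((i - 1 : Fin N) : ℕ) = i - 1 := Fin.val_sub_one_of_ne_zero hi
    have h2 : (i : ℕ) ≠ 0 := fun h => hi (Fin.ext (by simpa using h))
    simp only [Fin.le_def, Fin.ext_iff, h1]
    omega
  have hni : ¬ i ≤ i - 1 := by
    have h1 : ((i - 1 : Fin N) : ℕ) = i - 1 := Fin.val_sub_one_of_ne_zero hi
    have h2 : (i : ℕ) ≠ 0 := fun h => hi (Fin.ext (by simpa using h))
    simp only [Fin.le_def, h1]
    omega
  split_ifs with h
  · have : (Finset.univ.filter fun j : Fin N =>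
        j ≠ 0 ∧ j ≤ i ∧ PosNotBeta β (σ⁻¹ (j - 1)) (σ⁻¹ j)) =
        insert i (Finset.univ.filter fun j : Fin N =>
          j ≠ 0 ∧ j ≤ i - 1 ∧ PosNotBeta β (σ⁻¹ (j - 1)) (σ⁻¹ j)) := by
      ext j
      simp only [Finset.mem_filter, Finset.mem_univ, true_and, Finset.mem_insert, hlt j]
      constructor
      · tauto
      · rintro (rfl | h')
        · exact ⟨hi, Or.inr rfl, h⟩
        · tauto
    simp only [etaOf]
    rw [this, Finset.card_insert_of_notMem (by simp [hni])]
    push_cast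
    ring
  · have : (Finset.univ.filter fun j : Fin N =>
        j ≠ 0 ∧ j ≤ i ∧ PosNotBeta β (σ⁻¹ (j - 1)) (σ⁻¹ j)) =
        (Finset.univ.filter fun j : Fin N =>
          j ≠ 0 ∧ j ≤ i - 1 ∧ PosNotBeta β (σ⁻¹ (j - 1)) (σ⁻¹ j)) := by
      ext j
      simp only [Finset.mem_filter, Finset.mem_univ, true_and, hlt j]
      constructor
      · rintro ⟨h1, h2 | rfl, h3⟩
        · exact ⟨h1, h2, h3⟩
        · exact absurd h3 h
      · tauto
    simp only [etaOf]
    rw [this]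
    ring

/-- `X^β = {t_η σ | σ ∈ W̄^β, η ∈ η_σ + P̄_-}`. -/
def XSet [NeZero N] (β : Composition N) : Set (W N) :=
  {x | ∃ σ ∈ minRepsBar β, ∃ η ∈ antidominant N, x = transl (η + etaOf β σ) * ofPerm σ}

/-- `(𝔱')^*_β = {ζ | (ζ, α) = -1 for all α ∈ Π̄_β}`. -/
def tBeta [NeZero N] (β : Composition N) : Set (TDual N) :=
  {ζ | ∀ i : Fin N, i ≠ 0 → β.index (i - 1) = β.index i → pairing ζ (simpleRoot i) = -1}

/-- `ζ` is `β`-generic: `(ζ, α) ∉ {1, 0, -1}` for all `α ∈ ⋃_{w ∈ W^β} S(w)`. -/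
def IsGeneric [NeZero N] (β : Composition N) (ζ : TDual N) : Prop :=
  ∀ w ∈ minReps β, ∀ a ∈ invSet w, pairing ζ a ∉ ({1, 0, -1} : Set ℂ)

/-- The left ideal of `ℋ` generated by `u - 1` (`u ∈ W̄_β`) and `ξ - ζ(ξ)` (`ξ ∈ 𝔱'`). -/
def inducedIdeal [NeZero N] (β : Composition N) (ζ : TDual N) : Submodule (Hecke N) (Hecke N) :=
  Submodule.span (Hecke N)
    ({h | ∃ u ∈ parabolic β, h = ofW (ofPerm u) - 1} ∪
      {h | ∃ ξ : TPrime N, h = ofT ξ - algebraMap ℂ (Hecke N) (ζ ξ)})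

/-- The induced module `𝒴_β(ζ) = ℋ ⊗_{ℋ_β} ℂ 1_ζ`, where `u 1_ζ = 1_ζ` for `u ∈ W̄_β` and
`ξ 1_ζ = ζ(ξ) 1_ζ` for `ξ ∈ 𝔱'`. As `ℋ_β` is generated by `W̄_β` and `𝔱'`, the annihilator of
`1_ζ` in `ℋ_β` is the left ideal generated by the `u - 1` and the `ξ - ζ(ξ)`, and so the induced
module is the quotient of `ℋ` by the left ideal of `ℋ` that they generate. -/
def Y [NeZero N] (β : Composition N) (ζ : TDual N) := Hecke N ⧸ inducedIdeal β ζ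

section Instances

variable [NeZero N] (β : Composition N) (ζ : TDual N)

instance : AddCommGroup (Y β ζ) := inferInstanceAs (AddCommGroup (Hecke N ⧸ inducedIdeal β ζ))

instance : Module (Hecke N) (Y β ζ) :=
  inferInstanceAs (Module (Hecke N) (Hecke N ⧸ inducedIdeal β ζ))

instance : Module ℂ (Y β ζ) := inferInstanceAs (Module ℂ (Hecke N ⧸ inducedIdeal β ζ))

instance : IsScalarTower ℂ (Hecke N) (Y β ζ) :=
  inferInstanceAs (IsScalarTower ℂ (Hecke N) (Hecke N ⧸ inducedIdeal β ζ))

/-- The cyclic vector `1_ζ` of `𝒴_β(ζ)`. -/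
def cyc : Y β ζ := (inducedIdeal β ζ).mkQ 1

/-- The universal property of the induced module: `ℋ`-linear maps `𝒴_β(ζ) → M` correspond to the
vectors of `M` on which `W̄_β` acts trivially and `𝔱'` acts through `ζ`. -/
theorem existsUnique_hom {M : Type*} [AddCommGroup M] [Module (Hecke N) M] (m : M)
    (hu : ∀ u ∈ parabolic β, (ofW (ofPerm u) : Hecke N) • m = m)
    (hξ : ∀ ξ : TPrime N, (ofT ξ : Hecke N) • m = algebraMap ℂ (Hecke N) (ζ ξ) • m) :
    ∃! f : Y β ζ →ₗ[Hecke N] M, f (cyc β ζ) = m := by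
  refine ⟨(inducedIdeal β ζ).liftQ (LinearMap.toSpanSingleton (Hecke N) M m) ?_, ?_, ?_⟩
  · refine Submodule.span_le.2 ?_
    rintro _ (⟨u, h, rfl⟩ | ⟨ξ, rfl⟩)
    · simp [sub_smul, hu u h]
    · simp [sub_smul, hξ ξ]
  · exact ((inducedIdeal β ζ).liftQ_apply _ _).trans (one_smul _ m)
  · intro f hf
    refine Submodule.linearMap_qext _ (LinearMap.ext_ring ?_)
    exact hf.trans (one_smul _ m).symm

end Instances

end Parabolic

/-! ### Symmetric parts and central characters -/

section Invariants

variable {N : ℕ}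

/-- The action of `σ ∈ W̄` on `S[𝔱']`. -/
def actSym (σ : WBar N) :
    SymmetricAlgebra ℂ (TPrime N) →ₐ[ℂ] SymmetricAlgebra ℂ (TPrime N) :=
  SymmetricAlgebra.lift (SymmetricAlgebra.ι ℂ (TPrime N) ∘ₗ actT (ofPerm σ))

/-- The algebra of invariants `S[𝔱']^W̄`. -/
def symInv (N : ℕ) : Subalgebra ℂ (SymmetricAlgebra ℂ (TPrime N)) :=
  ⨅ σ : WBar N, AlgHom.equalizer (actSym σ) (AlgHom.id ℂ _)

/-- The character `[ζ] : S[𝔱']^W̄ → ℂ`, evaluation at `ζ`. -/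
def evalChar (ζ : TDual N) : symInv N →ₐ[ℂ] ℂ :=
  (SymmetricAlgebra.lift ζ).comp (symInv N).val

variable [NeZero N] (V : Type*) [AddCommGroup V] [Module ℂ V] [Module (Hecke N) V]
  [IsScalarTower ℂ (Hecke N) V]

/-- The `W̄`-invariant part `V^W̄` of an `ℋ`-module `V`. -/
def invPart : Submodule ℂ V where
  carrier := {v | ∀ σ : WBar N, (ofW (ofPerm σ) : Hecke N) • v = v}
  add_mem' := fun ha hb σ => by rw [smul_add, ha σ, hb σ]
  zero_mem' := fun σ => smul_zero _
  smul_mem' := fun a v hv σ => by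
    rw [← algebraMap_smul (Hecke N) a v, smul_smul, ← Algebra.commutes, ← smul_smul, hv σ]

/-- `V^W̄_χ = {v ∈ V^W̄ | p v = χ(p) v for all p ∈ S[𝔱']^W̄}`. -/
def invEigen (χ : symInv N →ₐ[ℂ] ℂ) : Submodule ℂ V where
  carrier := {v | v ∈ invPart (N := N) V ∧
    ∀ p : symInv N, (ofSym (p : SymmetricAlgebra ℂ (TPrime N)) : Hecke N) • v = χ p • v}
  add_mem' := fun ha hb =>
    ⟨add_mem ha.1 hb.1, fun p => by rw [smul_add, smul_add, ha.2 p, hb.2 p]⟩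
  zero_mem' := ⟨zero_mem _, fun p => by rw [smul_zero, smul_zero]⟩
  smul_mem' := fun a v hv => ⟨Submodule.smul_mem _ a hv.1, fun p => by
    rw [← algebraMap_smul (Hecke N) a v, smul_smul, ← Algebra.commutes, ← smul_smul, hv.2 p,
      algebraMap_smul, algebraMap_smul, smul_comm]⟩

end Invariants

end DDAHA

end

noncomputable section

namespace DDAHA

/-! ### The extended affine Weyl group as a group of permutations of `ℤ` -/

section Affine

variable {N : ℕ}

/-! `W` acts on `ℤ` by affine permutations that commute with translation by `N`. A root is a pair of
incongruent integers `(a, b)` up to simultaneous translation, positive when `a < b`. Then `S(w)` is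
the set of inversions of `w`, and `W^β` consists of the `w` that increase on each block
(`mem_minReps_iff`).

For `w ∈ W^β` the vector `φ_w 1_ζ` has weight `w(ζ)`, and genericity makes it a nonzero multiple of
`w 1_ζ` plus terms `y 1_ζ` with `y` shorter (`phiExpr_leading`). Hence these vectors span the
module. They do not vanish because the module is large enough: `ℋ` acts on `ℂ[W]` by Dunkl
operators, this action descends to `ℂ[W / W̄_β]`, and indicator functions there read off leading
coefficients (`exists_functional`, `functional_leading`).

The weights are separated by `eq_of_weight_eq`. If `σ w(ζ) = w'(ζ)`, then `w'⁻¹ σ w` preserves the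
fibres of `a ↦ ζ(ε_a^∨)`. These are finite because `ζ(c) ≠ 0`, and `σ w` and `w'` both increase on
them by genericity, so `w'⁻¹ σ w = 1`. Hence each weight space is a line, and different reduced
expressions of `w` give proportional vectors; no braid relations are needed.

For `i ≠ 0`, `Q φ_i` acts on a vector of weight `μ` as `(1 + μ(α_i^∨)) Q`, with nonzero factor in
the generic situation. If `s_i w` leaves `W^β`, then `s_i w = w s_j` with `s_j ∈ W̄_β`. So the line
of `Q φ_w 1_ζ` depends only on `W̄ w W̄_β` (`symmetrizer_stdVec_connected`), and it is nonzero by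
looking at an element of minimal length. Every coset `W̄ w` with `w ∈ W^β` meets `X^β` exactly once
(`exists_mul_mem_XSet`, `XSet_unique`), so the lines for `x ∈ X^β` span the invariants. The
characters `[x(ζ)]` are distinct because invariant polynomials separate orbits; the eigenspaces are
therefore independent, and each equals the line it contains. -/

theorem perm_mul (u v : W N) : perm (u * v) = perm u * perm v := rfl

theorem vec_mul (u v : W N) (i : Fin N) :
    vec (u * v) i = vec u i + vec v ((perm u)⁻¹ i) := rfl

theorem perm_one : perm (1 : W N) = 1 := rfl

theorem vec_one (i : Fin N) : vec (1 : W N) i = 0 := rfl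

@[simp] theorem perm_ofPerm (σ : WBar N) : perm (ofPerm σ) = σ := rfl

@[simp] theorem vec_ofPerm (σ : WBar N) (i : Fin N) : vec (ofPerm σ) i = 0 := rfl

@[simp] theorem perm_transl_mul (η : PBar N) (σ : WBar N) :
    perm (transl η * ofPerm σ) = σ := one_mul σ

@[simp] theorem vec_transl_mul (η : PBar N) (σ : WBar N) (i : Fin N) :
    vec (transl η * ofPerm σ) i = η i := by
  rw [vec_mul, vec_ofPerm, add_zero]; rfl

theorem ext_W {u v : W N} (h : perm u = perm v) (h' : ∀ i, vec u i = vec v i) : u = v :=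
  SemidirectProduct.ext (Multiplicative.toAdd.injective (funext h')) h

theorem eps_sub_injective {i j i' j' : Fin N} (hij : i ≠ j)
    (h : (eps i - eps j : PBar N) = eps i' - eps j') : i = i' ∧ j = j' := by
  have h1 := congrFun h i
  have h2 := congrFun h j
  simp only [eps, Pi.sub_apply, Pi.single_apply, if_true, if_neg hij, if_neg hij.symm] at h1 h2
  constructor
  · by_contra hc
    rw [if_neg hc] at h1
    split_ifs at h1 <;> omega
  · by_contra hc
    rw [if_neg hc] at h2
    split_ifs at h2 <;> omega

theorem perm_affRefl (i j : Fin N) (k : ℤ) : perm (affRefl i j k) = Equiv.swap i j :=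
  perm_transl_mul _ _

theorem vec_affRefl (i j : Fin N) (k : ℤ) (m : Fin N) :
    vec (affRefl i j k) m = -k * ((eps i - eps j : PBar N) m) := by
  simp [affRefl]

/-- Division by `N` turns the order of `ℤ` into the lexicographic order of quotient and residue,
which is the order behind the definition of positive affine roots. -/
theorem lt_iff_fin (i j : Fin N) (k l : ℤ) :
    ((i : ℕ) : ℤ) + N * k < (j : ℕ) + N * l ↔ k < l ∨ (k = l ∧ i < j) := by
  have hi : ((i : ℕ) : ℤ) < N := by exact_mod_cast i.2
  have hj : ((j : ℕ) : ℤ) < N := by exact_mod_cast j.2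
  rcases lt_trichotomy k l with h | h | h
  · have : (N : ℤ) * (k + 1) ≤ N * l := mul_le_mul_of_nonneg_left h (by positivity)
    simp only [h, true_or, iff_true]
    linarith [Int.natCast_nonneg (j : ℕ)]
  · subst h
    rw [add_lt_add_iff_right, Int.ofNat_lt, Fin.val_fin_lt]
    simp
  · have : (N : ℤ) * (l + 1) ≤ N * k := mul_le_mul_of_nonneg_left h (by positivity)
    simp only [h.not_gt, h.ne', false_and, or_false, iff_false, not_lt]
    linarith [Int.natCast_nonneg (i : ℕ)]

variable [NeZero N]

/-! ### Integers modulo `N` and the action of `W` on `ℤ` -/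

theorem natCast_pos : (0 : ℤ) < N := by exact_mod_cast Nat.pos_of_neZero N

/-- The residue of an integer modulo `N`. -/
def res (N : ℕ) [NeZero N] (a : ℤ) : Fin N :=
  ⟨(a % N).toNat, by
    have h := Int.emod_lt_of_pos a (natCast_pos (N := N))
    have h' := Int.emod_nonneg a (natCast_pos (N := N)).ne'
    omega⟩

theorem res_val (a : ℤ) : ((res N a : ℕ) : ℤ) = a % N :=
  Int.toNat_of_nonneg (Int.emod_nonneg a (natCast_pos (N := N)).ne')

theorem res_add_mul_ediv (a : ℤ) : ((res N a : ℕ) : ℤ) + N * (a / N) = a := by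
  rw [res_val, Int.emod_add_mul_ediv]

@[simp] theorem res_fin (i : Fin N) (k : ℤ) : res N ((i : ℕ) + N * k) = i := by
  apply Fin.ext
  have h : (((i : ℕ) : ℤ) + N * k) % N = (i : ℕ) := by
    rw [Int.add_mul_emod_self_left]
    exact Int.emod_eq_of_lt (by positivity) (by exact_mod_cast i.2)
  have := res_val (N := N) ((i : ℕ) + N * k)
  rw [h] at this
  exact_mod_cast this

@[simp] theorem ediv_fin (i : Fin N) (k : ℤ) : (((i : ℕ) : ℤ) + N * k) / N = k := by
  rw [Int.add_mul_ediv_left _ _ (natCast_pos (N := N)).ne',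
    Int.ediv_eq_zero_of_lt (by positivity) (by exact_mod_cast i.2), zero_add]

@[simp] theorem res_coe (i : Fin N) : res N ((i : ℕ) : ℤ) = i := by
  simpa using res_fin i 0

@[simp] theorem ediv_coe (i : Fin N) : ((i : ℕ) : ℤ) / N = 0 := by
  simpa using ediv_fin i 0

@[simp] theorem res_add_mul (a k : ℤ) : res N (a + N * k) = res N a := by
  apply Fin.ext
  zify
  rw [res_val, res_val, Int.add_mul_emod_self_left]

@[simp] theorem ediv_add_mul (a k : ℤ) : (a + N * k) / N = a / N + k :=
  Int.add_mul_ediv_left _ _ (natCast_pos (N := N)).ne'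

theorem res_eq_iff {a b : ℤ} : res N a = res N b ↔ ∃ k : ℤ, b = a + N * k := by
  constructor
  · intro h
    refine ⟨b / N - a / N, ?_⟩
    have ha := res_add_mul_ediv (N := N) a
    have hb := res_add_mul_ediv (N := N) b
    rw [← h] at hb
    linarith
  · rintro ⟨k, rfl⟩
    simp

/-- Every integer is uniquely `i + N k` with `i : Fin N`. -/
theorem int_cases {P : ℤ → Prop} (h : ∀ (i : Fin N) (k : ℤ), P ((i : ℕ) + N * k)) (a : ℤ) :
    P a := by
  rw [← res_add_mul_ediv (N := N) a]
  exact h _ _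

/-- The action of `W` on `ℤ` by affine permutations, `t_η σ (i + N k) = σ i + N (k + η_{σ i})`. -/
def aff (w : W N) (a : ℤ) : ℤ :=
  ((perm w (res N a) : ℕ) : ℤ) + N * (a / N + vec w (perm w (res N a)))

theorem aff_fin (w : W N) (i : Fin N) (k : ℤ) :
    aff w ((i : ℕ) + N * k) = ((perm w i : ℕ) : ℤ) + N * (k + vec w (perm w i)) := by
  simp [aff]

theorem aff_coe (w : W N) (i : Fin N) :
    aff w ((i : ℕ) : ℤ) = ((perm w i : ℕ) : ℤ) + N * vec w (perm w i) := by
  simp [aff]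

theorem aff_mul (u v : W N) (a : ℤ) : aff (u * v) a = aff u (aff v a) := by
  induction a using int_cases (N := N) with
  | h i k =>
    simp only [aff_fin, perm_mul, vec_mul, Equiv.Perm.mul_apply, Equiv.Perm.inv_def,
      Equiv.symm_apply_apply]
    ring

@[simp] theorem aff_one (a : ℤ) : aff (1 : W N) a = a := by
  induction a using int_cases (N := N) with
  | h i k => simp [aff_fin, perm_one, vec_one]

@[simp] theorem aff_inv_aff (w : W N) (a : ℤ) : aff w⁻¹ (aff w a) = a := by
  rw [← aff_mul, inv_mul_cancel, aff_one]

@[simp] theorem aff_aff_inv (w : W N) (a : ℤ) : aff w (aff w⁻¹ a) = a := by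
  rw [← aff_mul, mul_inv_cancel, aff_one]

theorem aff_injective (w : W N) : Function.Injective (aff w) :=
  Function.LeftInverse.injective (aff_inv_aff w)

/-- The permutation of `ℤ` attached to an element of `W`. -/
def affEquiv (w : W N) : ℤ ≃ ℤ where
  toFun := aff w
  invFun := aff w⁻¹
  left_inv := aff_inv_aff w
  right_inv := aff_aff_inv w

@[simp] theorem aff_add_mul (w : W N) (a k : ℤ) : aff w (a + N * k) = aff w a + N * k := by
  induction a using int_cases (N := N) with
  | h i l =>
    rw [add_assoc, ← mul_add, aff_fin, aff_fin]
    ring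

@[simp] theorem res_aff (w : W N) (a : ℤ) : res N (aff w a) = perm w (res N a) := by
  simp [aff]

theorem aff_faithful {u v : W N} (h : ∀ i : Fin N, aff u ((i : ℕ) : ℤ) = aff v ((i : ℕ) : ℤ)) :
    u = v := by
  have hp : perm u = perm v := by
    ext i : 1
    have := congrArg (res N) (h i)
    simpa using this
  refine ext_W hp fun i => ?_
  have := congrArg (fun a : ℤ => a / N) (h ((perm u)⁻¹ i))
  simp only [aff_coe, ediv_fin] at this
  rw [← hp] at this
  simpa using this

/-! ### Affine roots as pairs of integers -/

/-- The affine root `ε_a - ε_b`, where `ε_{i + N k} = ε_i - k δ`. -/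
def root (N : ℕ) [NeZero N] (a b : ℤ) : RootLat N :=
  (eps (res N a) - eps (res N b), b / N - a / N)

theorem root_add_mul (a b k : ℤ) : root N (a + N * k) (b + N * k) = root N a b := by
  simp [root]

theorem root_swap (a b : ℤ) : root N b a = -root N a b := by
  simp [root]

/-- This fixes the sign in `ε_{i + N k} = ε_i - k δ`: since `t_η` sends `ε_i` to `ε_i - η_i δ`, it
has to move the integers of residue `i` up by `N η_i`. -/
theorem rootAct_root (w : W N) (a b : ℤ) :
    rootAct w (root N a b) = root N (aff w a) (aff w b) := by
  have h : ∀ (j i : Fin N), (eps j : PBar N) ((perm w)⁻¹ i) = eps (perm w j) i := by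
    intro j i
    simp only [eps, Pi.single_apply, Equiv.Perm.inv_eq_iff_eq]
  refine Prod.ext ?_ ?_
  · funext i
    simp only [rootAct, root, Pi.sub_apply, h, res_aff]
  · simp only [rootAct, root, Pi.sub_apply, h, mul_sub, Finset.sum_sub_distrib]
    have hs : ∀ j : Fin N, ∑ i, vec w i * (eps j : PBar N) i = vec w j := by
      intro j
      simp [eps, Pi.single_apply]
    rw [hs, hs]
    simp only [aff, ediv_fin]
    ring

theorem root_inj {a b a' b' : ℤ} (hab : res N a ≠ res N b) (h : root N a b = root N a' b') :
    ∃ k : ℤ, a' = a + N * k ∧ b' = b + N * k := by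
  obtain ⟨h1, h2⟩ := eps_sub_injective hab (congrArg Prod.fst h)
  have h3 : b / N - a / N = b' / N - a' / N := congrArg Prod.snd h
  refine ⟨a' / N - a / N, ?_, ?_⟩
  · have e1 := res_add_mul_ediv (N := N) a
    have e2 := res_add_mul_ediv (N := N) a'
    rw [← h1] at e2
    linarith
  · have e1 := res_add_mul_ediv (N := N) b
    have e2 := res_add_mul_ediv (N := N) b'
    rw [← h2] at e2
    have : a' / (N : ℤ) - a / N = b' / N - b / N := by linarith
    rw [this]
    linarith

theorem root_fin (i j : Fin N) (k l : ℤ) :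
    root N ((i : ℕ) + N * k) ((j : ℕ) + N * l) = (eps i - eps j, l - k) := by
  simp [root]

theorem mem_posRoots_iff {r : RootLat N} :
    r ∈ posRoots N ↔ ∃ a b : ℤ, a < b ∧ res N a ≠ res N b ∧ r = root N a b := by
  constructor
  · rintro ⟨i, j, k, h, rfl⟩
    refine ⟨(i : ℕ) + N * 0, (j : ℕ) + N * k, ?_, ?_, ?_⟩
    · rw [lt_iff_fin]
      omega
    · rw [res_fin, res_fin]
      rintro rfl
      simp at h
    · rw [root_fin, sub_zero]
  · rintro ⟨a, b, h, hn, rfl⟩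
    refine ⟨res N a, res N b, b / N - a / N, ?_, rfl⟩
    rw [← res_add_mul_ediv (N := N) a, ← res_add_mul_ediv (N := N) b, lt_iff_fin] at h
    have := lt_or_gt_of_ne hn
    omega

theorem root_mem_posRoots {a b : ℤ} (hn : res N a ≠ res N b) :
    root N a b ∈ posRoots N ↔ a < b := by
  rw [mem_posRoots_iff]
  constructor
  · rintro ⟨a', b', h, -, e⟩
    obtain ⟨k, rfl, rfl⟩ := root_inj hn e
    linarith
  · exact fun h => ⟨a, b, h, hn, rfl⟩

theorem root_mem_roots {a b : ℤ} (hn : res N a ≠ res N b) : root N a b ∈ roots N :=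
  ⟨res N a, res N b, b / N - a / N, hn, rfl⟩

theorem res_aff_ne (w : W N) {a b : ℤ} (hn : res N a ≠ res N b) :
    res N (aff w a) ≠ res N (aff w b) := by
  simpa using hn

theorem res_ne_of_inv (w : W N) {a b : ℤ} (h : a < b) (h' : aff w b < aff w a) :
    res N a ≠ res N b := by
  intro e
  obtain ⟨k, rfl⟩ := res_eq_iff.1 e
  rw [aff_add_mul] at h'
  linarith

theorem root_mem_invSet {w : W N} {a b : ℤ} (hn : res N a ≠ res N b) :
    root N a b ∈ invSet w ↔ a < b ∧ aff w b < aff w a := by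
  simp only [invSet, Set.mem_ofPred_eq, rootAct_root, root_mem_posRoots hn, Set.mem_sdiff,
    root_mem_roots (res_aff_ne w hn), root_mem_posRoots (res_aff_ne w hn), true_and, not_lt]
  refine and_congr_right fun _ => ⟨fun h => lt_of_le_of_ne h ?_, le_of_lt⟩
  intro e
  exact hn (congrArg (res N) (aff_injective w e)).symm

/-- Affine permutations preserve the order of congruent integers, so no condition on residues is
needed to describe inversions. -/
theorem mem_invSet_iff {w : W N} {r : RootLat N} :
    r ∈ invSet w ↔ ∃ a b : ℤ, a < b ∧ aff w b < aff w a ∧ r = root N a b := by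
  constructor
  · intro h
    obtain ⟨a, b, -, hn, rfl⟩ := mem_posRoots_iff.1 h.1
    exact ⟨a, b, ((root_mem_invSet hn).1 h).1, ((root_mem_invSet hn).1 h).2, rfl⟩
  · rintro ⟨a, b, h, h', rfl⟩
    exact (root_mem_invSet (res_ne_of_inv w h h')).2 ⟨h, h'⟩

theorem exists_aff_bound (w : W N) : ∃ C : ℤ, ∀ a, |aff w a - a| ≤ C := by
  refine ⟨∑ i : Fin N, |aff w ((i : ℕ) : ℤ) - (i : ℕ)|, fun a => ?_⟩
  induction a using int_cases (N := N) with
  | h i k =>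
    rw [aff_add_mul, add_sub_add_right_eq_sub]
    exact Finset.single_le_sum (f := fun i : Fin N => |aff w ((i : ℕ) : ℤ) - (i : ℕ)|)
      (fun _ _ => abs_nonneg _) (Finset.mem_univ i)

/-- Needed so that the `ncard` in `length` is a true count and not the default value `0`. A pair can
be translated to `0 ≤ a < N`, and an element that displaces integers by at most `C` inverts it only
if `b - a ≤ 2 C`. -/
theorem invSet_finite (w : W N) : (invSet w).Finite := by
  obtain ⟨C, hC⟩ := exists_aff_bound w
  refine ((Set.finite_Icc (0 : ℤ) N).prod (Set.finite_Icc (0 : ℤ) (N + 2 * C))).image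
    (fun p => root N p.1 p.2) |>.subset ?_
  intro r hr
  obtain ⟨a, b, h, h', rfl⟩ := mem_invSet_iff.1 hr
  have ea := res_add_mul_ediv (N := N) a
  have hlt : ((res N a : ℕ) : ℤ) < N := by exact_mod_cast (res N a).2
  refine ⟨(a + N * (-(a / N)), b + N * (-(a / N))), ⟨⟨?_, ?_⟩, ⟨?_, ?_⟩⟩,
    root_add_mul _ _ _⟩
  · simp only; linarith [Int.natCast_nonneg (res N a : ℕ)]
  · simp only; linarith
  · simp only; linarith [Int.natCast_nonneg (res N a : ℕ)]
  · have h1 := abs_le.1 (hC a)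
    have h2 := abs_le.1 (hC b)
    simp only
    linarith

/-! ### Reflections -/

/-- The reflection of `W` that exchanges the integers `a` and `b`. -/
def refl (N : ℕ) [NeZero N] (a b : ℤ) : W N := affRefl (res N a) (res N b) (b / N - a / N)

theorem refl_add_mul (a b k : ℤ) : refl N (a + N * k) (b + N * k) = refl N a b := by
  simp [refl]

theorem aff_refl_left {a b : ℤ} (hn : res N a ≠ res N b) : aff (refl N a b) a = b := by
  have := res_add_mul_ediv (N := N) b
  rw [aff, refl, perm_affRefl, vec_affRefl, Equiv.swap_apply_left]
  simp only [eps, Pi.sub_apply, Pi.single_eq_same, Pi.single_eq_of_ne hn.symm]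
  linarith

theorem aff_refl_right {a b : ℤ} (hn : res N a ≠ res N b) : aff (refl N a b) b = a := by
  have := res_add_mul_ediv (N := N) a
  rw [aff, refl, perm_affRefl, vec_affRefl, Equiv.swap_apply_right]
  simp only [eps, Pi.sub_apply, Pi.single_eq_same, Pi.single_eq_of_ne hn]
  linarith

theorem aff_refl_of_ne {a b c : ℤ} (ha : res N c ≠ res N a) (hb : res N c ≠ res N b) :
    aff (refl N a b) c = c := by
  have := res_add_mul_ediv (N := N) c
  rw [aff, refl, perm_affRefl, vec_affRefl, Equiv.swap_apply_of_ne_of_ne ha hb]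
  simp only [eps, Pi.sub_apply, Pi.single_eq_of_ne ha, Pi.single_eq_of_ne hb]
  linarith

/-- Conjugation carries the exchange of `a` and `b` to the exchange of their images; both sides are
compared on the classes of `a`, of `b`, and on the remaining integers. -/
theorem mul_refl (w : W N) {a b : ℤ} (hn : res N a ≠ res N b) :
    w * refl N a b = refl N (aff w a) (aff w b) * w := by
  have key : ∀ c : ℤ, aff (w * refl N a b) c = aff (refl N (aff w a) (aff w b) * w) c := by
    intro c
    rw [aff_mul, aff_mul]
    by_cases ha : res N a = res N c
    · obtain ⟨k, rfl⟩ := res_eq_iff.1 ha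
      rw [aff_add_mul, aff_refl_left hn, aff_add_mul, aff_add_mul, aff_add_mul,
        aff_refl_left (res_aff_ne w hn)]
    by_cases hb : res N b = res N c
    · obtain ⟨k, rfl⟩ := res_eq_iff.1 hb
      rw [aff_add_mul, aff_refl_right hn, aff_add_mul, aff_add_mul, aff_add_mul,
        aff_refl_right (res_aff_ne w hn)]
    rw [aff_refl_of_ne (Ne.symm ha) (Ne.symm hb),
      aff_refl_of_ne (res_aff_ne w (Ne.symm ha)) (res_aff_ne w (Ne.symm hb))]
  exact aff_faithful fun i => key _

/-- The quotient `-1` at `i = 0` accounts for the `δ` in `α_0`: for every `i`, zero included, `α_i`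
is the root of the pair `(i - 1, i)`. -/
theorem ediv_sub_one (i : Fin N) : (((i : ℕ) : ℤ) - 1) / N = if i = 0 then -1 else 0 := by
  have hN := natCast_pos (N := N)
  have hi : ((i : ℕ) : ℤ) < N := by exact_mod_cast i.2
  split_ifs with h
  · subst h
    rw [Int.ediv_eq_iff_of_pos hN]
    simp
    omega
  · have : (i : ℕ) ≠ 0 := fun e => h (Fin.ext (by simpa using e))
    exact Int.ediv_eq_zero_of_lt (by omega) (by omega)

theorem res_sub_one (i : Fin N) : res N (((i : ℕ) : ℤ) - 1) = i - 1 := by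
  have e := res_add_mul_ediv (N := N) (((i : ℕ) : ℤ) - 1)
  rw [ediv_sub_one] at e
  apply Fin.ext
  by_cases h : i = 0
  · subst h
    rw [if_pos rfl] at e
    have h1 : ((0 - 1 : Fin N) : ℕ) = N - 1 := by
      rcases N with _ | n
      · exact absurd rfl (NeZero.ne 0)
      · simp
    have := Nat.pos_of_neZero N
    have h2 : (((0 : Fin N) : ℕ) : ℤ) = 0 := by simp
    rw [h1]
    omega
  · rw [if_neg h] at e
    rw [Fin.val_sub_one_of_ne_zero h]
    have : (i : ℕ) ≠ 0 := fun e => h (Fin.ext (by simpa using e))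
    omega

theorem simpleRoot_eq (i : Fin N) : simpleRoot i = root N (((i : ℕ) : ℤ) - 1) (i : ℕ) := by
  simp only [simpleRoot, root, res_sub_one, res_coe, ediv_coe, ediv_sub_one]
  split_ifs <;> simp

theorem simpleRefl_eq (i : Fin N) : simpleRefl i = refl N (((i : ℕ) : ℤ) - 1) (i : ℕ) := by
  simp only [simpleRefl, refl, res_sub_one, res_coe, ediv_coe, ediv_sub_one]
  split_ifs <;> simp

theorem sub_one_ne (hN : N ≠ 1) (i : Fin N) : i - 1 ≠ i := by
  intro h
  have h2 : (1 : Fin N) = 0 := by simpa using h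
  have : NeZero N := inferInstance
  rcases N with _ | _ | n
  · exact absurd rfl (NeZero.ne 0)
  · exact hN rfl
  · exact absurd (congrArg Fin.val h2) (by simp)

/-- When `N = 1` the indices `i - 1` and `i` coincide and the reflection degenerates. This case has
to be split off wherever `s_i` is used as a true reflection. -/
theorem simpleRefl_eq_one (hN : N = 1) (i : Fin N) : simpleRefl i = 1 := by
  subst hN
  have h : i - 1 = i := Subsingleton.elim _ _
  simp only [simpleRefl, affRefl, h, sub_self, smul_zero, Equiv.swap_self]
  rfl

theorem res_simple_ne (hN : N ≠ 1) (i : Fin N) :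
    res N (((i : ℕ) : ℤ) - 1) ≠ res N ((i : ℕ) : ℤ) := by
  rw [res_sub_one, res_coe]
  exact sub_one_ne hN i

theorem res_eq_coe_iff {a : ℤ} {i : Fin N} : res N a = i ↔ ∃ k : ℤ, a = (i : ℕ) + N * k := by
  conv_lhs => rw [← res_coe i, eq_comm]
  exact res_eq_iff

theorem res_eq_sub_one_iff {a : ℤ} {i : Fin N} : res N a = i - 1 ↔ res N (a + 1) = i := by
  rw [← res_sub_one, eq_comm, res_eq_iff, res_eq_coe_iff]
  exact exists_congr fun k => by constructor <;> intro h <;> linarith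

theorem aff_simple_of_res_eq (hN : N ≠ 1) {i : Fin N} {a : ℤ} (h : res N a = i) :
    aff (simpleRefl i) a = a - 1 := by
  obtain ⟨k, rfl⟩ := res_eq_coe_iff.1 h
  rw [simpleRefl_eq, aff_add_mul, aff_refl_right (res_simple_ne hN i)]
  ring

theorem aff_simple_of_res_succ (hN : N ≠ 1) {i : Fin N} {a : ℤ} (h : res N (a + 1) = i) :
    aff (simpleRefl i) a = a + 1 := by
  obtain ⟨k, hk⟩ := res_eq_coe_iff.1 h
  obtain rfl : a = ((i : ℕ) : ℤ) - 1 + N * k := by linarith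
  rw [simpleRefl_eq, aff_add_mul, aff_refl_left (res_simple_ne hN i)]
  ring

theorem aff_simple_of_ne {i : Fin N} {a : ℤ} (h : res N a ≠ i) (h' : res N (a + 1) ≠ i) :
    aff (simpleRefl i) a = a := by
  rw [simpleRefl_eq]
  refine aff_refl_of_ne ?_ ?_
  · rwa [res_sub_one, Ne, res_eq_sub_one_iff]
  · rwa [res_coe]

theorem simpleRefl_mul_self (i : Fin N) : simpleRefl i * simpleRefl i = 1 := by
  by_cases hN : N = 1
  · rw [simpleRefl_eq_one hN, one_mul]
  have key : ∀ a : ℤ, aff (simpleRefl i) (aff (simpleRefl i) a) = a := by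
    intro a
    by_cases h : res N a = i
    · rw [aff_simple_of_res_eq hN h, aff_simple_of_res_succ hN (by simpa using h)]
      ring
    by_cases h' : res N (a + 1) = i
    · rw [aff_simple_of_res_succ hN h', aff_simple_of_res_eq hN h']
      ring
    rw [aff_simple_of_ne h h', aff_simple_of_ne h h']
  exact aff_faithful fun j => by rw [aff_mul, key, aff_one]

theorem simpleRefl_inv (i : Fin N) : (simpleRefl i)⁻¹ = simpleRefl i :=
  inv_eq_of_mul_eq_one_right (simpleRefl_mul_self i)

theorem simpleRefl_mul_cancel (i : Fin N) (w : W N) :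
    simpleRefl i * (simpleRefl i * w) = w := by
  rw [← mul_assoc, simpleRefl_mul_self, one_mul]

theorem aff_simple_aff (i : Fin N) (a : ℤ) :
    aff (simpleRefl i) (aff (simpleRefl i) a) = a := by
  rw [← aff_mul, simpleRefl_mul_self, aff_one]

theorem aff_simple_cases (i : Fin N) (a : ℤ) :
    (aff (simpleRefl i) a = a - 1 ∧ res N a = i) ∨
      (aff (simpleRefl i) a = a + 1 ∧ res N (a + 1) = i) ∨ aff (simpleRefl i) a = a := by
  by_cases hN : N = 1
  · right; right
    rw [simpleRefl_eq_one hN, aff_one]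
  by_cases h : res N a = i
  · exact Or.inl ⟨aff_simple_of_res_eq hN h, h⟩
  by_cases h' : res N (a + 1) = i
  · exact Or.inr (Or.inl ⟨aff_simple_of_res_succ hN h', h'⟩)
  exact Or.inr (Or.inr (aff_simple_of_ne h h'))

/-- A simple reflection inverts only neighbours. -/
theorem aff_simple_inv {i : Fin N} {a b : ℤ} (h : a < b)
    (h' : aff (simpleRefl i) b < aff (simpleRefl i) a) : b = a + 1 ∧ res N b = i := by
  have ha := aff_simple_cases i a
  have hb := aff_simple_cases i b
  rcases ha with ⟨ha, -⟩ | ⟨ha, -⟩ | ha <;> rcases hb with ⟨hb, hb'⟩ | ⟨hb, -⟩ | hb <;> omega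

theorem refl_eq_simpleRefl {i : Fin N} {a : ℤ} (h : res N (a + 1) = i) :
    refl N a (a + 1) = simpleRefl i := by
  obtain ⟨k, hk⟩ := res_eq_coe_iff.1 h
  obtain rfl : a = ((i : ℕ) : ℤ) - 1 + N * k := by linarith
  rw [simpleRefl_eq, ← refl_add_mul _ ((i : ℕ) : ℤ) k, hk]

theorem res_ne_succ (hN : N ≠ 1) (a : ℤ) : res N a ≠ res N (a + 1) := by
  intro h
  have := res_eq_sub_one_iff.2 h.symm
  exact sub_one_ne hN _ this.symm

theorem mul_simpleRefl (w : W N) (j : Fin N) {i : Fin N} {a b : ℤ} (hN : N ≠ 1)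
    (hb : res N b = j) (ha : b = a + 1) (h : aff w b = aff w a + 1)
    (hi : res N (aff w b) = i) : w * simpleRefl j = simpleRefl i * w := by
  subst ha
  rw [← refl_eq_simpleRefl hb, mul_refl w (res_ne_succ hN a), h, refl_eq_simpleRefl (h ▸ hi)]

/-- `π` is the shift of `ℤ` by one. -/
theorem aff_pi (a : ℤ) : aff (piElt N) a = a + 1 := by
  induction a using int_cases (N := N) with
  | h i k =>
    have hp : perm (piElt N) i = i + 1 := by simp [piElt]
    rw [aff_fin, hp]
    have e := res_sub_one (i + 1)
    have e2 := ediv_sub_one (i + 1)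
    have e3 := res_add_mul_ediv (N := N) (((i + 1 : Fin N) : ℕ) - 1 : ℤ)
    rw [e, e2] at e3
    have hv : vec (piElt N) (i + 1) = if i + 1 = 0 then 1 else 0 := by
      simp [piElt, eps, Pi.single_apply]
    rw [hv]
    simp only [add_sub_cancel_right] at e3
    split_ifs at e3 ⊢ <;> linarith

theorem aff_pi_zpow (k : ℤ) (a : ℤ) : aff (piElt N ^ k) a = a + k := by
  induction k using Int.induction_on generalizing a with
  | zero => simp
  | succ n ih => rw [zpow_add_one, aff_mul, aff_pi, ih]; ring
  | pred n ih =>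
    rw [zpow_sub_one, aff_mul, ih]
    have : aff (piElt N)⁻¹ a = a - 1 :=
      aff_injective (piElt N) (by rw [aff_aff_inv, aff_pi]; ring)
    rw [this]
    ring

end Affine

/-! ### Lengths and reduced expressions -/

section Length

variable {N : ℕ} [NeZero N]

theorem rootAct_injOn (w : W N) : Set.InjOn (rootAct w) (posRoots N) := by
  intro r hr r' hr' h
  obtain ⟨a, b, -, hn, rfl⟩ := mem_posRoots_iff.1 hr
  obtain ⟨a', b', -, -, rfl⟩ := mem_posRoots_iff.1 hr'
  rw [rootAct_root, rootAct_root] at h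
  obtain ⟨k, h1, h2⟩ := root_inj (res_aff_ne w hn) h
  rw [← aff_add_mul] at h1 h2
  rw [aff_injective w h1, aff_injective w h2, root_add_mul]

/-- The map `r ↦ -w r` is a bijection from `S(w)` to `S(w⁻¹)`. -/
theorem length_inv (w : W N) : length w⁻¹ = length w := by
  have h : invSet w⁻¹ = (fun r => -rootAct w r) '' invSet w := by
    ext r
    simp only [Set.mem_image, mem_invSet_iff]
    constructor
    · rintro ⟨a, b, h, h', rfl⟩
      exact ⟨root N (aff w⁻¹ b) (aff w⁻¹ a), ⟨_, _, h', by simpa using h, rfl⟩,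
        by rw [rootAct_root, ← root_swap, aff_aff_inv, aff_aff_inv]⟩
    · rintro ⟨_, ⟨a, b, h, h', rfl⟩, rfl⟩
      exact ⟨aff w b, aff w a, h', by simpa using h, by rw [rootAct_root, ← root_swap]⟩
  rw [length, h, Set.InjOn.ncard_image, length]
  intro r hr r' hr' e
  exact rootAct_injOn w hr.1 hr'.1 (neg_injective e)

/-- Since `s_i` inverts only neighbours, `S(s_i w)` is `S(w)` with the single root `w⁻¹ α_i` added
when that root is positive. -/
theorem length_simple_mul (hN : N ≠ 1) {w : W N} {i : Fin N}
    (h : aff w⁻¹ (((i : ℕ) : ℤ) - 1) < aff w⁻¹ ((i : ℕ) : ℤ)) :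
    length (simpleRefl i * w) = length w + 1 := by
  set a := aff w⁻¹ (((i : ℕ) : ℤ) - 1) with ha
  set b := aff w⁻¹ ((i : ℕ) : ℤ) with hb
  have hwa : aff w a = ((i : ℕ) : ℤ) - 1 := by simp [ha]
  have hwb : aff w b = ((i : ℕ) : ℤ) := by simp [hb]
  have hsa : aff (simpleRefl i) (((i : ℕ) : ℤ) - 1) = (i : ℕ) := by
    rw [aff_simple_of_res_succ hN (by simp)]; ring
  have hsb : aff (simpleRefl i) ((i : ℕ) : ℤ) = ((i : ℕ) : ℤ) - 1 :=
    aff_simple_of_res_eq hN (by simp)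
  -- A pair whose images are neighbours with upper residue `i` is a translate of `(a, b)`, hence
  -- defines the same root.
  have shift : ∀ {c d : ℤ}, aff w d = aff w c + 1 → res N (aff w d) = i →
      ∃ k : ℤ, c = a + N * k ∧ d = b + N * k := by
    intro c d h1 h2
    obtain ⟨k, hk⟩ := res_eq_coe_iff.1 h2
    refine ⟨k, aff_injective w ?_, aff_injective w ?_⟩
    · rw [aff_add_mul, hwa]; linarith
    · rw [aff_add_mul, hwb, hk]
  have hset : invSet (simpleRefl i * w) = insert (root N a b) (invSet w) := by
    ext r
    simp only [Set.mem_insert_iff, mem_invSet_iff]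
    constructor
    · rintro ⟨c, d, hcd, hw, rfl⟩
      rw [aff_mul, aff_mul] at hw
      rcases lt_or_ge (aff w d) (aff w c) with hlt | hge
      · exact Or.inr ⟨c, d, hcd, hlt, rfl⟩
      · have hlt : aff w c < aff w d :=
          lt_of_le_of_ne hge fun e => hcd.ne (aff_injective w e)
        obtain ⟨h1, h2⟩ := aff_simple_inv hlt hw
        obtain ⟨k, rfl, rfl⟩ := shift h1 h2
        exact Or.inl (root_add_mul _ _ _)
    · rintro (rfl | ⟨c, d, hcd, hw, rfl⟩)
      · exact ⟨a, b, h, by rw [aff_mul, aff_mul, hwa, hwb, hsa, hsb]; linarith, rfl⟩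
      · refine ⟨c, d, hcd, ?_, rfl⟩
        rw [aff_mul, aff_mul]
        by_contra hc
        have hlt := lt_of_le_of_ne (not_lt.1 hc)
          fun e => hcd.ne (aff_injective w (aff_injective _ e))
        obtain ⟨h1, h2⟩ := aff_simple_inv hw hlt
        obtain ⟨k, rfl, rfl⟩ := shift h1 h2
        linarith
  rw [length, hset, Set.ncard_insert_of_notMem _ (invSet_finite w), length]
  have hne : res N a ≠ res N b := by
    intro e
    have := congrArg (perm w) e
    rw [← res_aff, ← res_aff, hwa, hwb] at this
    exact res_simple_ne hN i this
  rw [root_mem_invSet hne, hwa, hwb]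
  omega

theorem length_simple_mul' (hN : N ≠ 1) {w : W N} {i : Fin N}
    (h : aff w⁻¹ ((i : ℕ) : ℤ) < aff w⁻¹ (((i : ℕ) : ℤ) - 1)) :
    length (simpleRefl i * w) + 1 = length w := by
  have := length_simple_mul hN (w := simpleRefl i * w) (i := i) (by
    rw [mul_inv_rev, simpleRefl_inv, aff_mul, aff_mul,
      aff_simple_of_res_succ hN (by simp), aff_simple_of_res_eq hN (by simp)]
    simpa using h)
  rw [simpleRefl_mul_cancel] at this
  exact this.symm

theorem aff_lt_or_gt (w : W N) {a b : ℤ} (h : a ≠ b) : aff w a < aff w b ∨ aff w b < aff w a :=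
  lt_or_gt_of_ne fun e => h (aff_injective w e)

theorem length_simple_mul_le (w : W N) (i : Fin N) :
    length (simpleRefl i * w) ≤ length w + 1 := by
  by_cases hN : N = 1
  · rw [simpleRefl_eq_one hN, one_mul]
    exact Nat.le_succ _
  rcases aff_lt_or_gt w⁻¹ (sub_one_lt ((i : ℕ) : ℤ)).ne with h | h
  · exact (length_simple_mul hN h).le
  · have := length_simple_mul' hN h
    omega

theorem length_mul_simple (hN : N ≠ 1) {w : W N} {j : Fin N}
    (h : aff w ((j : ℕ) : ℤ) < aff w (((j : ℕ) : ℤ) - 1)) :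
    length (w * simpleRefl j) + 1 = length w := by
  rw [← length_inv (w * _), ← length_inv w, mul_inv_rev, simpleRefl_inv]
  exact length_simple_mul' hN (by simpa using h)

@[simp] theorem length_one : length (1 : W N) = 0 := by
  rw [length, Set.ncard_eq_zero (invSet_finite _), Set.eq_empty_iff_forall_notMem]
  intro r hr
  obtain ⟨a, b, h, h', -⟩ := mem_invSet_iff.1 hr
  simp only [aff_one] at h'
  linarith

@[simp] theorem length_pi_mul (k : ℤ) (w : W N) : length (piElt N ^ k * w) = length w := by
  have : invSet (piElt N ^ k * w) = invSet w := by
    ext r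
    simp [mem_invSet_iff, aff_mul, aff_pi_zpow]
  rw [length, this, length]

theorem length_prod_le (L : List (Fin N)) : length (L.map simpleRefl).prod ≤ L.length := by
  induction L with
  | nil => simp
  | cons i L ih =>
    rw [List.map_cons, List.prod_cons, List.length_cons]
    exact (length_simple_mul_le _ i).trans (by omega)

theorem length_eq_zero_of_eq_one (hN : N = 1) (w : W N) : length w = 0 := by
  subst hN
  rw [length, Set.ncard_eq_zero (invSet_finite _), Set.eq_empty_iff_forall_notMem]
  intro r hr
  obtain ⟨a, b, h, h', -⟩ := mem_invSet_iff.1 hr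
  exact res_ne_of_inv w h h' (Subsingleton.elim _ _)

/-- An affine permutation without descents is a power of `π`. -/
theorem eq_pi_zpow {w : W N} (h : ∀ a, aff w a < aff w (a + 1)) : ∃ k : ℤ, w = piElt N ^ k := by
  have hmono : StrictMono (aff w) := strictMono_int_of_lt_succ h
  have hstep : ∀ a, aff w (a + 1) = aff w a + 1 := by
    intro a
    have h1 := h a
    -- A value skipped between those at `a` and `a + 1` would be attained at an integer strictly
    -- between `a` and `a + 1`.
    by_contra hne
    have h2 : aff w a < aff w (aff w⁻¹ (aff w a + 1)) := by simp
    have h3 : aff w (aff w⁻¹ (aff w a + 1)) < aff w (a + 1) := by rw [aff_aff_inv]; omega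
    rw [hmono.lt_iff_lt] at h2 h3
    omega
  refine ⟨aff w 0, aff_faithful fun i => ?_⟩
  rw [aff_pi_zpow]
  induction (i : ℕ) with
  | zero => simp
  | succ n ih => push_cast; rw [hstep, ih]; ring

/-- A descent at `(a, a + 1)` is removed by right multiplication with `s_i`, where `i` is the
residue of `a + 1`, and the length drops by one. An element without descents is a power of `π`. -/
theorem exists_reduced (w : W N) : ∃ (k : ℤ) (L : List (Fin N)), IsReducedExpr w k L := by
  induction hn : length w using Nat.strong_induction_on generalizing w with
  | _ n ih =>
    by_cases h : ∀ a, aff w a < aff w (a + 1)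
    · obtain ⟨k, rfl⟩ := eq_pi_zpow h
      refine ⟨k, [], by simp, ?_⟩
      rw [← mul_one (piElt N ^ k), length_pi_mul, length_one, List.length_nil]
    · push Not at h
      obtain ⟨a, ha⟩ := h
      have hlt := lt_of_le_of_ne ha fun e => (lt_add_one a).ne' (aff_injective w e)
      have hN : N ≠ 1 := by
        rintro rfl
        exact res_ne_of_inv w (lt_add_one a) hlt (Subsingleton.elim _ _)
      obtain ⟨k, hk⟩ := res_eq_coe_iff.1 (rfl : res N (a + 1) = _)
      have ha' : a = (((res N (a + 1) : ℕ) : ℤ) - 1) + N * k := by linarith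
      rw [hk] at hlt
      have hlt2 : aff w ((res N (a + 1) : ℕ) : ℤ) < aff w (((res N (a + 1) : ℕ) : ℤ) - 1) := by
        have e1 := aff_add_mul w ((res N (a + 1) : ℕ) : ℤ) k
        have e2 := aff_add_mul w (((res N (a + 1) : ℕ) : ℤ) - 1) k
        rw [← ha'] at e2
        linarith
      have hl := length_mul_simple hN hlt2
      obtain ⟨l, L, hL, hL'⟩ := ih _ (by omega) (w * simpleRefl (res N (a + 1))) rfl
      refine ⟨l, L ++ [res N (a + 1)], ?_, ?_⟩
      · rw [List.map_append, List.prod_append, ← mul_assoc, ← hL]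
        simp [mul_assoc, simpleRefl_mul_self]
      · rw [List.length_append, hL', List.length_singleton, hl]

/-- `W` is generated by the `s_i` and the powers of `π`. -/
theorem W_induction {P : W N → Prop} (one : P 1) (simple : ∀ i w, P w → P (simpleRefl i * w))
    (pi : ∀ (k : ℤ) w, P w → P (piElt N ^ k * w)) (w : W N) : P w := by
  obtain ⟨k, L, rfl, -⟩ := exists_reduced w
  refine pi k _ ?_
  clear k
  induction L with
  | nil => exact one
  | cons i L ih => exact simple i _ ih

end Length

/-! ### Minimal coset representatives -/

section Cosets

variable {N : ℕ} {β : Composition N}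

theorem index_mono {p q : Fin N} (h : p ≤ q) : β.index p ≤ β.index q := by
  by_contra hc
  have h1 := β.sizeUpTo_index_le p
  have h2 := β.lt_sizeUpTo_index_succ q
  have h3 : β.sizeUpTo (β.index q).succ ≤ β.sizeUpTo (β.index p) :=
    β.monotone_sizeUpTo (Fin.lt_def.1 (not_le.1 hc))
  rw [Fin.le_def] at h
  omega

theorem lt_of_index_lt {p q : Fin N} (h : β.index p < β.index q) : p < q := by
  by_contra hc
  exact absurd (index_mono (β := β) (not_lt.1 hc)) (not_le.2 h)

theorem index_eq_of_between {p m q : Fin N} (h : p ≤ m) (h' : m ≤ q)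
    (e : β.index p = β.index q) : β.index p = β.index m ∧ β.index m = β.index q := by
  have h1 := index_mono (β := β) h
  have h2 := index_mono (β := β) h'
  exact ⟨le_antisymm h1 (e ▸ h2), le_antisymm h2 (e ▸ h1)⟩

theorem perm_apply_inv (σ : WBar N) (p : Fin N) : σ (σ⁻¹ p) = p := by simp

theorem perm_inv_apply (σ : WBar N) (p : Fin N) : σ⁻¹ (σ p) = p := by simp

theorem perm_eq_one_of_strictMono {u : WBar N} (h : StrictMono u) : u = 1 := by
  ext i : 1
  exact DFunLike.congr_fun (Subsingleton.elim (h.orderIsoOfSurjective u u.surjective)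
    (OrderIso.refl (Fin N))) i

variable [NeZero N]

theorem val_sub_one {j : Fin N} (hj : j ≠ 0) : ((j - 1 : Fin N) : ℕ) + 1 = j := by
  rw [Fin.val_sub_one_of_ne_zero hj]
  have : (j : ℕ) ≠ 0 := fun e => hj (Fin.ext (by simpa using e))
  omega

theorem coe_sub_one {j : Fin N} (hj : j ≠ 0) : (((j - 1 : Fin N) : ℕ) : ℤ) = ((j : ℕ) : ℤ) - 1 := by
  have := val_sub_one hj
  omega

theorem ne_one_of_ne_zero {j : Fin N} (hj : j ≠ 0) : N ≠ 1 := by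
  rintro rfl
  exact hj (Subsingleton.elim _ _)

/-- A relation on `Fin N` that holds for neighbours and is transitive along `<` holds
for all pairs `p < q`. -/
theorem chain_lt {S : Fin N → Fin N → Prop} (adj : ∀ j : Fin N, j ≠ 0 → S (j - 1) j)
    (trans : ∀ p m q, p < m → m < q → S p m → S m q → S p q) {p q : Fin N} (h : p < q) :
    S p q := by
  induction hn : (q : ℕ) generalizing q with
  | zero => rw [Fin.lt_def] at h; omega
  | succ n ih =>
    have hq : q ≠ 0 := fun e => by subst e; simp at hn
    have hv := val_sub_one hq
    rcases eq_or_ne p (q - 1) with rfl | hne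
    · exact adj q hq
    · have hne' : (p : ℕ) ≠ (q - 1 : Fin N) := fun e => hne (Fin.ext e)
      rw [Fin.lt_def] at h
      have h1 : p < q - 1 := by rw [Fin.lt_def]; omega
      refine trans p (q - 1) q h1 (by rw [Fin.lt_def]; omega) (ih h1 (by omega)) (adj q hq)

theorem chain_block {S : Fin N → Fin N → Prop}
    (adj : ∀ j : Fin N, j ≠ 0 → β.index (j - 1) = β.index j → S (j - 1) j)
    (trans : ∀ p m q, p < m → m < q → S p m → S m q → S p q) {p q : Fin N} (h : p < q)
    (e : β.index p = β.index q) : S p q := by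
  refine chain_lt (S := fun p q => β.index p = β.index q → S p q) adj ?_ h e
  intro p m q h h' h1 h2 e
  obtain ⟨e1, e2⟩ := index_eq_of_between h.le h'.le e
  exact trans p m q h h' (h1 e1) (h2 e2)

theorem parabolic_index {u : WBar N} (hu : u ∈ parabolic β) (p : Fin N) :
    β.index (u p) = β.index p := by
  induction hu using Subgroup.closure_induction generalizing p with
  | mem σ hσ =>
    obtain ⟨i, -, e, rfl⟩ := hσ
    rw [Equiv.swap_apply_def]
    split_ifs with h1 h2
    · rw [h1, e]
    · rw [h2, e]
    · rfl
  | one => rfl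
  | mul σ τ _ _ h1 h2 => rw [Equiv.Perm.mul_apply, h1, h2]
  | inv σ _ h => rw [← h (σ⁻¹ p), perm_apply_inv]

theorem swap_mem_parabolic {j : Fin N} (hj : j ≠ 0) (e : β.index (j - 1) = β.index j) :
    Equiv.swap (j - 1) j ∈ parabolic β :=
  Subgroup.subset_closure ⟨j, hj, e, rfl⟩

theorem ofPerm_swap {j : Fin N} (hj : j ≠ 0) :
    ofPerm (Equiv.swap (j - 1) j) = (simpleRefl j : W N) := by
  refine ext_W (perm_affRefl _ _ _).symm fun i => ?_
  rw [vec_ofPerm, simpleRefl, vec_affRefl, if_neg hj, neg_zero, zero_mul]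

theorem aff_ofPerm (σ : WBar N) (i : Fin N) (k : ℤ) :
    aff (ofPerm σ) ((i : ℕ) + N * k) = ((σ i : ℕ) : ℤ) + N * k := by
  rw [aff_fin, perm_ofPerm, vec_ofPerm, add_zero]

theorem aff_ofPerm_coe (σ : WBar N) (i : Fin N) :
    aff (ofPerm σ) ((i : ℕ) : ℤ) = ((σ i : ℕ) : ℤ) := by
  simpa using aff_ofPerm σ i 0

/-- `w ∈ W^β` if and only if `w` maps the positive roots of `W̄_β` to positive roots. -/
theorem mem_minReps_iff {w : W N} : w ∈ minReps β ↔
    ∀ p q : Fin N, p < q → β.index p = β.index q →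
      aff w ((p : ℕ) : ℤ) < aff w ((q : ℕ) : ℤ) := by
  constructor
  · intro hw p q h e
    refine chain_block (S := fun p q => aff w ((p : ℕ) : ℤ) < aff w ((q : ℕ) : ℤ)) ?_
      (fun _ _ _ _ _ => lt_trans) h e
    intro j hj ej
    by_contra hc
    rw [coe_sub_one hj] at hc
    rcases aff_lt_or_gt w (sub_one_lt ((j : ℕ) : ℤ)).ne with h1 | h1
    · exact hc h1
    · have h2 := hw _ (swap_mem_parabolic hj ej)
      have h3 := length_mul_simple (ne_one_of_ne_zero hj) h1
      rw [ofPerm_swap hj] at h2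
      omega
  · intro hw u hu
    -- `u⁻¹` embeds `S(w)` into `S(w u)`. Positivity survives because an inversion of `w` whose two
    -- entries have the same quotient by `N` joins different blocks, and `u⁻¹` preserves each block.
    refine Set.ncard_le_ncard_of_injOn (rootAct (ofPerm u⁻¹)) ?_ ?_ (invSet_finite _)
    · intro r hr
      obtain ⟨a, b, h, h', rfl⟩ := mem_invSet_iff.1 hr
      rw [rootAct_root]
      refine mem_invSet_iff.2 ⟨_, _, ?_, ?_, rfl⟩
      · rw [← res_add_mul_ediv (N := N) a, ← res_add_mul_ediv (N := N) b, aff_ofPerm, aff_ofPerm,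
          lt_iff_fin]
        rw [← res_add_mul_ediv (N := N) a, ← res_add_mul_ediv (N := N) b, lt_iff_fin] at h
        refine h.imp_right fun ⟨h1, h2⟩ => ⟨h1, ?_⟩
        have hne : β.index (res N a) ≠ β.index (res N b) := by
          intro e
          have := hw _ _ h2 e
          rw [← res_add_mul_ediv (N := N) a, ← res_add_mul_ediv (N := N) b, aff_add_mul,
            aff_add_mul, h1] at h'
          linarith
        refine lt_of_index_lt (β := β) ?_
        rw [parabolic_index (inv_mem hu), parabolic_index (inv_mem hu)]
        exact lt_of_le_of_ne (index_mono h2.le) hne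
      · rw [map_inv, aff_mul, aff_mul, aff_aff_inv, aff_aff_inv]
        exact h'
    · exact (rootAct_injOn _).mono fun r hr => hr.1

theorem exists_minRep (β : Composition N) (y : W N) :
    ∃ u ∈ parabolic β, y * ofPerm u ∈ minReps β ∧ length (y * ofPerm u) ≤ length y := by
  obtain ⟨u, hu, hmin⟩ := exists_minimalFor_of_wellFoundedLT (fun u => u ∈ parabolic β)
    (fun u => length (y * ofPerm u)) ⟨1, one_mem _⟩
  have hle : ∀ v ∈ parabolic β, length (y * ofPerm u) ≤ length (y * ofPerm v) := by
    intro v hv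
    rcases le_total (length (y * ofPerm u)) (length (y * ofPerm v)) with h | h
    · exact h
    · exact hmin hv h
  refine ⟨u, hu, fun v hv => ?_, by simpa using hle 1 (one_mem _)⟩
  rw [mul_assoc, ← map_mul]
  exact hle _ (mul_mem hu hv)

/-- Both `w` and `w u` increase on blocks, so `u` increases on each block; as it preserves the
blocks, it increases everywhere. Only preservation of blocks is required of `u`, since `XSet_unique`
applies this to a permutation not known to lie in `W̄_β`. -/
theorem minReps_unique {w : W N} {u : WBar N} (hw : w ∈ minReps β)
    (hu : ∀ p, β.index (u p) = β.index p) (hwu : w * ofPerm u ∈ minReps β) : u = 1 := by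
  rw [mem_minReps_iff] at hw hwu
  refine perm_eq_one_of_strictMono fun p q h => ?_
  by_cases e : β.index p = β.index q
  · by_contra hc
    have hne : u q ≠ u p := fun e' => h.ne' (u.injective e')
    have h1 := hw _ _ (lt_of_le_of_ne (not_lt.1 hc) hne) (by rw [hu, hu, e])
    have h2 := hwu p q h e
    rw [aff_mul, aff_mul, aff_ofPerm_coe, aff_ofPerm_coe] at h2
    exact lt_asymm h1 h2
  · refine lt_of_index_lt (β := β) ?_
    rw [hu, hu]
    exact lt_of_le_of_ne (index_mono h.le) e

/-- Deodhar's lemma. `s_i` can disturb the order on a block only by inverting two neighbouring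
values of `w`. As `w` increases on the block, these values are taken at adjacent places `j - 1`,
`j`, and conjugation by `w` turns `s_j` into `s_i`. -/
theorem simple_mul_minReps {w : W N} (hw : w ∈ minReps β) (i : Fin N) :
    simpleRefl i * w ∈ minReps β ∨
      ∃ j : Fin N, j ≠ 0 ∧ β.index (j - 1) = β.index j ∧
        simpleRefl i * w = w * simpleRefl j := by
  by_contra hc
  push Not at hc
  obtain ⟨h1, h2⟩ := hc
  rw [mem_minReps_iff] at h1 hw
  push Not at h1
  obtain ⟨p, q, h, e, hpq⟩ := h1
  have hlt := hw p q h e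
  rw [aff_mul, aff_mul] at hpq
  have hpq' := lt_of_le_of_ne hpq fun e => hlt.ne' (aff_injective _ e)
  obtain ⟨h3, h4⟩ := aff_simple_inv hlt hpq'
  have hq0 : q ≠ 0 := by
    rintro rfl
    simp at h
  have hv := val_sub_one hq0
  rcases eq_or_ne p (q - 1) with rfl | hne
  · refine h2 q hq0 e (mul_simpleRefl w q (ne_one_of_ne_zero hq0) (res_coe q) ?_ h3 h4).symm
    have := coe_sub_one hq0
    linarith
  · have hne' : (p : ℕ) ≠ (q - 1 : Fin N) := fun e => hne (Fin.ext e)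
    rw [Fin.lt_def] at h
    have h5 : p < q - 1 := by rw [Fin.lt_def]; omega
    have h6 : q - 1 < q := by rw [Fin.lt_def]; omega
    obtain ⟨e1, e2⟩ := index_eq_of_between h5.le h6.le e
    have := hw _ _ h5 e1
    have := hw _ _ h6 e2
    omega

/-- Allows the first letter of a reduced expression to be removed inside `W^β`. A pair of one block
inverted by `w` but not by `s_i w` would have the values `i`, `i - 1` up to translation, contrary to
the ascent. -/
theorem minReps_of_simple_mul {w : W N} {i : Fin N} (hw : simpleRefl i * w ∈ minReps β)
    (h : aff w⁻¹ (((i : ℕ) : ℤ) - 1) < aff w⁻¹ ((i : ℕ) : ℤ)) : w ∈ minReps β := by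
  rw [mem_minReps_iff] at hw ⊢
  intro p q hpq e
  have h1 := hw p q hpq e
  rw [aff_mul, aff_mul] at h1
  by_contra hc
  have hpq' : ((p : ℕ) : ℤ) < (q : ℕ) := by exact_mod_cast hpq
  have hlt := lt_of_le_of_ne (not_lt.1 hc) fun e => hpq'.ne' (aff_injective w e)
  obtain ⟨h2, h3⟩ := aff_simple_inv hlt h1
  obtain ⟨k, hk⟩ := res_eq_coe_iff.1 h3
  have hq : aff w q = (((i : ℕ) : ℤ) - 1) + N * k := by linarith
  have e1 : ((p : ℕ) : ℤ) = aff w⁻¹ ((i : ℕ) : ℤ) + N * k := by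
    rw [← aff_add_mul, ← hk, aff_inv_aff]
  have e2 : ((q : ℕ) : ℤ) = aff w⁻¹ (((i : ℕ) : ℤ) - 1) + N * k := by
    rw [← aff_add_mul, ← hq, aff_inv_aff]
  linarith

theorem pi_mul_mem_minReps {k : ℤ} {w : W N} :
    piElt N ^ k * w ∈ minReps β ↔ w ∈ minReps β := by
  simp [mem_minReps_iff, aff_mul, aff_pi_zpow]

/-! ### The set `X^β` -/

theorem mem_minRepsBar_iff {σ : WBar N} : σ ∈ minRepsBar β ↔
    ∀ p q : Fin N, p < q → β.index p = β.index q → σ p < σ q := by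
  change ofPerm σ ∈ minReps β ↔ _
  simp only [mem_minReps_iff, aff_ofPerm_coe, Int.ofNat_lt, Fin.val_fin_lt]

/-- `X^β` consists of the `t_μ σ`, `σ ∈ W̄^β`, for which the pairs formed by `μ_p` and
the block of `σ⁻¹ p`, the latter in reversed order, increase lexicographically. -/
theorem mem_XSet_iff {x : W N} : x ∈ XSet β ↔ ∃ σ ∈ minRepsBar β, ∃ μ : PBar N,
    Monotone (fun p => toLex (μ p, OrderDual.toDual (β.index (σ⁻¹ p)))) ∧
      x = transl μ * ofPerm σ := by
  constructor
  · rintro ⟨σ, hσ, η, hη, rfl⟩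
    refine ⟨σ, hσ, _, ?_, rfl⟩
    refine monotone_iff_forall_lt.2 fun p q h => ?_
    refine chain_lt (S := fun p q => toLex ((η + etaOf β σ) p, OrderDual.toDual (β.index (σ⁻¹ p)))
      ≤ toLex ((η + etaOf β σ) q, OrderDual.toDual (β.index (σ⁻¹ q)))) ?_
      (fun _ _ _ _ _ => le_trans) h
    intro j hj
    have h1 := etaOf_step β σ j hj
    have h2 := hη (j - 1) j (by have := val_sub_one hj; rw [Fin.lt_def]; omega)
    rw [Prod.Lex.toLex_le_toLex]
    simp only [Pi.add_apply, OrderDual.toDual_le_toDual]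
    split_ifs at h1 with hc
    · left; linarith
    · rcases lt_or_eq_of_le (show η (j - 1) + etaOf β σ (j - 1) ≤ η j + etaOf β σ j by linarith)
        with h3 | h3
      · exact Or.inl h3
      · refine Or.inr ⟨h3, ?_⟩
        by_contra hlt
        rw [not_le] at hlt
        exact hc ⟨lt_of_index_lt hlt, hlt.ne⟩
  · rintro ⟨σ, hσ, μ, hμ, rfl⟩
    refine ⟨σ, hσ, μ - etaOf β σ, ?_, by rw [sub_add_cancel]⟩
    intro p q h
    refine chain_lt (S := fun p q => (μ - etaOf β σ) p - (μ - etaOf β σ) q ≤ 0) ?_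
      (fun _ _ _ _ _ h1 h2 => by linarith) h
    intro j hj
    have h1 := etaOf_step β σ j hj
    have h2 := hμ (show j - 1 ≤ j by have := val_sub_one hj; rw [Fin.le_def]; omega)
    simp only [Prod.Lex.toLex_le_toLex, OrderDual.toDual_le_toDual] at h2
    simp only [Pi.sub_apply]
    split_ifs at h1 with hc
    · rcases h2 with h2 | ⟨h2, h3⟩
      · linarith
      · exact absurd (le_antisymm (index_mono hc.1.le) h3) hc.2
    · rcases h2 with h2 | ⟨h2, h3⟩ <;> linarith

theorem XSet_subset_minReps : XSet β ⊆ minReps β := by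
  intro x hx
  obtain ⟨σ, hσ, μ, hμ, rfl⟩ := mem_XSet_iff.1 hx
  rw [mem_minReps_iff]
  intro p q h e
  have h1 := mem_minRepsBar_iff.1 hσ p q h e
  have h2 := hμ h1.le
  simp only [Prod.Lex.toLex_le_toLex] at h2
  rw [aff_coe, aff_coe, lt_iff_fin, perm_transl_mul, vec_transl_mul, vec_transl_mul]
  rcases h2 with h2 | ⟨h2, -⟩
  · exact Or.inl h2
  · exact Or.inr ⟨h2, h1⟩

theorem exists_mul_mem_XSet {w : W N} (hw : w ∈ minReps β) :
    ∃ ρ : WBar N, ofPerm ρ * w ∈ XSet β := by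
  rw [mem_minReps_iff] at hw
  set g : Fin N → ℤ := fun j => vec w (perm w j) with hg
  -- Sorting by the first two entries gives the monotonicity in `mem_XSet_iff`. The position `j`
  -- breaks ties: since `w ∈ W^β` makes `g` nondecreasing on a block, `K` is strictly increasing
  -- there, and hence so is `τ⁻¹`.
  set K : Fin N → ℤ ×ₗ ((Fin β.length)ᵒᵈ ×ₗ Fin N) :=
    fun j => toLex (g j, toLex (OrderDual.toDual (β.index j), j)) with hK
  set τ := Tuple.sort K with hτ
  have hmono : Monotone (K ∘ τ) := Tuple.monotone_sort K
  refine ⟨τ⁻¹ * (perm w)⁻¹, mem_XSet_iff.2 ⟨τ⁻¹, ?_, g ∘ τ, ?_, ?_⟩⟩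
  · rw [mem_minRepsBar_iff]
    intro p q h e
    by_contra hc
    have h1 := hmono (not_lt.1 hc)
    simp only [Function.comp_apply, perm_apply_inv] at h1
    refine absurd h1 (not_le.2 ?_)
    have h2 := hw p q h e
    rw [aff_coe, aff_coe, lt_iff_fin] at h2
    simp only [hK]
    rw [Prod.Lex.toLex_lt_toLex]
    rcases h2 with h2 | ⟨h2, -⟩
    · exact Or.inl h2
    · refine Or.inr ⟨h2, ?_⟩
      rw [Prod.Lex.toLex_lt_toLex]
      exact Or.inr ⟨by rw [e], h⟩
  · intro p q h
    have h1 := hmono h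
    simp only [hK, Function.comp_apply, Prod.Lex.toLex_le_toLex] at h1
    rw [Prod.Lex.toLex_le_toLex]
    simp only [inv_inv, Function.comp_apply]
    rcases h1 with h1 | ⟨h1, h2 | ⟨h2, -⟩⟩
    · exact Or.inl h1
    · exact Or.inr ⟨h1, h2.le⟩
    · exact Or.inr ⟨h1, h2.le⟩
  · refine ext_W ?_ fun i => ?_
    · rw [perm_mul, perm_ofPerm, perm_transl_mul, inv_mul_cancel_right]
    · rw [vec_mul, vec_ofPerm, zero_add, vec_transl_mul, perm_ofPerm, mul_inv_rev, inv_inv,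
        inv_inv]
      rfl

/-- Left multiplication by `W̄` permutes the pairs of `mem_XSet_iff`, and a monotone arrangement of
a family is unique. So `μ = μ'`, and `σ⁻¹ σ'` preserves the blocks, which makes it trivial. -/
theorem XSet_unique {x x' : W N} (hx : x ∈ XSet β) (hx' : x' ∈ XSet β) {ρ : WBar N}
    (h : ofPerm ρ * x = x') : x = x' := by
  obtain ⟨σ, hσ, μ, hμ, rfl⟩ := mem_XSet_iff.1 hx
  obtain ⟨σ', hσ', μ', hμ', rfl⟩ := mem_XSet_iff.1 hx'
  have hp : ρ * σ = σ' := by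
    have := congrArg perm h
    rwa [perm_mul, perm_ofPerm, perm_transl_mul, perm_transl_mul] at this
  have hv : ∀ i, μ (ρ⁻¹ i) = μ' i := by
    intro i
    have := congrArg (fun w => vec w i) h
    simpa only [vec_mul (ofPerm ρ), vec_ofPerm, zero_add, vec_transl_mul, perm_ofPerm] using this
  have hF := Tuple.unique_monotone
    (f := fun p => toLex (μ p, OrderDual.toDual (β.index (σ⁻¹ p)))) (σ := 1) (τ := ρ⁻¹) hμ (by
      have : (fun p => toLex (μ p, OrderDual.toDual (β.index (σ⁻¹ p)))) ∘ (ρ⁻¹ : WBar N) =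
          fun p => toLex (μ' p, OrderDual.toDual (β.index (σ'⁻¹ p))) := by
        funext p
        simp only [Function.comp_apply, hv, ← hp, mul_inv_rev, Equiv.Perm.mul_apply]
      rwa [this])
  have hF' : ∀ p, μ p = μ' p ∧ β.index (σ⁻¹ p) = β.index (σ'⁻¹ p) := by
    intro p
    have := congrFun hF p
    simp only [Function.comp_apply, Equiv.Perm.one_apply, toLex_inj, Prod.mk.injEq,
      OrderDual.toDual_inj] at this
    refine ⟨this.1.trans (hv p), ?_⟩
    rw [← hp, mul_inv_rev, Equiv.Perm.mul_apply]
    exact this.2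
  have hu : σ⁻¹ * σ' = 1 := by
    refine minReps_unique (β := β) (w := ofPerm σ) hσ (fun p => ?_) ?_
    · rw [Equiv.Perm.mul_apply, (hF' _).2, perm_inv_apply]
    · rw [← map_mul, mul_inv_cancel_left]
      exact hσ'
  rw [inv_mul_eq_one.1 hu, funext fun p => (hF' p).1]

end Cosets

/-! ### The vectors `ε_a^∨` of `𝔱'` -/

section Cartan

variable {N : ℕ}

theorem actT_cElt (w : W N) : actT w (cElt N) = cElt N := by
  ext <;> simp [actT, cElt]

theorem etaFun_apply (η : PBar N) (ξ : TPrime N) : etaFun η ξ = ∑ i, (η i : ℂ) * ξ.1 i := by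
  simp [etaFun, LinearMap.sum_apply]

theorem etaFun_cElt (η : PBar N) : etaFun η (cElt N) = 0 := by
  simp [etaFun_apply, cElt]

variable [NeZero N]

/-- The vector `ε_a^∨` of `𝔱'`, where `ε_{i + N k}^∨ = ε_i^∨ - k c`. -/
def epsT (N : ℕ) [NeZero N] (a : ℤ) : TPrime N := (Pi.single (res N a) 1, -((a / N : ℤ) : ℂ))

theorem epsT_add_mul (a k : ℤ) : epsT N (a + N * k) = epsT N a - (k : ℂ) • cElt N := by
  ext
  · simp [epsT, cElt]
  · simp [epsT, cElt]
    ring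

theorem TPrime_eq_sum (ξ : TPrime N) :
    ξ = ∑ i : Fin N, ξ.1 i • epsT N ((i : ℕ) : ℤ) + ξ.2 • cElt N := by
  ext j
  · simp [epsT, cElt, Prod.fst_sum, Finset.sum_apply, Pi.single_apply]
  · simp [epsT, cElt, Prod.snd_sum]

theorem TPrime_hom_ext {M : Type*} [AddCommGroup M] [Module ℂ M] {f g : TPrime N →ₗ[ℂ] M}
    (h : ∀ i : Fin N, f (epsT N ((i : ℕ) : ℤ)) = g (epsT N ((i : ℕ) : ℤ)))
    (hc : f (cElt N) = g (cElt N)) : f = g := by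
  refine LinearMap.ext fun ξ => ?_
  rw [TPrime_eq_sum ξ]
  simp [h, hc]

theorem actT_epsT (w : W N) (a : ℤ) : actT w (epsT N a) = epsT N (aff w a) := by
  ext i
  · simp only [actT, epsT, LinearMap.coe_mk, AddHom.coe_mk, Pi.single_apply,
      Equiv.Perm.inv_eq_iff_eq, res_aff]
  · simp only [actT, epsT, LinearMap.coe_mk, AddHom.coe_mk, Pi.single_apply,
      Equiv.Perm.inv_eq_iff_eq, mul_ite, mul_one, mul_zero, Finset.sum_ite_eq',
      Finset.mem_univ, if_true, aff, ediv_fin]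
    push_cast
    ring

theorem actT_mul (u v : W N) (ξ : TPrime N) : actT (u * v) ξ = actT u (actT v ξ) := by
  have : actT (u * v) = actT u ∘ₗ actT v :=
    TPrime_hom_ext (fun i => by simp [actT_epsT, aff_mul]) (by simp [actT_cElt])
  rw [this]
  rfl

theorem actT_one (ξ : TPrime N) : actT (1 : W N) ξ = ξ := by
  have : actT (1 : W N) = LinearMap.id :=
    TPrime_hom_ext (fun i => by simp [actT_epsT]) (by simp [actT_cElt])
  rw [this]
  rfl

theorem etaFun_epsT (η : PBar N) (a : ℤ) : etaFun η (epsT N a) = η (res N a) := by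
  simp [etaFun_apply, epsT, Pi.single_apply]

theorem affAct_apply (w : W N) (ζ : TDual N) (ξ : TPrime N) :
    affAct w ζ ξ = ζ (actT w⁻¹ ξ) := by
  have : affAct w ζ = ζ ∘ₗ actT w⁻¹ := by
    refine TPrime_hom_ext (fun i => ?_) ?_
    · have h : aff w⁻¹ ((i : ℕ) : ℤ) = (((perm w)⁻¹ i : Fin N) : ℕ) + N * (-vec w i) := by
        apply aff_injective w
        rw [aff_aff_inv, aff_fin, perm_apply_inv]
        ring
      simp only [affAct, LinearMap.add_apply, LinearMap.comp_apply, LinearMap.smul_apply,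
        actT_epsT, aff_ofPerm_coe, etaFun_epsT, res_coe, h, epsT_add_mul, map_sub, map_smul,
        smul_eq_mul]
      push_cast
      ring
    · simp [affAct, actT_cElt, etaFun_cElt]
  rw [this]
  rfl

theorem affAct_mul (u v : W N) (ζ : TDual N) : affAct (u * v) ζ = affAct u (affAct v ζ) := by
  refine LinearMap.ext fun ξ => ?_
  rw [affAct_apply, affAct_apply, affAct_apply, mul_inv_rev, actT_mul]

theorem affAct_one (ζ : TDual N) : affAct 1 ζ = ζ := by
  refine LinearMap.ext fun ξ => ?_
  rw [affAct_apply, inv_one, actT_one]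

theorem affAct_cElt (w : W N) (ζ : TDual N) : affAct w ζ (cElt N) = ζ (cElt N) := by
  rw [affAct_apply, actT_cElt]

theorem affAct_epsT (w : W N) (ζ : TDual N) (a : ℤ) :
    affAct w ζ (epsT N a) = ζ (epsT N (aff w⁻¹ a)) := by
  rw [affAct_apply, actT_epsT]

theorem pairing_root (ζ : TDual N) (a b : ℤ) :
    pairing ζ (root N a b) = ζ (epsT N a) - ζ (epsT N b) := by
  rw [pairing, ← map_sub]
  congr 1
  ext i
  · simp [root, eps, epsT, Pi.single_apply]
  · simp [root, epsT]
    ring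

theorem simpleCoroot_eq (i : Fin N) :
    simpleCoroot i = epsT N (((i : ℕ) : ℤ) - 1) - epsT N ((i : ℕ) : ℤ) := by
  rw [simpleCoroot, simpleRoot_eq]
  ext j
  · simp [root, eps, epsT, Pi.single_apply]
  · simp [root, epsT]

/-- The simple root `α_i` as a functional on `𝔱'`. -/
abbrev alphaT (i : Fin N) : TDual N := etaFun (simpleRoot i).1

theorem alphaT_epsT (i : Fin N) (a : ℤ) :
    alphaT i (epsT N a) = (if res N (a + 1) = i then 1 else 0) - if res N a = i then 1 else 0 := by
  rw [etaFun_epsT, simpleRoot]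
  simp [eps, Pi.single_apply, ← res_eq_sub_one_iff]

theorem alphaT_eq_zero (hN : N = 1) (i : Fin N) : alphaT i = 0 := by
  subst hN
  have h : i - 1 = i := Subsingleton.elim _ _
  refine TPrime_hom_ext (fun j => ?_) (by simp [etaFun_cElt])
  rw [etaFun_epsT, simpleRoot, h, sub_self]
  simp

theorem actT_simple (i : Fin N) (ξ : TPrime N) :
    actT (simpleRefl i) ξ = ξ - alphaT i ξ • simpleCoroot i := by
  by_cases hN : N = 1
  · rw [simpleRefl_eq_one hN, actT_one, alphaT_eq_zero hN]
    simp
  have : actT (simpleRefl i) =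
      LinearMap.id - (alphaT i : TPrime N →ₗ[ℂ] ℂ).smulRight (simpleCoroot i) := by
    refine TPrime_hom_ext (fun j => ?_) (by simp [actT_cElt, etaFun_cElt])
    have key : ∀ a : ℤ, actT (simpleRefl i) (epsT N a) =
        epsT N a - alphaT i (epsT N a) • simpleCoroot i := by
      intro a
      rw [actT_epsT, simpleCoroot_eq, alphaT_epsT]
      by_cases h : res N a = i
      · have h' : res N (a + 1) ≠ i := fun e => res_ne_succ hN a (h.trans e.symm)
        rw [if_neg h', if_pos h, aff_simple_of_res_eq hN h]
        obtain ⟨k, rfl⟩ := res_eq_coe_iff.1 h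
        rw [add_sub_right_comm, epsT_add_mul, epsT_add_mul, zero_sub, neg_one_smul]
        abel
      by_cases h' : res N (a + 1) = i
      · rw [if_pos h', if_neg h, aff_simple_of_res_succ hN h']
        obtain ⟨k, hk⟩ := res_eq_coe_iff.1 h'
        have hk' : a = ((i : ℕ) : ℤ) - 1 + N * k := by linarith
        rw [hk, hk', epsT_add_mul, epsT_add_mul, sub_zero, one_smul]
        abel
      · rw [if_neg h', if_neg h, aff_simple_of_ne h h', sub_zero, zero_smul, sub_zero]
    exact key _
  rw [this]
  rfl

theorem actT_simple_simple (i : Fin N) (ξ : TPrime N) :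
    actT (simpleRefl i) (actT (simpleRefl i) ξ) = ξ := by
  rw [← actT_mul, simpleRefl_mul_self, actT_one]

theorem alphaT_simpleCoroot (hN : N ≠ 1) (i : Fin N) : alphaT i (simpleCoroot i) = 2 := by
  have h1 := alphaT_epsT i (((i : ℕ) : ℤ) - 1)
  have h2 := alphaT_epsT i ((i : ℕ) : ℤ)
  have h3 : res N (((i : ℕ) : ℤ) - 1) ≠ i := by
    rw [res_sub_one]
    exact sub_one_ne hN i
  have h4 : res N (((i : ℕ) : ℤ) + 1) ≠ i := by
    intro e
    exact res_ne_succ hN ((i : ℕ) : ℤ) (by rw [e, res_coe])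
  rw [simpleCoroot_eq, map_sub, h1, h2, sub_add_cancel, res_coe, if_pos rfl, if_neg h3,
    if_neg h4]
  norm_num

theorem alphaT_actT_simple (i : Fin N) (ξ : TPrime N) :
    alphaT i (actT (simpleRefl i) ξ) = -alphaT i ξ := by
  by_cases hN : N = 1
  · rw [alphaT_eq_zero hN]
    simp
  rw [actT_simple, map_sub, map_smul, alphaT_simpleCoroot hN, smul_eq_mul]
  ring

theorem actT_simple_coroot (hN : N ≠ 1) (i : Fin N) :
    actT (simpleRefl i) (simpleCoroot i) = -simpleCoroot i := by
  rw [actT_simple, alphaT_simpleCoroot hN, two_smul]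
  abel

end Cartan

/-! ### Genericity -/

section Generic

variable {N : ℕ} [NeZero N] {β : Composition N} {ζ : TDual N}

theorem aff_transl (μ : PBar N) (a : ℤ) : aff (transl μ) a = a + N * μ (res N a) := by
  have h : transl μ = transl μ * ofPerm 1 := by rw [map_one, mul_one]
  have e := res_add_mul_ediv (N := N) a
  rw [aff, h, perm_transl_mul, Equiv.Perm.one_apply, vec_transl_mul]
  linarith

/-- The positive affine roots that are inverted by no element of `W^β` are of the form
`α_{ij} + k δ` with `i < j` in the same block. -/
theorem IsGeneric.same_block (hgen : IsGeneric β ζ) {a b : ℤ} (hab : a < b)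
    (hn : res N a ≠ res N b) (h : pairing ζ (root N a b) ∈ ({1, 0, -1} : Set ℂ)) :
    β.index (res N a) = β.index (res N b) ∧ res N a < res N b := by
  have hM : b < a + N * (b - a + 1) := by
    have := natCast_pos (N := N)
    nlinarith
  -- A translation that is nondecreasing along each block lies in `W^β`. Moving `a` up by `N (b - a
  -- + 1)` while `b` stays carries `a` past `b`, so the root is in `S(t_μ)` and genericity excludes
  -- it. Step functions `μ` treat the residues in the wrong order, block indicators those in
  -- different blocks.
  have key : ∀ μ : PBar N, (∀ p q : Fin N, p < q → β.index p = β.index q → μ p ≤ μ q) →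
      μ (res N a) = b - a + 1 → μ (res N b) = 0 → False := by
    intro μ hμ h1 h2
    refine hgen (transl μ) ?_ (root N a b) ?_ h
    · rw [mem_minReps_iff]
      intro p q hpq e
      rw [aff_transl, aff_transl, res_coe, res_coe, lt_iff_fin]
      rcases (hμ p q hpq e).lt_or_eq with h | h
      · exact Or.inl h
      · exact Or.inr ⟨h, hpq⟩
    · rw [root_mem_invSet hn, aff_transl, aff_transl, h1, h2]
      exact ⟨hab, by linarith⟩
  by_cases e : β.index (res N a) = β.index (res N b)
  · refine ⟨e, ?_⟩
    by_contra hc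
    have hlt := lt_of_le_of_ne (not_lt.1 hc) hn.symm
    refine key (fun p => if res N a ≤ p then b - a + 1 else 0) ?_ (if_pos le_rfl)
      (if_neg (not_le.2 hlt))
    intro p q hpq _
    split_ifs with h1 h2
    · exact le_rfl
    · exact absurd (h1.trans hpq.le) h2
    · linarith
    · exact le_rfl
  · exact (key (fun p => if β.index p = β.index (res N a) then b - a + 1 else 0)
      (fun p q _ e => by simp only [e, le_refl]) (if_pos rfl) (if_neg (Ne.symm e))).elim

/-- The values `-1` on the simple roots of the block telescope. -/
theorem tBeta_block (hβ : ζ ∈ tBeta β) {p q : Fin N} (h : p < q)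
    (e : β.index p = β.index q) :
    ζ (epsT N ((p : ℕ) : ℤ)) - ζ (epsT N ((q : ℕ) : ℤ)) = ((p : ℕ) : ℂ) - ((q : ℕ) : ℂ) := by
  refine chain_block (S := fun p q => ζ (epsT N ((p : ℕ) : ℤ)) - ζ (epsT N ((q : ℕ) : ℤ)) =
    ((p : ℕ) : ℂ) - ((q : ℕ) : ℂ)) ?_ (fun _ _ _ _ _ h1 h2 => by linear_combination h1 + h2) h e
  intro j hj ej
  have h1 := hβ j hj ej
  rw [simpleRoot_eq, pairing_root, ← coe_sub_one hj] at h1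
  rw [h1, ← val_sub_one hj]
  push_cast
  ring

/-- Elements of `W̄ W^β` are increasing on the fibres of `a ↦ ζ(ε_a^∨)`. -/
theorem aff_lt_of_weight_eq (hβ : ζ ∈ tBeta β) (hgen : IsGeneric β ζ) (hδ : ζ (cElt N) ≠ 0)
    {v : W N} (hv : v ∈ minReps β) (σ : WBar N) {a b : ℤ} (hab : a < b)
    (h : ζ (epsT N a) = ζ (epsT N b)) : aff (ofPerm σ * v) a < aff (ofPerm σ * v) b := by
  have hn : res N a ≠ res N b := by
    intro e
    obtain ⟨k, rfl⟩ := res_eq_iff.1 e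
    rw [epsT_add_mul, map_sub, map_smul, smul_eq_mul, eq_comm, sub_eq_self, mul_eq_zero] at h
    rcases h with h | h
    · rw [Int.cast_eq_zero] at h
      subst h
      simp at hab
    · exact hδ h
  obtain ⟨e, hlt⟩ := hgen.same_block hab hn (by rw [pairing_root, h, sub_self]; simp)
  have hb := tBeta_block hβ hlt e
  rw [mem_minReps_iff] at hv
  have hv' := hv _ _ hlt e
  generalize hp : res N a = p at *
  generalize hq : res N b = q at *
  obtain ⟨m, rfl⟩ := res_eq_coe_iff.1 hp
  obtain ⟨n, rfl⟩ := res_eq_coe_iff.1 hq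
  -- With `m = n`, two places of one block would have the same value of `ζ`, against `tBeta_block`.
  -- The strict inequality thus lies in the quotients by `N`, which left multiplication by `σ` does
  -- not change.
  have hmn : m < n := by
    rcases (lt_iff_fin _ _ _ _).1 hab with h1 | ⟨rfl, -⟩
    · exact h1
    · rw [epsT_add_mul, epsT_add_mul, map_sub, map_sub, sub_left_inj] at h
      rw [h, sub_self, eq_comm, sub_eq_zero, Nat.cast_inj] at hb
      exact absurd (Fin.ext hb) hlt.ne
  rw [aff_coe, aff_coe, lt_iff_fin] at hv'
  rw [aff_mul, aff_mul, aff_fin v, aff_fin v, aff_ofPerm, aff_ofPerm, lt_iff_fin]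
  left
  rcases hv' with h1 | ⟨h1, -⟩ <;> linarith

/-- The `W̄`-orbits of the weights `w(ζ)`, `w ∈ W^β`, separate the cosets `W̄ w`. -/
theorem eq_of_weight_eq (hβ : ζ ∈ tBeta β) (hgen : IsGeneric β ζ) (hδ : ζ (cElt N) ≠ 0)
    {w w' : W N} (hw : w ∈ minReps β) (hw' : w' ∈ minReps β) (σ : WBar N)
    (h : affAct (ofPerm σ) (affAct w ζ) = affAct w' ζ) : ofPerm σ * w = w' := by
  set u := ofPerm σ * w with hu
  have hz : ∀ a, ζ (epsT N (aff w'⁻¹ (aff u a))) = ζ (epsT N a) := by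
    intro a
    rw [← affAct_epsT, ← h, ← affAct_mul, affAct_epsT, aff_inv_aff]
  -- Since `ζ(c) ≠ 0`, a fibre contains at most one integer of each residue.
  have hfin : ∀ a, Finite {b : ℤ | ζ (epsT N b) = ζ (epsT N a)} := by
    intro a
    refine Finite.of_injective (β := Fin N) (fun b => res N b.1) fun b b' e => ?_
    obtain ⟨k, hk⟩ := res_eq_iff.1 e
    have h1 : ζ (epsT N b'.1) = ζ (epsT N b.1) := b'.2.trans b.2.symm
    rw [hk, epsT_add_mul, map_sub, map_smul, smul_eq_mul, sub_eq_self, mul_eq_zero] at h1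
    rcases h1 with h1 | h1
    · rw [Int.cast_eq_zero] at h1
      exact Subtype.ext (by rw [hk, h1]; simp)
    · exact absurd h1 hδ
  refine aff_faithful fun i => ?_
  set a : ℤ := ((i : ℕ) : ℤ) with ha
  have := hfin a
  -- `w'⁻¹ u` maps the fibre to itself and increases strictly there, because `u` and `w'` both
  -- increase on fibres. A strictly increasing self-map of a finite chain is the identity.
  let t : {b : ℤ | ζ (epsT N b) = ζ (epsT N a)} → {b : ℤ | ζ (epsT N b) = ζ (epsT N a)} :=
    fun b => ⟨aff w'⁻¹ (aff u b), (hz b).trans b.2⟩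
  have ht : StrictMono t := by
    intro b b' hbb
    have h1 : aff u b < aff u b' :=
      aff_lt_of_weight_eq hβ hgen hδ hw σ hbb (b.2.trans b'.2.symm)
    by_contra hc
    rcases (not_lt.1 hc).lt_or_eq with h2 | h2
    · have h3 := aff_lt_of_weight_eq hβ hgen hδ hw' 1 (show (t b').1 < (t b).1 from h2)
        ((t b').2.trans (t b).2.symm)
      rw [map_one, one_mul] at h3
      simp only [t, aff_aff_inv] at h3
      exact lt_asymm h1 h3
    · have h3 := congrArg (aff w') (congrArg Subtype.val h2)
      simp only [t, aff_aff_inv] at h3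
      exact h1.ne' h3
  have hsurj := Finite.surjective_of_injective ht.injective
  have h1 := DFunLike.congr_fun (Subsingleton.elim (ht.orderIsoOfSurjective t hsurj)
    (OrderIso.refl _)) ⟨a, rfl⟩
  have h2 : aff w'⁻¹ (aff u a) = a := congrArg Subtype.val h1
  rw [← h2, aff_aff_inv, h2]

end Generic

/-! ### The representation of `ℋ` on `ℂ[W]` by Dunkl operators -/

section Dunkl

variable {N : ℕ}

/-- Left multiplication by an element of `W` on `ℂ[W]`. -/
def leftMul (u : W N) : Module.End ℂ (W N →₀ ℂ) := Finsupp.lmapDomain ℂ ℂ (u * ·)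

@[simp] theorem leftMul_single (u w : W N) (z : ℂ) :
    leftMul u (Finsupp.single w z) = Finsupp.single (u * w) z := by
  simp [leftMul]

theorem linearMap_ext_single {f g : Module.End ℂ (W N →₀ ℂ)}
    (h : ∀ w, f (Finsupp.single w 1) = g (Finsupp.single w 1)) : f = g := by
  refine Finsupp.lhom_ext' fun w => LinearMap.ext_ring ?_
  simpa using h w

theorem leftMul_mul (u v : W N) : leftMul (u * v) = leftMul u * leftMul v :=
  linearMap_ext_single fun w => by simp [mul_assoc]

theorem leftMul_one : leftMul (1 : W N) = 1 :=
  linearMap_ext_single fun w => by simp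

variable [NeZero N]

/-- The coefficient of the reflection that exchanges `a` and `b` in the action of `ε_a^∨` on
`w`. -/
def dCoef (a b : ℤ) (w : W N) : ℂ :=
  if a < b ∧ aff w⁻¹ b < aff w⁻¹ a then 1 else
    if b < a ∧ aff w⁻¹ a < aff w⁻¹ b then -1 else 0

theorem dCoef_of_lt {a b : ℤ} (w : W N) (h : a < b) :
    dCoef a b w = if aff w⁻¹ b < aff w⁻¹ a then 1 else 0 := by
  simp [dCoef, h, h.not_gt]

theorem dCoef_of_gt {a b : ℤ} (w : W N) (h : b < a) :
    dCoef a b w = if aff w⁻¹ a < aff w⁻¹ b then -1 else 0 := by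
  simp [dCoef, h, h.not_gt]

theorem dCoef_self (a : ℤ) (w : W N) : dCoef a a w = 0 := by
  simp [dCoef]

theorem dCoef_of_res_eq {a b : ℤ} (w : W N) (h : res N a = res N b) : dCoef a b w = 0 := by
  rcases lt_trichotomy a b with h1 | rfl | h1
  · rw [dCoef_of_lt w h1, if_neg]
    exact fun h2 => res_ne_of_inv w⁻¹ h1 h2 h
  · exact dCoef_self a w
  · rw [dCoef_of_gt w h1, if_neg]
    exact fun h2 => res_ne_of_inv w⁻¹ h1 h2 h.symm

theorem dCoef_one (a b : ℤ) : dCoef a b (1 : W N) = 0 := by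
  rcases lt_trichotomy a b with h | rfl | h
  · simp [dCoef_of_lt _ h, h.le]
  · exact dCoef_self a 1
  · simp [dCoef_of_gt _ h, h.le]

theorem dCoef_support_finite (a : ℤ) (w : W N) : {b | dCoef a b w ≠ 0}.Finite := by
  obtain ⟨C, hC⟩ := exists_aff_bound w⁻¹
  refine (Set.finite_Icc (a - 2 * C) (a + 2 * C)).subset fun b hb => ?_
  have h1 := abs_le.1 (hC a)
  have h2 := abs_le.1 (hC b)
  rcases lt_trichotomy a b with h | rfl | h
  · rw [Set.mem_ofPred_eq, dCoef_of_lt w h] at hb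
    split_ifs at hb with h3
    · exact ⟨by linarith, by linarith⟩
    · exact absurd rfl hb
  · exact absurd (dCoef_self a w) hb
  · rw [Set.mem_ofPred_eq, dCoef_of_gt w h] at hb
    split_ifs at hb with h3
    · exact ⟨by linarith, by linarith⟩
    · exact absurd rfl hb

theorem single_support_finite (a : ℤ) (w : W N) (f : ℤ → W N) :
    (Function.support fun b => Finsupp.single (f b) (dCoef a b w)).Finite := by
  refine (dCoef_support_finite a w).subset fun b hb => ?_
  intro h
  exact hb (by simp only [h, Finsupp.single_zero])

/-- The action of `ε_a^∨` on `w ∈ ℂ[W]`. -/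
def dunklSingle (ζ : TDual N) (a : ℤ) (w : W N) : W N →₀ ℂ :=
  Finsupp.single w (ζ (epsT N (aff w⁻¹ a))) -
    ∑ᶠ b : ℤ, Finsupp.single (refl N a b * w) (dCoef a b w)

/-- The Dunkl operator by which `ε_a^∨` acts on `ℂ[W]`. -/
def dunkl (ζ : TDual N) (a : ℤ) : Module.End ℂ (W N →₀ ℂ) :=
  Finsupp.linearCombination ℂ (dunklSingle ζ a)

theorem dunkl_single (ζ : TDual N) (a : ℤ) (w : W N) :
    dunkl ζ a (Finsupp.single w 1) = dunklSingle ζ a w := by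
  simp [dunkl]

/-- Consistency with `ε_{a + N k}^∨ = ε_a^∨ - k c`, with `c` acting by `ζ(c)`: translation by `N k`
reindexes the reflection sum without changing it. -/
theorem dunkl_add_mul (ζ : TDual N) (a k : ℤ) :
    dunkl ζ (a + N * k) = dunkl ζ a - ((k : ℂ) * ζ (cElt N)) • 1 := by
  refine linearMap_ext_single fun w => ?_
  have h : ∑ᶠ b : ℤ, Finsupp.single (refl N (a + N * k) b * w) (dCoef (a + N * k) b w) =
      ∑ᶠ b : ℤ, Finsupp.single (refl N a b * w) (dCoef a b w) := by
    rw [← finsum_comp_equiv (Equiv.addRight ((N : ℤ) * k))]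
    refine finsum_congr fun b => ?_
    simp only [Equiv.coe_addRight, refl_add_mul, dCoef, aff_add_mul, add_lt_add_iff_right]
  rw [LinearMap.sub_apply, LinearMap.smul_apply, Module.End.one_apply, dunkl_single, dunkl_single,
    dunklSingle, dunklSingle, h, aff_add_mul, epsT_add_mul, map_sub, Finsupp.single_sub, map_smul,
    smul_eq_mul, Finsupp.smul_single, smul_eq_mul, mul_one]
  abel

/-- The operator by which `ξ ∈ 𝔱'` acts on `ℂ[W]`. -/
def dunklT (ζ : TDual N) : TPrime N →ₗ[ℂ] Module.End ℂ (W N →₀ ℂ) where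
  toFun ξ := ∑ i : Fin N, ξ.1 i • dunkl ζ ((i : ℕ) : ℤ) + (ξ.2 * ζ (cElt N)) • 1
  map_add' ξ ξ' := by
    simp only [Prod.fst_add, Pi.add_apply, add_smul, Finset.sum_add_distrib, Prod.snd_add, add_mul]
    abel
  map_smul' z ξ := by
    simp only [Prod.smul_fst, Pi.smul_apply, smul_eq_mul, mul_smul, Prod.smul_snd,
      RingHom.id_apply, smul_add, Finset.smul_sum]

theorem dunklT_cElt (ζ : TDual N) : dunklT ζ (cElt N) = ζ (cElt N) • 1 := by
  simp [dunklT, cElt]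

theorem dunklT_epsT (ζ : TDual N) (a : ℤ) : dunklT ζ (epsT N a) = dunkl ζ a := by
  have h := dunkl_add_mul ζ ((res N a : ℕ) : ℤ) (a / N)
  rw [res_add_mul_ediv] at h
  rw [h]
  simp [dunklT, epsT, Pi.single_apply]
  module

theorem dunkl_single_one (ζ : TDual N) (a : ℤ) :
    dunkl ζ a (Finsupp.single 1 1) = ζ (epsT N a) • Finsupp.single 1 1 := by
  rw [dunkl_single, dunklSingle]
  simp [dCoef_one]

theorem dunklT_single_one (ζ : TDual N) (ξ : TPrime N) :
    dunklT ζ ξ (Finsupp.single 1 1) = ζ ξ • Finsupp.single 1 1 := by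
  have : (LinearMap.applyₗ (R := ℂ) (Finsupp.single (1 : W N) (1 : ℂ))) ∘ₗ dunklT ζ =
      (ζ : TPrime N →ₗ[ℂ] ℂ).smulRight (Finsupp.single (1 : W N) (1 : ℂ)) := by
    refine TPrime_hom_ext (fun i => ?_) ?_
    · simp only [LinearMap.comp_apply, dunklT_epsT, LinearMap.applyₗ_apply_apply,
        LinearMap.smulRight_apply, dunkl_single_one]
    · simp [dunklT_cElt]
  exact LinearMap.congr_fun this ξ

/-- Left multiplication by `v` of the reflection part of a Dunkl operator. -/
theorem leftMul_finsum (v w : W N) (a : ℤ) :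
    leftMul v (∑ᶠ b : ℤ, Finsupp.single (refl N a b * w) (dCoef a b w)) =
      ∑ᶠ b : ℤ, Finsupp.single (refl N (aff v a) b * (v * w)) (dCoef a (aff v⁻¹ b) w) := by
  rw [map_finsum _ (single_support_finite a w (fun b => refl N a b * w)),
    ← finsum_comp_equiv (affEquiv v⁻¹)]
  refine finsum_congr fun b => ?_
  change leftMul v (Finsupp.single (refl N a (aff v⁻¹ b) * w) (dCoef a (aff v⁻¹ b) w)) = _
  by_cases h : res N a = res N (aff v⁻¹ b)
  · simp [dCoef_of_res_eq w h]
  · rw [leftMul_single, ← mul_assoc, mul_refl v h, aff_aff_inv, mul_assoc]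

/-- `s_i` keeps the order of every pair except neighbours whose upper entry has residue `i`. For
those the inversion condition is complemented and the sign reversed, so the two coefficients differ
by exactly one. -/
theorem dCoef_simple (w : W N) (i : Fin N) (hN : N ≠ 1) (a b : ℤ) :
    dCoef a b (simpleRefl i * w) =
      dCoef (aff (simpleRefl i) a) (aff (simpleRefl i) b) w +
        ((if b = a + 1 ∧ res N b = i then 1 else 0) -
          if a = b + 1 ∧ res N a = i then 1 else 0) := by
  have hinv : ∀ c, aff (simpleRefl i * w)⁻¹ c = aff w⁻¹ (aff (simpleRefl i) c) := by
    intro c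
    rw [mul_inv_rev, simpleRefl_inv, aff_mul]
  have hnot : ∀ {a b : ℤ}, a < b → aff (simpleRefl i) a < aff (simpleRefl i) b →
      ¬(b = a + 1 ∧ res N b = i) := by
    rintro a _ - h ⟨rfl, h2⟩
    rw [aff_simple_of_res_succ hN h2, aff_simple_of_res_eq hN h2] at h
    linarith
  rcases lt_trichotomy a b with h | rfl | h
  · have h1 : ¬(a = b + 1 ∧ res N a = i) := fun e => by linarith [e.1]
    rw [dCoef_of_lt _ h, hinv, hinv, if_neg h1]
    rcases aff_lt_or_gt (simpleRefl i) h.ne with h2 | h2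
    · rw [dCoef_of_lt _ h2, if_neg (hnot h h2)]
      ring
    · obtain ⟨h3, h4⟩ := aff_simple_inv h h2
      rw [dCoef_of_gt _ h2, if_pos (And.intro h3 h4)]
      rcases aff_lt_or_gt w⁻¹ h2.ne with h5 | h5
      · rw [if_pos h5, if_neg h5.not_gt]
        ring
      · rw [if_neg h5.not_gt, if_pos h5]
        ring
  · simp [dCoef_self]
  · have h1 : ¬(b = a + 1 ∧ res N b = i) := fun e => by linarith [e.1]
    rw [dCoef_of_gt _ h, hinv, hinv, if_neg h1]
    rcases aff_lt_or_gt (simpleRefl i) h.ne with h2 | h2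
    · rw [dCoef_of_gt _ h2, if_neg (hnot h h2)]
      ring
    · obtain ⟨h3, h4⟩ := aff_simple_inv h h2
      rw [dCoef_of_lt _ h2, if_pos (And.intro h3 h4)]
      rcases aff_lt_or_gt w⁻¹ h2.ne with h5 | h5
      · rw [if_pos h5, if_neg h5.not_gt]
        ring
      · rw [if_neg h5.not_gt, if_pos h5]
        ring

theorem refl_comm (a b : ℤ) : refl N a b = refl N b a := by
  refine ext_W ?_ fun m => ?_
  · rw [refl, refl, perm_affRefl, perm_affRefl, Equiv.swap_comm]
  · rw [refl, refl, vec_affRefl, vec_affRefl]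
    simp only [Pi.sub_apply]
    ring

/-- Only `b = a ± 1` can contribute; the reflection is then `s_i` itself and cancels against `s_i
w`. This yields the constant term of the cross relation. -/
theorem finsum_simple_correction (w : W N) (i : Fin N) (hN : N ≠ 1) (a : ℤ) :
    ∑ᶠ b : ℤ, Finsupp.single (refl N a b * (simpleRefl i * w))
      (((if b = a + 1 ∧ res N b = i then 1 else 0) -
          if a = b + 1 ∧ res N a = i then 1 else 0) : ℂ) =
      alphaT i (epsT N a) • Finsupp.single w 1 := by
  rw [alphaT_epsT]
  by_cases h : res N a = i
  · have h' : res N (a + 1) ≠ i := fun e => res_ne_succ hN a (h.trans e.symm)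
    rw [finsum_eq_single _ (a - 1)]
    · have e : refl N a (a - 1) = simpleRefl i := by
        rw [refl_comm, ← refl_eq_simpleRefl (i := i) (a := a - 1) (by simpa using h)]
        simp
      rw [if_neg (by rintro ⟨e, -⟩; linarith), if_pos ⟨by ring, h⟩, if_neg h', if_pos h, e,
        simpleRefl_mul_cancel]
      simp
    · intro b hb
      rw [if_neg, if_neg]
      · simp
      · rintro ⟨e, -⟩
        exact hb (by linarith)
      · rintro ⟨rfl, e⟩
        exact h' e
  by_cases h' : res N (a + 1) = i
  · rw [finsum_eq_single _ (a + 1)]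
    · rw [if_pos ⟨rfl, h'⟩, if_neg (by rintro ⟨-, e⟩; exact h e), if_pos h', if_neg h,
        refl_eq_simpleRefl h', simpleRefl_mul_cancel]
      simp
    · intro b hb
      rw [if_neg, if_neg]
      · simp
      · rintro ⟨-, e⟩
        exact h e
      · rintro ⟨e, -⟩
        exact hb e
  · rw [if_neg h', if_neg h, sub_zero, zero_smul]
    refine finsum_eq_zero_of_forall_eq_zero fun b => ?_
    rw [if_neg, if_neg]
    · simp
    · rintro ⟨-, e⟩
      exact h e
    · rintro ⟨rfl, e⟩
      exact h' e

theorem dunkl_comp_simple (ζ : TDual N) (i : Fin N) (a : ℤ) :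
    dunkl ζ a * leftMul (simpleRefl i) + alphaT i (epsT N a) • 1 =
      leftMul (simpleRefl i) * dunkl ζ (aff (simpleRefl i) a) := by
  by_cases hN : N = 1
  · rw [simpleRefl_eq_one hN, leftMul_one, alphaT_eq_zero hN, LinearMap.zero_apply, zero_smul,
      add_zero, mul_one, one_mul, aff_one]
  refine linearMap_ext_single fun w => ?_
  rw [LinearMap.add_apply, Module.End.mul_apply, leftMul_single, dunkl_single,
    Module.End.mul_apply, dunkl_single, dunklSingle, dunklSingle, map_sub, leftMul_single,
    leftMul_finsum, simpleRefl_inv, aff_simple_aff, mul_inv_rev, simpleRefl_inv, aff_mul,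
    LinearMap.smul_apply, Module.End.one_apply, ← finsum_simple_correction w i hN a,
    ← eq_sub_iff_add_eq, sub_sub, ← finsum_add_distrib]
  · congr 1
    refine finsum_congr fun b => ?_
    rw [← Finsupp.single_add, dCoef_simple w i hN]
  -- The remaining goals are the finiteness of both supports, needed to split the `finsum`.
  · have := (single_support_finite (aff (simpleRefl i) a) w
      (fun b => refl N a (aff (simpleRefl i) b) * (simpleRefl i * w))).image
      (aff (simpleRefl i))
    refine this.subset fun b hb => ?_
    refine ⟨aff (simpleRefl i) b, ?_, aff_simple_aff i b⟩
    simpa [aff_simple_aff] using hb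
  · refine (Set.toFinite {a + 1, a - 1}).subset fun b hb => ?_
    by_contra hc
    simp only [Set.mem_insert_iff, Set.mem_singleton_iff, not_or] at hc
    refine hb ?_
    change Finsupp.single _ _ = _
    rw [if_neg fun e => hc.1 e.1, if_neg fun e => hc.2 (by linarith [e.1]), sub_zero,
      Finsupp.single_zero]

theorem dunkl_comp_pi (ζ : TDual N) (k a : ℤ) :
    leftMul (piElt N ^ k) * dunkl ζ a =
      dunkl ζ (aff (piElt N ^ k) a) * leftMul (piElt N ^ k) := by
  refine linearMap_ext_single fun w => ?_
  rw [Module.End.mul_apply, Module.End.mul_apply, leftMul_single, dunkl_single, dunkl_single,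
    dunklSingle, dunklSingle, map_sub, leftMul_single, leftMul_finsum, mul_inv_rev, aff_mul,
    aff_inv_aff]
  congr 1
  refine finsum_congr fun b => ?_
  congr 1
  have h : ∀ c : ℤ, aff (piElt N ^ k)⁻¹ c = c - k := by
    intro c
    rw [← zpow_neg, aff_pi_zpow]
    ring
  simp only [dCoef, mul_inv_rev, aff_mul, h, aff_pi_zpow, add_sub_cancel_right,
    lt_sub_iff_add_lt, sub_lt_iff_lt_add]

theorem dunklT_comp_simple (ζ : TDual N) (i : Fin N) (ξ : TPrime N) (x : W N →₀ ℂ) :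
    dunklT ζ ξ (leftMul (simpleRefl i) x) =
      leftMul (simpleRefl i) (dunklT ζ (actT (simpleRefl i) ξ) x) - alphaT i ξ • x := by
  rw [eq_sub_iff_add_eq]
  have : (LinearMap.mulRight ℂ (leftMul (simpleRefl i))).comp (dunklT ζ) +
        (alphaT i : TPrime N →ₗ[ℂ] ℂ).smulRight (1 : Module.End ℂ (W N →₀ ℂ)) =
      (LinearMap.mulLeft ℂ (leftMul (simpleRefl i))).comp
        ((dunklT ζ).comp (actT (simpleRefl i))) := by
    refine TPrime_hom_ext (M := Module.End ℂ (W N →₀ ℂ)) (fun j => ?_) ?_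
    · refine LinearMap.ext fun y => ?_
      have := LinearMap.congr_fun (dunkl_comp_simple ζ i ((j : ℕ) : ℤ)) y
      simpa [dunklT_epsT, actT_epsT] using this
    · refine LinearMap.ext fun y => ?_
      simp [dunklT_cElt, actT_cElt, etaFun_cElt]
  exact LinearMap.congr_fun (LinearMap.congr_fun this ξ) x

theorem dunklT_comp_pi (ζ : TDual N) (k : ℤ) (ξ : TPrime N) (x : W N →₀ ℂ) :
    leftMul (piElt N ^ k) (dunklT ζ ξ x) =
      dunklT ζ (actT (piElt N ^ k) ξ) (leftMul (piElt N ^ k) x) := by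
  have : (LinearMap.mulLeft ℂ (leftMul (piElt N ^ k))).comp (dunklT ζ) =
      (LinearMap.mulRight ℂ (leftMul (piElt N ^ k))).comp
        ((dunklT ζ).comp (actT (piElt N ^ k))) := by
    refine TPrime_hom_ext (M := Module.End ℂ (W N →₀ ℂ)) (fun j => ?_) ?_
    · refine LinearMap.ext fun y => ?_
      have := LinearMap.congr_fun (dunkl_comp_pi ζ k ((j : ℕ) : ℤ)) y
      simpa [dunklT_epsT, actT_epsT] using this
    · refine LinearMap.ext fun y => ?_
      simp [dunklT_cElt, actT_cElt]
  exact LinearMap.congr_fun (LinearMap.congr_fun this ξ) x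

theorem dunklT_comp_pi' (ζ : TDual N) (k : ℤ) (ξ : TPrime N) (x : W N →₀ ℂ) :
    dunklT ζ ξ (leftMul (piElt N ^ k) x) =
      leftMul (piElt N ^ k) (dunklT ζ (actT (piElt N ^ k)⁻¹ ξ) x) := by
  rw [dunklT_comp_pi, ← actT_mul, mul_inv_cancel, actT_one]

/-- No products of reflections are computed. The unit of `W` is a common eigenvector, and the cross
relations carry commutativity from `w` to `s_i w` and `π^k w`: after both operators have been moved
past `s_i`, the correction terms are symmetric in the two vectors. -/
theorem dunklT_comm (ζ : TDual N) (ξ ξ' : TPrime N) :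
    dunklT ζ ξ * dunklT ζ ξ' = dunklT ζ ξ' * dunklT ζ ξ := by
  refine linearMap_ext_single fun w => ?_
  simp only [Module.End.mul_apply]
  induction w using W_induction generalizing ξ ξ' with
  | one => simp only [dunklT_single_one, map_smul, smul_comm (ζ ξ)]
  | simple i w ih =>
    have key : ∀ η η' : TPrime N,
        dunklT ζ η (dunklT ζ η' (leftMul (simpleRefl i) (Finsupp.single w 1))) =
        leftMul (simpleRefl i) (dunklT ζ (actT (simpleRefl i) η)
          (dunklT ζ (actT (simpleRefl i) η') (Finsupp.single w 1))) -
        alphaT i η • dunklT ζ η' (Finsupp.single w 1) +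
        (alphaT i η * alphaT i η') • dunklT ζ (simpleCoroot i) (Finsupp.single w 1) -
        alphaT i η' • dunklT ζ η (Finsupp.single w 1) := by
      intro η η'
      rw [dunklT_comp_simple, map_sub, dunklT_comp_simple, map_smul, actT_simple i η']
      simp only [map_sub, map_smul, LinearMap.sub_apply, LinearMap.smul_apply]
      module
    have := key ξ ξ'
    rw [leftMul_single] at this
    rw [this]
    have := key ξ' ξ
    rw [leftMul_single] at this
    rw [this, ih]
    module
  | pi k w ih =>
    rw [← leftMul_single, dunklT_comp_pi', dunklT_comp_pi', dunklT_comp_pi', dunklT_comp_pi', ih]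

/-- The action of `ℋ` on `ℂ[W]`, which is the module induced from the character `ζ` of `𝔱'`. -/
def regRep (ζ : TDual N) : Hecke N →ₐ[ℂ] Module.End ℂ (W N →₀ ℂ) :=
  RingQuot.liftAlgHom ℂ ⟨FreeAlgebra.lift ℂ (Sum.elim leftMul (dunklT ζ)), by
    intro x y h
    induction h with
    | w_one => simpa using leftMul_one
    | w_mul u v => simpa using leftMul_mul u v
    | t_add ξ ξ' => simp
    | t_smul z ξ => simp
    | t_comm ξ ξ' => simpa using dunklT_comm ζ ξ ξ'
    | cross i ξ =>
      refine LinearMap.ext fun x => ?_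
      have := dunklT_comp_simple ζ i (actT (simpleRefl i) ξ) x
      rw [actT_simple_simple, alphaT_actT_simple] at this
      simp only [map_sub, map_mul, map_neg, FreeAlgebra.lift_ι_apply, Sum.elim_inl, Sum.elim_inr,
        AlgHom.commutes, LinearMap.sub_apply, Module.End.mul_apply, this, LinearMap.neg_apply,
        Module.algebraMap_end_apply]
      module
    | pi_cross ξ =>
      refine LinearMap.ext fun x => ?_
      have := dunklT_comp_pi ζ 1 ξ x
      simpa using this⟩

theorem regRep_ofW (ζ : TDual N) (w : W N) : regRep ζ (ofW w) = leftMul w := by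
  refine (RingQuot.liftAlgHom_mkAlgHom_apply ℂ _ _ _).trans ?_
  simp

theorem regRep_ofT (ζ : TDual N) (ξ : TPrime N) : regRep ζ (ofT ξ) = dunklT ζ ξ := by
  refine (RingQuot.liftAlgHom_mkAlgHom_apply ℂ _ _ _).trans ?_
  simp

theorem Hecke_induction {P : Hecke N → Prop} (scalar : ∀ z : ℂ, P (algebraMap ℂ _ z))
    (ofW : ∀ w, P (ofW w)) (ofT : ∀ ξ, P (ofT ξ)) (mul : ∀ x y, P x → P y → P (x * y))
    (add : ∀ x y, P x → P y → P (x + y)) (h : Hecke N) : P h := by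
  obtain ⟨f, rfl⟩ := RingQuot.mkAlgHom_surjective ℂ (Rel N) h
  induction f using FreeAlgebra.induction with
  | grade0 z =>
    have := scalar z
    rwa [← AlgHom.commutes (Hecke.mk N) z] at this
  | grade1 x =>
    rcases x with w | ξ
    · exact ofW w
    · exact ofT ξ
  | mul x y hx hy => rw [map_mul]; exact mul _ _ hx hy
  | add x y hx hy => rw [map_add]; exact add _ _ hx hy

end Dunkl

/-! ### Linear functionals on the induced module -/

section Functionals

variable {N : ℕ} [NeZero N] {β : Composition N} {ζ : TDual N}

/-- The kernel of `ℂ[W] → ℂ[W / W̄_β]`. -/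
def cosetKer (β : Composition N) : Submodule ℂ (W N →₀ ℂ) :=
  Submodule.span ℂ {x | ∃ (w : W N) (j : Fin N), j ≠ 0 ∧ β.index (j - 1) = β.index j ∧
    x = Finsupp.single (w * simpleRefl j) 1 - Finsupp.single w 1}

theorem leftMul_mem_cosetKer (v : W N) {x : W N →₀ ℂ} (hx : x ∈ cosetKer β) :
    leftMul v x ∈ cosetKer β := by
  induction hx using Submodule.span_induction with
  | mem x hx =>
    obtain ⟨w, j, hj, e, rfl⟩ := hx
    exact Submodule.subset_span ⟨v * w, j, hj, e, by simp [mul_assoc]⟩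
  | zero => simp
  | add x y _ _ hx hy => rw [map_add]; exact add_mem hx hy
  | smul z x _ hx => rw [map_smul]; exact Submodule.smul_mem _ z hx

/-- This is where `ζ(α_j^∨) = -1` enters: it makes `s_j - 1` a weight vector, of weight `ζ + α_j`.
The other generators arise by left multiplication, and moving `ξ` past `s_i` or `π^k` stays in the
kernel. -/
theorem dunklT_mem_cosetKer (hβ : ζ ∈ tBeta β) (ξ : TPrime N) {x : W N →₀ ℂ}
    (hx : x ∈ cosetKer β) : dunklT ζ ξ x ∈ cosetKer β := by
  induction hx using Submodule.span_induction with
  | mem x hx =>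
    obtain ⟨w, j, hj, e, rfl⟩ := hx
    have hmem : ∀ w : W N, Finsupp.single (w * simpleRefl j) 1 - Finsupp.single w 1 ∈
        cosetKer β := fun w => Submodule.subset_span ⟨w, j, hj, e, rfl⟩
    induction w using W_induction generalizing ξ with
    | one =>
      have h : dunklT ζ ξ (Finsupp.single (1 * simpleRefl j) 1 - Finsupp.single 1 1) =
          (ζ ξ + alphaT j ξ) •
            (Finsupp.single (1 * simpleRefl j) 1 - Finsupp.single 1 1) := by
        have h1 := dunklT_comp_simple ζ j ξ (Finsupp.single 1 1)
        have h2 : ζ (simpleCoroot j) = -1 := hβ j hj e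
        rw [dunklT_single_one, map_smul, leftMul_single, actT_simple, map_sub, map_smul, h2] at h1
        rw [one_mul, map_sub, dunklT_single_one]
        rw [mul_one] at h1
        rw [h1, smul_eq_mul]
        module
      rw [h]
      exact Submodule.smul_mem _ _ (hmem 1)
    | simple i w ih =>
      have h : (Finsupp.single (simpleRefl i * w * simpleRefl j) 1 -
          Finsupp.single (simpleRefl i * w) 1 : W N →₀ ℂ) = leftMul (simpleRefl i)
            (Finsupp.single (w * simpleRefl j) 1 - Finsupp.single w 1) := by
        simp [mul_assoc]
      rw [h, dunklT_comp_simple]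
      exact sub_mem (leftMul_mem_cosetKer _ (ih _)) (Submodule.smul_mem _ _ (hmem w))
    | pi k w ih =>
      have h : (Finsupp.single (piElt N ^ k * w * simpleRefl j) 1 -
          Finsupp.single (piElt N ^ k * w) 1 : W N →₀ ℂ) = leftMul (piElt N ^ k)
            (Finsupp.single (w * simpleRefl j) 1 - Finsupp.single w 1) := by
        simp [mul_assoc]
      rw [h, dunklT_comp_pi']
      exact leftMul_mem_cosetKer _ (ih _)
  | zero => simp
  | add x y _ _ hx hy => rw [map_add]; exact add_mem hx hy
  | smul z x _ hx => rw [map_smul]; exact Submodule.smul_mem _ z hx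

theorem regRep_mem_cosetKer (hβ : ζ ∈ tBeta β) (h : Hecke N) {x : W N →₀ ℂ}
    (hx : x ∈ cosetKer β) : regRep ζ h x ∈ cosetKer β := by
  induction h using Hecke_induction generalizing x with
  | scalar z => rw [AlgHom.commutes]; exact Submodule.smul_mem _ z hx
  | ofW w => rw [regRep_ofW]; exact leftMul_mem_cosetKer w hx
  | ofT ξ => rw [regRep_ofT]; exact dunklT_mem_cosetKer hβ ξ hx
  | mul a b ha hb => rw [map_mul]; exact ha (hb hx)
  | add a b ha hb => rw [map_add]; exact add_mem (ha hx) (hb hx)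

theorem single_parabolic_sub_mem {u : WBar N} (hu : u ∈ parabolic β) (w : W N) :
    Finsupp.single (w * ofPerm u) 1 - Finsupp.single w 1 ∈ cosetKer β := by
  induction hu using Subgroup.closure_induction generalizing w with
  | mem σ hσ =>
    obtain ⟨j, hj, e, rfl⟩ := hσ
    rw [ofPerm_swap hj]
    exact Submodule.subset_span ⟨w, j, hj, e, rfl⟩
  | one => simp
  | mul σ τ _ _ h1 h2 =>
    rw [map_mul, ← mul_assoc]
    simpa using add_mem (h2 (w * ofPerm σ)) (h1 w)
  | inv σ _ h =>
    have := neg_mem (h (w * ofPerm σ⁻¹))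
    rwa [mul_assoc, ← map_mul, inv_mul_cancel, map_one, mul_one, neg_sub] at this

theorem regRep_inducedIdeal (hβ : ζ ∈ tBeta β) {h : Hecke N} (hh : h ∈ inducedIdeal β ζ) :
    regRep ζ h (Finsupp.single 1 1) ∈ cosetKer β := by
  induction hh using Submodule.span_induction with
  | mem h hh =>
    rcases hh with ⟨u, hu, rfl⟩ | ⟨ξ, rfl⟩
    · have := single_parabolic_sub_mem hu 1
      simpa [regRep_ofW] using this
    · rw [map_sub, regRep_ofT, AlgHom.commutes, LinearMap.sub_apply, dunklT_single_one,
        Module.algebraMap_end_apply, sub_self]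
      exact zero_mem _
  | zero => simp
  | add x y _ _ hx hy => rw [map_add]; exact add_mem hx hy
  | smul z x _ hx =>
    rw [smul_eq_mul, map_mul]
    exact regRep_mem_cosetKer hβ z hx

/-- Takes the place of a basis theorem for the induced module. Applying `regRep` to the unit of `W`
sends the inducing ideal into `cosetKer β`, on which the indicator of a right `W̄_β`-stable set
vanishes. -/
theorem exists_functional (hβ : ζ ∈ tBeta β) (D : Set (W N))
    (hD : ∀ u ∈ parabolic β, ∀ w, w * ofPerm u ∈ D ↔ w ∈ D) :
    ∃ f : Y β ζ →ₗ[ℂ] ℂ, ∀ w, f ((ofW w : Hecke N) • cyc β ζ) = D.indicator 1 w := by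
  set g : (W N →₀ ℂ) →ₗ[ℂ] ℂ := Finsupp.linearCombination ℂ (D.indicator 1) with hg
  have hgK : ∀ x ∈ cosetKer β, g x = 0 := by
    intro x hx
    induction hx using Submodule.span_induction with
    | mem x hx =>
      obtain ⟨w, j, hj, e, rfl⟩ := hx
      have := hD _ (swap_mem_parabolic hj e) w
      rw [ofPerm_swap hj] at this
      by_cases hw : w ∈ D
      · simp [hg, hw, this]
      · simp [hg, hw, this]
    | zero => simp
    | add x y _ _ hx hy => rw [map_add, hx, hy, add_zero]
    | smul z x _ hx => rw [map_smul, hx, smul_zero]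
  let f₀ : Hecke N →ₗ[ℂ] ℂ :=
    g ∘ₗ LinearMap.applyₗ (R := ℂ) (Finsupp.single (1 : W N) (1 : ℂ)) ∘ₗ (regRep ζ).toLinearMap
  have hf₀ : (inducedIdeal β ζ).restrictScalars ℂ ≤ LinearMap.ker f₀ :=
    fun h hh => hgK _ (regRep_inducedIdeal hβ hh)
  refine ⟨((inducedIdeal β ζ).restrictScalars ℂ).liftQ f₀ hf₀ ∘ₗ
    (Submodule.Quotient.restrictScalarsEquiv ℂ (inducedIdeal β ζ)).symm.toLinearMap, fun w => ?_⟩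
  change f₀ (ofW w * 1) = _
  simp [f₀, hg, regRep_ofW]

end Functionals

/-! ### Relations in `ℋ` -/

section Relations

variable {N : ℕ} [NeZero N]

theorem simple_mul_ofT (i : Fin N) (ξ : TPrime N) :
    ofW (simpleRefl i) * ofT ξ =
      ofT (actT (simpleRefl i) ξ) * ofW (simpleRefl i) - algebraMap ℂ (Hecke N) (alphaT i ξ) := by
  have h := RingQuot.mkAlgHom_rel ℂ (Rel.cross (N := N) i ξ)
  rw [map_sub, map_mul, map_mul, map_neg, AlgHom.commutes] at h
  rw [sub_eq_iff_eq_add] at h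
  rw [sub_eq_neg_add]
  exact h

theorem ofT_mul_simple (i : Fin N) (ξ : TPrime N) :
    ofT ξ * ofW (simpleRefl i) =
      ofW (simpleRefl i) * ofT (actT (simpleRefl i) ξ) -
        algebraMap ℂ (Hecke N) (alphaT i ξ) := by
  rw [simple_mul_ofT, actT_simple_simple, alphaT_actT_simple, map_neg]
  abel

theorem pi_mul_ofT (k : ℤ) (ξ : TPrime N) :
    ofW (piElt N ^ k) * ofT ξ = ofT (actT (piElt N ^ k) ξ) * ofW (piElt N ^ k) := by
  have h1 : ∀ ξ : TPrime N, ofW (piElt N) * ofT ξ = ofT (actT (piElt N) ξ) * ofW (piElt N) := by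
    intro ξ
    have h := RingQuot.mkAlgHom_rel ℂ (Rel.pi_cross ξ)
    rw [map_mul, map_mul] at h
    exact h
  have h2 : ∀ ξ : TPrime N,
      ofW (piElt N)⁻¹ * ofT ξ = ofT (actT (piElt N)⁻¹ ξ) * ofW (piElt N)⁻¹ := by
    intro ξ
    have h := h1 (actT (piElt N)⁻¹ ξ)
    rw [← actT_mul, mul_inv_cancel, actT_one] at h
    have h3 : (ofW (piElt N)⁻¹ : Hecke N) * ofW (piElt N) = 1 := by
      rw [← map_mul, inv_mul_cancel, map_one]
    have h4 : (ofW (piElt N) : Hecke N) * ofW (piElt N)⁻¹ = 1 := by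
      rw [← map_mul, mul_inv_cancel, map_one]
    calc ofW (piElt N)⁻¹ * ofT ξ
        = ofW (piElt N)⁻¹ * (ofT ξ * ofW (piElt N)) * ofW (piElt N)⁻¹ := by
          rw [mul_assoc, mul_assoc, h4, mul_one]
      _ = _ := by rw [← h, ← mul_assoc, h3, one_mul]
  induction k using Int.induction_on generalizing ξ with
  | zero => simp [actT_one]
  | succ n ih => rw [zpow_add_one, map_mul, mul_assoc, h1, ← mul_assoc, ih, actT_mul, mul_assoc]
  | pred n ih => rw [zpow_sub_one, map_mul, mul_assoc, h2, ← mul_assoc, ih, actT_mul, mul_assoc]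

theorem ofT_mul_pi (k : ℤ) (ξ : TPrime N) :
    ofT ξ * ofW (piElt N ^ k) = ofW (piElt N ^ k) * ofT (actT (piElt N ^ k)⁻¹ ξ) := by
  rw [pi_mul_ofT, ← actT_mul, mul_inv_cancel, actT_one]

/-- `W̄` is generated by the simple reflections. -/
theorem WBar_induction {P : WBar N → Prop} (one : P 1)
    (simple : ∀ (i : Fin N) (σ : WBar N), i ≠ 0 → P σ → P (Equiv.swap (i - 1) i * σ))
    (σ : WBar N) : P σ := by
  obtain ⟨n, rfl⟩ := Nat.exists_eq_succ_of_ne_zero (NeZero.ne N)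
  have h : σ ∈ Submonoid.closure
      (Set.range fun i : Fin n => Equiv.swap (Fin.castSucc i) (Fin.succ i)) := by
    rw [Equiv.Perm.mclosure_swap_castSucc_succ]
    trivial
  induction h using Submonoid.closure_induction_left with
  | one => exact one
  | mul_left x hx y _ ih =>
    obtain ⟨i, rfl⟩ := hx
    have hi : i.succ - 1 = i.castSucc := by
      apply Fin.ext
      rw [Fin.val_sub_one_of_ne_zero (Fin.succ_ne_zero i)]
      simp
    have := simple i.succ y (Fin.succ_ne_zero i) ih
    rwa [hi] at this

/-- The interchange of a simple reflection with a polynomial, in terms of a divided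
difference. -/
theorem exists_divided_difference (i : Fin N) (p : SymmetricAlgebra ℂ (TPrime N))
    {a : SymmetricAlgebra ℂ (TPrime N) →ₐ[ℂ] SymmetricAlgebra ℂ (TPrime N)}
    (ha : a = SymmetricAlgebra.lift
      (SymmetricAlgebra.ι ℂ (TPrime N) ∘ₗ actT (simpleRefl i))) :
    ∃ q, p - a p = SymmetricAlgebra.ι ℂ _ (simpleCoroot i) * q ∧
      ofW (simpleRefl i) * ofSym p = ofSym (a p) * ofW (simpleRefl i) - ofSym q := by
  induction p using SymmetricAlgebra.induction with
  | algebraMap z =>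
    exact ⟨0, by simp, by
      rw [AlgHom.commutes, AlgHom.commutes, AlgHom.commutes, map_zero, sub_zero,
        Algebra.commutes]⟩
  | ι ξ =>
    refine ⟨algebraMap ℂ _ (alphaT i ξ), ?_, ?_⟩
    · rw [ha, SymmetricAlgebra.lift_ι_apply, LinearMap.comp_apply, actT_simple, map_sub,
        sub_sub_cancel, map_smul, ← Algebra.commutes, Algebra.smul_def]
    · rw [ha, SymmetricAlgebra.lift_ι_apply, LinearMap.comp_apply, ofSym_ι, ofSym_ι,
        AlgHom.commutes, simple_mul_ofT]
  | mul p p' hp hp' =>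
    obtain ⟨q, h1, h2⟩ := hp
    obtain ⟨q', h1', h2'⟩ := hp'
    refine ⟨a p * q' + q * p', ?_, ?_⟩
    · rw [map_mul]
      linear_combination p' * h1 + a p * h1'
    · rw [map_mul, ← mul_assoc, h2, sub_mul, mul_assoc, h2', map_mul, map_add, map_mul ofSym q,
        map_mul, map_mul, mul_sub, mul_assoc]
      abel
  | add p p' hp hp' =>
    obtain ⟨q, h1, h2⟩ := hp
    obtain ⟨q', h1', h2'⟩ := hp'
    refine ⟨q + q', ?_, ?_⟩
    · rw [map_add]
      linear_combination h1 + h1'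
    · rw [map_add, mul_add, h2, h2', map_add, map_add, map_add, add_mul]
      abel

/-- For invariant `p` the product of `α_i^∨` with the divided difference is `p - s_i p = 0`. The
symmetric algebra is a domain, so the correction term vanishes. -/
theorem symInv_comm (p : symInv N) (σ : WBar N) :
    ofW (ofPerm σ) * ofSym (p : SymmetricAlgebra ℂ (TPrime N)) =
      ofSym (p : SymmetricAlgebra ℂ (TPrime N)) * ofW (ofPerm σ) := by
  induction σ using WBar_induction with
  | one => simp
  | simple i σ hi ih =>
    rw [map_mul, map_mul, mul_assoc, ih, ← mul_assoc, ← mul_assoc]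
    congr 1
    obtain ⟨q, h1, h2⟩ := exists_divided_difference i p.1 rfl
    have h3 : actSym (Equiv.swap (i - 1) i) p.1 = p.1 := by
      exact Algebra.mem_iInf.1 p.2 (Equiv.swap (i - 1) i)
    rw [actSym, ofPerm_swap hi] at h3
    rw [h3, sub_self, eq_comm, mul_eq_zero] at h1
    rw [ofPerm_swap hi, h2, h3]
    rcases h1 with h1 | h1
    -- Evaluation at `α_i` sends `α_i^∨` to `2`, so this factor is not zero.
    · have h4 := congrArg (SymmetricAlgebra.lift (alphaT i)) h1
      rw [SymmetricAlgebra.lift_ι_apply, alphaT_simpleCoroot (ne_one_of_ne_zero hi),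
        map_zero] at h4
      norm_num at h4
    · rw [h1, map_zero, sub_zero]

/-! ### The symmetrizer -/

theorem symmetrizer_mul (σ : WBar N) : symmetrizer N * ofW (ofPerm σ) = symmetrizer N := by
  rw [symmetrizer, smul_mul_assoc, Finset.sum_mul]
  congr 1
  simp only [← map_mul]
  exact Fintype.sum_equiv (Equiv.mulRight σ) _ _ fun _ => rfl

theorem mul_symmetrizer (σ : WBar N) : ofW (ofPerm σ) * symmetrizer N = symmetrizer N := by
  rw [symmetrizer, mul_smul_comm, Finset.mul_sum]
  congr 1
  simp only [← map_mul]
  exact Fintype.sum_equiv (Equiv.mulLeft σ) _ _ fun _ => rfl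

theorem symInv_symmetrizer (p : symInv N) :
    ofSym (p : SymmetricAlgebra ℂ (TPrime N)) * symmetrizer N =
      symmetrizer N * ofSym (p : SymmetricAlgebra ℂ (TPrime N)) := by
  rw [symmetrizer, smul_mul_assoc, mul_smul_comm, Finset.mul_sum, Finset.sum_mul]
  congr 1
  exact Finset.sum_congr rfl fun σ _ => (symInv_comm p σ).symm

end Relations

/-! ### Weight vectors -/

section Weights

variable {N : ℕ} [NeZero N] {V : Type*} [AddCommGroup V] [Module ℂ V] [Module (Hecke N) V]
  [IsScalarTower ℂ (Hecke N) V]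

variable (V) in
/-- The weight space of weight `μ` of an `ℋ`-module. -/
def wtSpace (μ : TDual N) : Submodule ℂ V where
  carrier := {v | ∀ ξ : TPrime N, (ofT ξ : Hecke N) • v = μ ξ • v}
  add_mem' := fun ha hb ξ => by rw [smul_add, smul_add, ha ξ, hb ξ]
  zero_mem' := fun ξ => by rw [smul_zero, smul_zero]
  smul_mem' := fun z v hv ξ => by rw [smul_comm, hv ξ, smul_comm]

variable {μ : TDual N} {v : V}

theorem phiSimple_smul (hv : v ∈ wtSpace V μ) (i : Fin N) :
    phiSimple i • v = v + μ (simpleCoroot i) • (ofW (simpleRefl i) : Hecke N) • v := by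
  rw [phiSimple, add_smul, one_smul, mul_smul, hv, smul_comm]

/-- The constant `-α_i(ξ)` of the cross relation changes the coefficient `μ(ξ)` of `v` into `μ(s_i
ξ)`, which is already the factor at `s_i v`. -/
theorem phiSimple_mem (hv : v ∈ wtSpace V μ) (i : Fin N) :
    phiSimple i • v ∈ wtSpace V (affAct (simpleRefl i) μ) := by
  intro ξ
  rw [phiSimple_smul hv, smul_add, smul_comm, ← mul_smul, ofT_mul_simple, sub_smul, mul_smul, hv,
    hv, algebraMap_smul, affAct_apply, simpleRefl_inv, actT_simple, map_sub, map_smul, smul_eq_mul,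
    smul_comm (ofW (simpleRefl i) : Hecke N)]
  generalize (ofW (simpleRefl i) : Hecke N) • v = y
  module

/-- When `μ(α_i^∨) ≠ ±1`, as genericity provides, this shows that `φ_i` does not kill a nonzero
weight vector. -/
theorem phiSimple_phiSimple (hN : N ≠ 1) (hv : v ∈ wtSpace V μ) (i : Fin N) :
    phiSimple i • phiSimple i • v = (1 - μ (simpleCoroot i) ^ 2) • v := by
  rw [phiSimple_smul (phiSimple_mem hv i), affAct_apply, simpleRefl_inv, actT_simple_coroot hN,
    phiSimple_smul hv, smul_add, smul_comm (ofW (simpleRefl i) : Hecke N) (μ (simpleCoroot i)),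
    ← mul_smul (ofW (simpleRefl i) : Hecke N), ← map_mul, simpleRefl_mul_self, map_one, one_smul,
    map_neg]
  generalize (ofW (simpleRefl i) : Hecke N) • v = y
  module

theorem pi_smul_mem (hv : v ∈ wtSpace V μ) (k : ℤ) :
    (ofW (piElt N ^ k) : Hecke N) • v ∈ wtSpace V (affAct (piElt N ^ k) μ) := by
  intro ξ
  rw [← mul_smul, ofT_mul_pi, mul_smul, hv, affAct_apply, smul_comm]

theorem ofSym_smul (hv : v ∈ wtSpace V μ) (p : SymmetricAlgebra ℂ (TPrime N)) :
    ofSym p • v = SymmetricAlgebra.lift μ p • v := by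
  induction p using SymmetricAlgebra.induction with
  | algebraMap z => rw [AlgHom.commutes, AlgHom.commutes, algebraMap_smul]; rfl
  | ι ξ => rw [ofSym_ι, SymmetricAlgebra.lift_ι_apply, hv]
  | mul p q hp hq => rw [map_mul, mul_smul, hq, smul_comm, hp, map_mul, smul_smul, mul_comm]
  | add p q hp hq => rw [map_add, add_smul, hp, hq, map_add, add_smul]

theorem symmetrizer_smul_mem (v : V) : symmetrizer N • v ∈ invPart (N := N) V := by
  intro σ
  rw [← mul_smul, mul_symmetrizer]

theorem symmetrizer_smul_of_mem (hv : v ∈ invPart (N := N) V) : symmetrizer N • v = v := by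
  rw [symmetrizer, smul_assoc, Finset.sum_smul, Finset.sum_congr rfl fun σ _ => hv σ,
    Finset.sum_const, Finset.card_univ, Fintype.card_perm, Fintype.card_fin,
    ← Nat.cast_smul_eq_nsmul ℂ, smul_smul, inv_mul_cancel₀, one_smul]
  exact_mod_cast N.factorial_ne_zero

theorem symmetrizer_smul_mem_invEigen (hv : v ∈ wtSpace V μ) :
    symmetrizer N • v ∈ invEigen V (evalChar μ) := by
  refine ⟨symmetrizer_smul_mem v, fun p => ?_⟩
  rw [← mul_smul, symInv_symmetrizer, mul_smul, ofSym_smul hv, smul_comm]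
  rfl

theorem symmetrizer_phiSimple (hv : v ∈ wtSpace V μ) {i : Fin N} (hi : i ≠ 0) :
    symmetrizer N • phiSimple i • v = (1 + μ (simpleCoroot i)) • symmetrizer N • v := by
  rw [phiSimple_smul hv, smul_add, smul_comm, ← mul_smul, ← ofPerm_swap hi, symmetrizer_mul,
    add_smul, one_smul]

end Weights

/-! ### Independence of eigenspaces and separation of orbits by invariants -/

section Eigen

/-- Simultaneous eigenspaces lie in the simultaneous generalized ones, which are independent for
distinct systems of eigenvalues of commuting operators. -/
theorem iSupIndep_eigen {V A ι : Type*} [AddCommGroup V] [Module ℂ V] (T : A → Module.End ℂ V)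
    (comm : ∀ a b, Commute (T a) (T b)) {χ : ι → A → ℂ} (hχ : Function.Injective χ)
    {E : ι → Submodule ℂ V} (hE : ∀ x, ∀ v ∈ E x, ∀ a, T a v = χ x a • v) : iSupIndep E := by
  refine ((Module.End.independent_iInf_maxGenEigenspace_of_forall_mapsTo T fun i j φ =>
    Module.End.mapsTo_maxGenEigenspace_of_comm (comm j i) φ).comp hχ).mono fun x v hv => ?_
  rw [Function.comp_apply, Submodule.mem_iInf]
  intro a
  refine (Module.End.mem_maxGenEigenspace _ _ _).2 ⟨1, ?_⟩
  rw [pow_one, LinearMap.sub_apply, hE x v hv a, LinearMap.smul_apply, Module.End.one_apply,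
    sub_self]

/-- By the modular law, anything in `A x` beyond `B x` would have to come from the other `A y`. Used
to show that lines which already span are the full eigenspaces. -/
theorem eq_of_iSupIndep {V ι : Type*} [AddCommGroup V] [Module ℂ V] {A B : ι → Submodule ℂ V}
    (hA : iSupIndep A) (hBA : ∀ x, B x ≤ A x) (h : ⨆ x, A x ≤ ⨆ x, B x) (x : ι) :
    A x = B x := by
  refine le_antisymm ?_ (hBA x)
  have h1 : A x ≤ B x ⊔ ⨆ (y) (_ : y ≠ x), A y := by
    refine (le_iSup A x).trans (h.trans (iSup_le fun y => ?_))
    by_cases e : y = x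
    · exact e ▸ le_sup_left
    · exact (hBA y).trans (le_sup_of_le_right (le_iSup₂_of_le y e le_rfl))
  calc A x ≤ (B x ⊔ ⨆ (y) (_ : y ≠ x), A y) ⊓ A x := le_inf h1 le_rfl
    _ = B x ⊔ (⨆ (y) (_ : y ≠ x), A y) ⊓ A x := sup_inf_assoc_of_le _ (hBA x)
    _ = B x := by rw [inf_comm, (hA x).eq_bot, sup_bot_eq]

/-- Equal multisets have fibres of equal size, and bijections between the fibres glue. -/
theorem exists_perm_of_map_eq {n : ℕ} {a b : Fin n → ℂ}
    (h : Finset.univ.val.map a = Finset.univ.val.map b) :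
    ∃ σ : Equiv.Perm (Fin n), ∀ i, b (σ i) = a i := by
  classical
  have hc : ∀ c, Nonempty ({i // a i = c} ≃ {i // b i = c}) := by
    intro c
    rw [← Fintype.card_eq, Fintype.card_subtype, Fintype.card_subtype]
    have := congrArg (Multiset.count c) h
    rw [Multiset.count_map, Multiset.count_map] at this
    simp only [eq_comm (a := c)] at this
    exact this
  exact ⟨Equiv.ofFiberEquiv fun c => (hc c).some, Equiv.ofFiberEquiv_map _⟩

/-! ### Separation of `W̄`-orbits by invariant polynomials -/

variable {N : ℕ}

theorem actSym_ι (σ : WBar N) (ξ : TPrime N) :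
    actSym σ (SymmetricAlgebra.ι ℂ _ ξ) = SymmetricAlgebra.ι ℂ _ (actT (ofPerm σ) ξ) := by
  rw [actSym, SymmetricAlgebra.lift_ι_apply, LinearMap.comp_apply]

theorem mem_symInv {p : SymmetricAlgebra ℂ (TPrime N)} :
    p ∈ symInv N ↔ ∀ σ, actSym σ p = p :=
  Algebra.mem_iInf

variable [NeZero N]

/-- Invariant polynomials separate the `W̄`-orbits. -/
theorem exists_perm_of_evalChar_eq {μ μ' : TDual N} (h : evalChar μ = evalChar μ') :
    ∃ σ : WBar N, affAct (ofPerm σ) μ = μ' := by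
  have hev : ∀ p ∈ symInv N, SymmetricAlgebra.lift μ p = SymmetricAlgebra.lift μ' p :=
    fun p hp => DFunLike.congr_fun h (⟨p, hp⟩ : symInv N)
  have hc : μ (cElt N) = μ' (cElt N) := by
    have := hev (SymmetricAlgebra.ι ℂ _ (cElt N))
      (mem_symInv.2 fun σ => by rw [actSym_ι, actT_cElt])
    rwa [SymmetricAlgebra.lift_ι_apply, SymmetricAlgebra.lift_ι_apply] at this
  -- The coefficients of `P` are invariant, so `μ` and `μ'` specialize it to the same polynomial,
  -- whose roots are the values at the `ε_i^∨`.
  set P : Polynomial (SymmetricAlgebra ℂ (TPrime N)) :=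
    ∏ i : Fin N, (Polynomial.X - Polynomial.C (SymmetricAlgebra.ι ℂ _ (epsT N ((i : ℕ) : ℤ))))
    with hP
  have hinv : ∀ σ : WBar N, P.map (actSym σ : _ →+* _) = P := by
    intro σ
    rw [hP, Polynomial.map_prod]
    refine Fintype.prod_equiv σ _ _ fun i => ?_
    rw [Polynomial.map_sub, Polynomial.map_X, Polynomial.map_C, RingHom.coe_coe, actSym_ι,
      actT_epsT, aff_ofPerm_coe]
  have hmap : P.map (SymmetricAlgebra.lift μ : _ →+* ℂ) =
      P.map (SymmetricAlgebra.lift μ' : _ →+* ℂ) := by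
    ext n
    rw [Polynomial.coeff_map, Polynomial.coeff_map]
    refine hev _ (mem_symInv.2 fun σ => ?_)
    have := congrArg (fun p => Polynomial.coeff p n) (hinv σ)
    rwa [Polynomial.coeff_map] at this
  have hroots : ∀ ν : TDual N, (P.map (SymmetricAlgebra.lift ν : _ →+* ℂ)).roots =
      Finset.univ.val.map fun i : Fin N => ν (epsT N ((i : ℕ) : ℤ)) := by
    intro ν
    rw [hP, Polynomial.map_prod]
    simp only [Polynomial.map_sub, Polynomial.map_X, Polynomial.map_C, RingHom.coe_coe,
      SymmetricAlgebra.lift_ι_apply]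
    have := Polynomial.roots_multiset_prod_X_sub_C
      (Finset.univ.val.map fun i : Fin N => ν (epsT N ((i : ℕ) : ℤ)))
    rwa [Multiset.map_map] at this
  obtain ⟨σ, hσ⟩ := exists_perm_of_map_eq ((hroots μ).symm.trans ((congrArg _ hmap).trans
    (hroots μ')))
  refine ⟨σ, TPrime_hom_ext (fun i => ?_) (by rw [affAct_cElt, hc])⟩
  rw [affAct_epsT, ← map_inv, aff_ofPerm_coe, ← hσ, perm_apply_inv]

end Eigen

/-! ### The module `𝒴_β(ζ)` -/

section Induced

variable {N : ℕ} [NeZero N] {β : Composition N} {ζ : TDual N}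

theorem cyc_mem_wtSpace : cyc β ζ ∈ wtSpace (Y β ζ) ζ := by
  intro ξ
  rw [← algebraMap_smul (Hecke N) (ζ ξ), ← sub_eq_zero, ← sub_smul]
  refine (Submodule.Quotient.mk_eq_zero (inducedIdeal β ζ)).2 ?_
  change (ofT ξ - algebraMap ℂ (Hecke N) (ζ ξ)) * 1 ∈ inducedIdeal β ζ
  rw [mul_one]
  exact Submodule.subset_span (Or.inr ⟨ξ, rfl⟩)

theorem parabolic_smul_cyc {u : WBar N} (hu : u ∈ parabolic β) :
    (ofW (ofPerm u) : Hecke N) • cyc β ζ = cyc β ζ := by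
  rw [← sub_eq_zero]
  nth_rewrite 2 [← one_smul (Hecke N) (cyc β ζ)]
  rw [← sub_smul]
  refine (Submodule.Quotient.mk_eq_zero (inducedIdeal β ζ)).2 ?_
  change (ofW (ofPerm u) - 1) * 1 ∈ inducedIdeal β ζ
  rw [mul_one]
  exact Submodule.subset_span (Or.inl ⟨u, hu, rfl⟩)

theorem ofW_mul_parabolic_smul_cyc {u : WBar N} (hu : u ∈ parabolic β) (y : W N) :
    (ofW (y * ofPerm u) : Hecke N) • cyc β ζ = (ofW y : Hecke N) • cyc β ζ := by
  rw [map_mul, mul_smul, parabolic_smul_cyc hu]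

/-- The span of the vectors `y 1_ζ`, `l(y) < n`. -/
def lower (β : Composition N) (ζ : TDual N) (n : ℕ) : Submodule ℂ (Y β ζ) :=
  Submodule.span ℂ {v | ∃ y : W N, length y < n ∧ v = (ofW y : Hecke N) • cyc β ζ}

theorem ofW_mem_lower {y : W N} {n : ℕ} (h : length y < n) :
    (ofW y : Hecke N) • cyc β ζ ∈ lower β ζ n :=
  Submodule.subset_span ⟨y, h, rfl⟩

theorem lower_mono {m n : ℕ} (h : m ≤ n) : lower β ζ m ≤ lower β ζ n :=
  Submodule.span_mono fun _ ⟨y, hy, e⟩ => ⟨y, hy.trans_le h, e⟩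

theorem ofW_smul_mem_lower {w : W N} {m n : ℕ} (h : ∀ y, length y < m → length (w * y) < n)
    {v : Y β ζ} (hv : v ∈ lower β ζ m) : (ofW w : Hecke N) • v ∈ lower β ζ n := by
  induction hv using Submodule.span_induction with
  | mem v hv =>
    obtain ⟨y, hy, rfl⟩ := hv
    rw [← mul_smul, ← map_mul]
    exact ofW_mem_lower (h y hy)
  | zero => rw [smul_zero]; exact zero_mem _
  | add x y _ _ hx hy => rw [smul_add]; exact add_mem hx hy
  | smul z x _ hx => rw [smul_comm]; exact Submodule.smul_mem _ z hx

theorem simple_smul_mem_lower (i : Fin N) {n : ℕ} {v : Y β ζ} (hv : v ∈ lower β ζ n) :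
    (ofW (simpleRefl i) : Hecke N) • v ∈ lower β ζ (n + 1) :=
  ofW_smul_mem_lower (fun y hy => (length_simple_mul_le y i).trans_lt (by omega)) hv

theorem pi_smul_mem_lower (k : ℤ) {n : ℕ} {v : Y β ζ} (hv : v ∈ lower β ζ n) :
    (ofW (piElt N ^ k) : Hecke N) • v ∈ lower β ζ n :=
  ofW_smul_mem_lower (fun y hy => by rwa [length_pi_mul]) hv

/-- `𝒴_β(ζ)` is spanned by the vectors `y 1_ζ`, `y ∈ W`. -/
theorem span_ofW_smul_cyc :
    Submodule.span ℂ (Set.range fun y : W N => (ofW y : Hecke N) • cyc β ζ) = ⊤ := by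
  set S := Submodule.span ℂ (Set.range fun y : W N => (ofW y : Hecke N) • cyc β ζ) with hS
  have hgen : ∀ h : Hecke N, (∀ y : W N, h • (ofW y : Hecke N) • cyc β ζ ∈ S) →
      ∀ v ∈ S, h • v ∈ S := by
    intro h hh v hv
    induction hv using Submodule.span_induction with
    | mem v hv =>
      obtain ⟨y, rfl⟩ := hv
      exact hh y
    | zero => rw [smul_zero]; exact zero_mem _
    | add x y _ _ hx hy => rw [smul_add]; exact add_mem hx hy
    | smul z x _ hx => rw [smul_comm]; exact Submodule.smul_mem _ z hx
  have hW : ∀ w : W N, ∀ v ∈ S, (ofW w : Hecke N) • v ∈ S := fun w =>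
    hgen _ fun y => Submodule.subset_span ⟨w * y, by rw [← mul_smul, ← map_mul]⟩
  have hT : ∀ (ξ : TPrime N) (y : W N), (ofT ξ : Hecke N) • (ofW y : Hecke N) • cyc β ζ ∈ S := by
    intro ξ y
    induction y using W_induction generalizing ξ with
    | one =>
      rw [map_one, one_smul, cyc_mem_wtSpace]
      exact Submodule.smul_mem _ _ (Submodule.subset_span ⟨1, by simp only [map_one, one_smul]⟩)
    | simple i y ih =>
      rw [map_mul, mul_smul, ← mul_smul, ofT_mul_simple, sub_smul, mul_smul, algebraMap_smul]
      exact sub_mem (hW _ _ (ih _)) (Submodule.smul_mem _ _ (Submodule.subset_span ⟨y, rfl⟩))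
    | pi k y ih =>
      rw [map_mul, mul_smul, ← mul_smul, ofT_mul_pi, mul_smul]
      exact hW _ _ (ih _)
  have hall : ∀ h : Hecke N, ∀ v ∈ S, h • v ∈ S := by
    intro h
    induction h using Hecke_induction with
    | scalar z => intro v hv; rw [algebraMap_smul]; exact Submodule.smul_mem _ z hv
    | ofW w => exact hW w
    | ofT ξ => exact hgen _ (hT ξ)
    | mul a b ha hb => intro v hv; rw [mul_smul]; exact ha _ (hb v hv)
    | add a b ha hb => intro v hv; rw [add_smul]; exact add_mem (ha v hv) (hb v hv)
  refine eq_top_iff.2 fun v _ => ?_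
  obtain ⟨h, rfl⟩ := Submodule.mkQ_surjective (inducedIdeal β ζ) v
  have : (inducedIdeal β ζ).mkQ h = h • cyc β ζ := by
    rw [cyc]
    exact (congrArg _ (mul_one h).symm).trans (map_smul (inducedIdeal β ζ).mkQ h 1)
  rw [this]
  exact hall h _ (Submodule.subset_span ⟨1, by simp only [map_one, one_smul]⟩)

/-- The values of `w(ζ)` on simple coroots are generic as long as `w` and `s_i w` are in `W^β`. -/
theorem IsGeneric.weight_simpleCoroot (hgen : IsGeneric β ζ) (hN : N ≠ 1) {w : W N} {i : Fin N}
    (hw : w ∈ minReps β) (hsw : simpleRefl i * w ∈ minReps β) :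
    affAct w ζ (simpleCoroot i) ∉ ({1, 0, -1} : Set ℂ) := by
  have hval : affAct w ζ (simpleCoroot i) = pairing ζ
      (root N (aff w⁻¹ (((i : ℕ) : ℤ) - 1)) (aff w⁻¹ ((i : ℕ) : ℤ))) := by
    rw [simpleCoroot_eq, map_sub, affAct_epsT, affAct_epsT, pairing_root]
  rw [hval]
  rcases aff_lt_or_gt w⁻¹ (sub_one_lt ((i : ℕ) : ℤ)).ne with h | h
  · refine hgen _ hsw _ (mem_invSet_iff.2 ⟨_, _, h, ?_, rfl⟩)
    rw [aff_mul, aff_mul, aff_aff_inv, aff_aff_inv,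
      aff_simple_of_res_succ hN (a := ((i : ℕ) : ℤ) - 1) (by rw [sub_add_cancel, res_coe]),
      aff_simple_of_res_eq hN (a := ((i : ℕ) : ℤ)) (res_coe i)]
    linarith
  · have h1 := hgen w hw (root N (aff w⁻¹ ((i : ℕ) : ℤ)) (aff w⁻¹ (((i : ℕ) : ℤ) - 1)))
      (mem_invSet_iff.2 ⟨_, _, h, by rw [aff_aff_inv, aff_aff_inv]; linarith, rfl⟩)
    rw [pairing_root] at h1 ⊢
    rw [← neg_sub]
    intro h2
    refine h1 ?_
    simp only [Set.mem_insert_iff, Set.mem_singleton_iff, neg_eq_iff_eq_neg, neg_zero,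
      neg_neg] at h2 ⊢
    tauto

/-- The leading term of `φ_{j_1} ⋯ φ_{j_m} 1_ζ`. -/
theorem phi_prod_leading (hgen : IsGeneric β ζ) (L : List (Fin N))
    (hL : L.length = length (L.map simpleRefl).prod) (hw : (L.map simpleRefl).prod ∈ minReps β) :
    (L.map phiSimple).prod • cyc β ζ ∈
        wtSpace (Y β ζ) (affAct (L.map simpleRefl).prod ζ) ∧
      ∃ c : ℂ, c ≠ 0 ∧ (L.map phiSimple).prod • cyc β ζ -
        c • (ofW (L.map simpleRefl).prod : Hecke N) • cyc β ζ ∈ lower β ζ L.length := by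
  induction L with
  | nil =>
    simp only [List.map_nil, List.prod_nil, one_smul, affAct_one]
    exact ⟨cyc_mem_wtSpace, 1, one_ne_zero, by simp⟩
  | cons i L ih =>
    simp only [List.map_cons, List.prod_cons, List.length_cons] at hL hw ⊢
    set w := (L.map simpleRefl).prod with hwdef
    have hN : N ≠ 1 := by
      intro hN
      rw [length_eq_zero_of_eq_one hN] at hL
      omega
    have hle := length_prod_le L
    rw [← hwdef] at hle
    have hle' := length_simple_mul_le w i
    -- Forced by reducedness: at a descent `s_i w` would be shorter than `w`, which is already no
    -- longer than `L.length`.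
    have hasc : aff w⁻¹ (((i : ℕ) : ℤ) - 1) < aff w⁻¹ ((i : ℕ) : ℤ) := by
      rcases aff_lt_or_gt w⁻¹ (sub_one_lt ((i : ℕ) : ℤ)).ne with h | h
      · exact h
      · have := length_simple_mul' hN h
        omega
    have hw' := minReps_of_simple_mul hw hasc
    obtain ⟨h1, c, hc, h2⟩ := ih (by omega) hw'
    have hgi := hgen.weight_simpleCoroot hN hw' hw
    rw [mul_smul, affAct_mul]
    refine ⟨phiSimple_mem h1 i, affAct w ζ (simpleCoroot i) * c, mul_ne_zero ?_ hc, ?_⟩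
    · intro h
      exact hgi (by rw [h]; simp)
    · rw [phiSimple_smul h1]
      set v := (L.map phiSimple).prod • cyc β ζ with hv
      have h3 : v ∈ lower β ζ (L.length + 1) := by
        have := add_mem (lower_mono (Nat.le_succ _) h2)
          (Submodule.smul_mem (lower β ζ (L.length + 1)) c (ofW_mem_lower (by omega : length w < _)))
        rwa [sub_add_cancel] at this
      have h4 := Submodule.smul_mem _ (affAct w ζ (simpleCoroot i))
        (simple_smul_mem_lower i h2)
      have h5 := add_mem h3 h4
      rw [smul_sub, smul_comm (ofW (simpleRefl i) : Hecke N) c, ← mul_smul (ofW (simpleRefl i)) (ofW w),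
        ← map_mul, smul_sub, smul_smul _ c, ← add_sub_assoc] at h5
      exact h5

theorem phiExpr_leading (hgen : IsGeneric β ζ) {w : W N} (hw : w ∈ minReps β) {k : ℤ}
    {L : List (Fin N)} (h : IsReducedExpr w k L) :
    phiExpr k L • cyc β ζ ∈ wtSpace (Y β ζ) (affAct w ζ) ∧
      ∃ c : ℂ, c ≠ 0 ∧ phiExpr k L • cyc β ζ - c • (ofW w : Hecke N) • cyc β ζ ∈
        lower β ζ (length w) := by
  obtain ⟨rfl, hl⟩ := h
  rw [pi_mul_mem_minReps] at hw
  obtain ⟨h1, c, hc, h2⟩ := phi_prod_leading hgen L (by rw [hl, length_pi_mul]) hw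
  rw [phiExpr, mul_smul, affAct_mul, ← hl]
  refine ⟨pi_smul_mem h1 k, c, hc, ?_⟩
  have := pi_smul_mem_lower k h2
  rwa [smul_sub, smul_comm (ofW (piElt N ^ k) : Hecke N) c,
    ← mul_smul (ofW (piElt N ^ k)) (ofW _), ← map_mul] at this

/-- A linear functional reads off the leading coefficient. -/
theorem functional_leading (D : Set (W N)) {f : Y β ζ →ₗ[ℂ] ℂ}
    (hf : ∀ w, f ((ofW w : Hecke N) • cyc β ζ) = D.indicator 1 w) {w : W N} (hw : w ∈ D)
    (hmin : ∀ y ∈ D, length w ≤ length y) {v : Y β ζ} {c : ℂ}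
    (hv : v - c • (ofW w : Hecke N) • cyc β ζ ∈ lower β ζ (length w)) : f v = c := by
  have h0 : ∀ x ∈ lower β ζ (length w), f x = 0 := by
    intro x hx
    induction hx using Submodule.span_induction with
    | mem x hx =>
      obtain ⟨y, hy, rfl⟩ := hx
      rw [hf, Set.indicator_of_notMem]
      exact fun h => absurd (hmin y h) (not_le.2 hy)
    | zero => exact map_zero f
    | add x y _ _ hx hy => rw [map_add, hx, hy, add_zero]
    | smul z x _ hx => rw [map_smul, hx, smul_zero]
  have h1 := h0 _ hv
  rw [map_sub, map_smul, hf, Set.indicator_of_mem hw, sub_eq_zero] at h1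
  simpa using h1

/-- `w` has minimal length in `w W̄_β`, so the indicator of this coset picks out the nonzero leading
coefficient. -/
theorem phiExpr_smul_cyc_ne_zero (hβ : ζ ∈ tBeta β) (hgen : IsGeneric β ζ) {w : W N}
    (hw : w ∈ minReps β) {k : ℤ} {L : List (Fin N)} (h : IsReducedExpr w k L) :
    phiExpr k L • cyc β ζ ≠ 0 := by
  obtain ⟨-, c, hc, h1⟩ := phiExpr_leading hgen hw h
  obtain ⟨f, hf⟩ := exists_functional hβ {y | ∃ u ∈ parabolic β, y = w * ofPerm u} (by
    intro u hu y
    constructor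
    · rintro ⟨v, hv, e⟩
      refine ⟨v * u⁻¹, mul_mem hv (inv_mem hu), ?_⟩
      rw [map_mul, ← mul_assoc, ← e, mul_assoc, ← map_mul, mul_inv_cancel, map_one, mul_one]
    · rintro ⟨v, hv, rfl⟩
      exact ⟨v * u, mul_mem hv hu, by rw [map_mul, mul_assoc]⟩)
  have := functional_leading _ hf ⟨1, one_mem _, by simp⟩
    (by rintro _ ⟨u, hu, rfl⟩; exact hw u hu) h1
  intro h0
  rw [h0, map_zero] at this
  exact hc this.symm

/-- The vector `φ_w 1_ζ`, formed from some reduced expression of `w`. -/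
def stdVec (β : Composition N) (ζ : TDual N) (w : W N) : Y β ζ :=
  phiExpr (exists_reduced w).choose (exists_reduced w).choose_spec.choose • cyc β ζ

theorem stdVec_mem_wtSpace (hgen : IsGeneric β ζ) {w : W N} (hw : w ∈ minReps β) :
    stdVec β ζ w ∈ wtSpace (Y β ζ) (affAct w ζ) :=
  (phiExpr_leading hgen hw (exists_reduced w).choose_spec.choose_spec).1

theorem stdVec_leading (hgen : IsGeneric β ζ) {w : W N} (hw : w ∈ minReps β) :
    ∃ c : ℂ, c ≠ 0 ∧ stdVec β ζ w - c • (ofW w : Hecke N) • cyc β ζ ∈ lower β ζ (length w) :=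
  (phiExpr_leading hgen hw (exists_reduced w).choose_spec.choose_spec).2

theorem stdVec_ne_zero (hβ : ζ ∈ tBeta β) (hgen : IsGeneric β ζ) {w : W N}
    (hw : w ∈ minReps β) : stdVec β ζ w ≠ 0 :=
  phiExpr_smul_cyc_ne_zero hβ hgen hw (exists_reduced w).choose_spec.choose_spec

/-- Triangularity and induction on length: `y 1_ζ` depends only on `y W̄_β`, so `y` may be replaced
by a minimal representative, which is no longer, and the leading coefficient there is invertible. -/
theorem iSup_span_stdVec (hgen : IsGeneric β ζ) :
    ⨆ w : minReps β, Submodule.span ℂ {stdVec β ζ w} = ⊤ := by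
  set S := ⨆ w : minReps β, Submodule.span ℂ {stdVec β ζ w} with hS
  have key : ∀ n, lower β ζ n ≤ S := by
    intro n
    induction n with
    | zero =>
      refine Submodule.span_le.2 ?_
      rintro _ ⟨y, hy, rfl⟩
      exact absurd hy (Nat.not_lt_zero _)
    | succ n ih =>
      refine Submodule.span_le.2 ?_
      rintro _ ⟨y, hy, rfl⟩
      obtain ⟨u, hu, hmem, hle⟩ := exists_minRep β y
      rw [← ofW_mul_parabolic_smul_cyc hu]
      obtain ⟨c, hc, h⟩ := stdVec_leading hgen hmem
      have h1 := ih (lower_mono (by omega) h)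
      have h2 : stdVec β ζ (y * ofPerm u) ∈ S :=
        le_iSup (fun w : minReps β => Submodule.span ℂ {stdVec β ζ w}) ⟨_, hmem⟩
          (Submodule.mem_span_singleton_self _)
      have h3 := sub_mem h2 h1
      rw [sub_sub_cancel] at h3
      exact (Submodule.smul_mem_iff _ hc).1 h3
  rw [eq_top_iff, ← span_ofW_smul_cyc]
  refine Submodule.span_le.2 ?_
  rintro _ ⟨y, rfl⟩
  exact key _ (ofW_mem_lower (Nat.lt_succ_self _))

/-- The weight spaces of weight `w(ζ)`, `w ∈ W^β`, are one-dimensional. -/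
theorem wtSpace_eq_span (hβ : ζ ∈ tBeta β) (hgen : IsGeneric β ζ) (hδ : ζ (cElt N) ≠ 0)
    {w : W N} (hw : w ∈ minReps β) :
    wtSpace (Y β ζ) (affAct w ζ) = Submodule.span ℂ {stdVec β ζ w} := by
  -- The weights `w(ζ)` are distinct, so the weight spaces are independent, and the lines inside
  -- them already span the module.
  refine eq_of_iSupIndep (A := fun w : minReps β => wtSpace (Y β ζ) (affAct w.1 ζ))
    (B := fun w : minReps β => Submodule.span ℂ {stdVec β ζ w}) ?_ ?_ ?_ ⟨w, hw⟩
  · refine iSupIndep_eigen (A := TPrime N) (fun ξ => Algebra.lsmul ℂ ℂ (Y β ζ) (ofT ξ)) ?_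
      (χ := fun w ξ => affAct w.1 ζ ξ) ?_ ?_
    · intro ξ ξ'
      exact (show Commute (ofT ξ : Hecke N) (ofT ξ') from ofT_comm ξ ξ').map _
    · intro w w' h
      have h1 : affAct w.1 ζ = affAct w'.1 ζ := LinearMap.ext (congrFun h)
      have := eq_of_weight_eq hβ hgen hδ w.2 w'.2 1 (by rw [map_one, affAct_one, h1])
      rw [map_one, one_mul] at this
      exact Subtype.ext this
    · exact fun w v hv ξ => hv ξ
  · intro w
    rw [Submodule.span_singleton_le_iff_mem]
    exact stdVec_mem_wtSpace hgen w.2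
  · rw [iSup_span_stdVec hgen]
    exact le_top

/-- `φ_i φ_w 1_ζ` has the weight of `φ_{s_i w} 1_ζ`, so it is a multiple of it, nonzero because
`φ_i² = 1 - μ(α_i^∨)²` is. Applying `Q` produces the factor `1 + μ(α_i^∨)`, nonzero by genericity.
-/
theorem symmetrizer_stdVec_simple (hβ : ζ ∈ tBeta β) (hgen : IsGeneric β ζ)
    (hδ : ζ (cElt N) ≠ 0) {w : W N} {i : Fin N} (hi : i ≠ 0) (hw : w ∈ minReps β)
    (hsw : simpleRefl i * w ∈ minReps β) :
    ∃ c : ℂ, c ≠ 0 ∧ symmetrizer N • stdVec β ζ (simpleRefl i * w) =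
      c • symmetrizer N • stdVec β ζ w := by
  have hN := ne_one_of_ne_zero hi
  have hv := stdVec_mem_wtSpace hgen hw
  have hg := hgen.weight_simpleCoroot hN hw hsw
  simp only [Set.mem_insert_iff, Set.mem_singleton_iff, not_or] at hg
  have h1 := phiSimple_mem hv i
  rw [← affAct_mul, wtSpace_eq_span hβ hgen hδ hsw, Submodule.mem_span_singleton] at h1
  obtain ⟨d, hd⟩ := h1
  have hd0 : d ≠ 0 := by
    rintro rfl
    have h2 := phiSimple_phiSimple hN hv i
    rw [← hd, zero_smul, smul_zero, eq_comm, smul_eq_zero] at h2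
    rcases h2 with h2 | h2
    · have h3 : (1 - affAct w ζ (simpleCoroot i)) *
          (1 + affAct w ζ (simpleCoroot i)) = 0 := by linear_combination h2
      rcases mul_eq_zero.1 h3 with h4 | h4
      · exact hg.1 (by linear_combination -h4)
      · exact hg.2.2 (by linear_combination h4)
    · exact stdVec_ne_zero hβ hgen hw h2
  have h2 := symmetrizer_phiSimple hv hi
  rw [← hd, smul_comm] at h2
  refine ⟨d⁻¹ * (1 + affAct w ζ (simpleCoroot i)), mul_ne_zero (inv_ne_zero hd0) ?_, ?_⟩
  · intro h
    exact hg.2.2 (by linear_combination h)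
  · rw [mul_smul, ← h2, smul_smul, inv_mul_cancel₀ hd0, one_smul]

/-- The vectors `Q φ_w 1_ζ` for `w` in one double coset are proportional. -/
theorem symmetrizer_stdVec_connected (hβ : ζ ∈ tBeta β) (hgen : IsGeneric β ζ)
    (hδ : ζ (cElt N) ≠ 0) {w : W N} (hw : w ∈ minReps β) (σ : WBar N) :
    ∃ u ∈ parabolic β, ofPerm σ * w * ofPerm u ∈ minReps β ∧
      ∃ c : ℂ, c ≠ 0 ∧ symmetrizer N • stdVec β ζ (ofPerm σ * w * ofPerm u) =
        c • symmetrizer N • stdVec β ζ w := by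
  induction σ using WBar_induction with
  | one => exact ⟨1, one_mem _, by simpa using hw, 1, one_ne_zero, by simp⟩
  | simple i σ hi ih =>
    obtain ⟨u, hu, hmem, c, hc, h⟩ := ih
    rw [map_mul, ofPerm_swap hi]
    rcases simple_mul_minReps hmem i with h1 | ⟨j, hj, e, h1⟩
    · obtain ⟨d, hd, h2⟩ := symmetrizer_stdVec_simple hβ hgen hδ hi hmem h1
      refine ⟨u, hu, by simpa only [mul_assoc] using h1, d * c, mul_ne_zero hd hc, ?_⟩
      rw [mul_smul, ← h, ← h2]
      simp only [mul_assoc]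
    -- Here `s_i` acts on the representative as right multiplication by an element of `W̄_β`, so the
    -- minimal representative stays the same.
    · refine ⟨u * Equiv.swap (j - 1) j, mul_mem hu (swap_mem_parabolic hj e), ?_⟩
      have h2 : simpleRefl i * ofPerm σ * w * ofPerm (u * Equiv.swap (j - 1) j) =
          ofPerm σ * w * ofPerm u := by
        rw [map_mul, ofPerm_swap hj, ← mul_assoc, mul_assoc (simpleRefl i), mul_assoc (simpleRefl i),
          h1, mul_assoc, simpleRefl_mul_self, mul_one]
      rw [h2]
      exact ⟨hmem, c, hc, h⟩

/-- An indicator that is left `W̄`-stable has one value on all `σ y`, so averaging over `W̄` does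
not change it. -/
theorem functional_symmetrizer (D : Set (W N)) {f : Y β ζ →ₗ[ℂ] ℂ}
    (hf : ∀ w, f ((ofW w : Hecke N) • cyc β ζ) = D.indicator 1 w)
    (hD : ∀ (σ : WBar N) (w : W N), ofPerm σ * w ∈ D ↔ w ∈ D) (v : Y β ζ) :
    f (symmetrizer N • v) = f v := by
  have hv : v ∈ Submodule.span ℂ (Set.range fun y : W N => (ofW y : Hecke N) • cyc β ζ) := by
    rw [span_ofW_smul_cyc]
    trivial
  induction hv using Submodule.span_induction with
  | mem x hx =>
    obtain ⟨y, rfl⟩ := hx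
    have h : ∀ σ : WBar N, f ((ofW (ofPerm σ) : Hecke N) • (ofW y : Hecke N) • cyc β ζ) =
        D.indicator 1 y := by
      intro σ
      rw [← mul_smul, ← map_mul, hf]
      by_cases hy : y ∈ D
      · rw [Set.indicator_of_mem hy, Set.indicator_of_mem ((hD σ y).2 hy)]
        rfl
      · rw [Set.indicator_of_notMem hy, Set.indicator_of_notMem (fun e => hy ((hD σ y).1 e))]
    simp only [symmetrizer]
    rw [smul_assoc, Finset.sum_smul, map_smul, map_sum, Finset.sum_congr rfl fun σ _ => h σ,
      Finset.sum_const, Finset.card_univ, Fintype.card_perm, Fintype.card_fin, hf,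
      ← Nat.cast_smul_eq_nsmul ℂ, smul_smul, inv_mul_cancel₀, one_smul]
    exact_mod_cast N.factorial_ne_zero
  | zero => rw [smul_zero]
  | add x y _ _ hx hy => rw [smul_add, map_add, hx, hy, map_add]
  | smul z x _ hx => rw [smul_comm, map_smul, hx, map_smul]

/-- Up to a nonzero scalar, `w` may be replaced by an element of `W^β` of minimal length in `W̄ w
W̄_β`. The indicator of this double coset is insensitive to `Q` and reads off the leading
coefficient. -/
theorem symmetrizer_stdVec_ne_zero (hβ : ζ ∈ tBeta β) (hgen : IsGeneric β ζ)
    (hδ : ζ (cElt N) ≠ 0) {w : W N} (hw : w ∈ minReps β) :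
    symmetrizer N • stdVec β ζ w ≠ 0 := by
  set D : Set (W N) := {y | ∃ σ : WBar N, ∃ u ∈ parabolic β, y = ofPerm σ * w * ofPerm u}
    with hDdef
  have hDl : ∀ (σ : WBar N) (y : W N), ofPerm σ * y ∈ D ↔ y ∈ D := by
    intro σ y
    constructor
    · rintro ⟨τ, u, hu, e⟩
      refine ⟨σ⁻¹ * τ, u, hu, ?_⟩
      rw [map_mul, map_inv, mul_assoc, mul_assoc, ← mul_assoc _ w, ← e, inv_mul_cancel_left]
    · rintro ⟨τ, u, hu, rfl⟩
      exact ⟨σ * τ, u, hu, by simp only [map_mul, mul_assoc]⟩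
  have hDr : ∀ u ∈ parabolic β, ∀ y, y * ofPerm u ∈ D ↔ y ∈ D := by
    intro u hu y
    constructor
    · rintro ⟨τ, v, hv, e⟩
      refine ⟨τ, v * u⁻¹, mul_mem hv (inv_mem hu), ?_⟩
      rw [map_mul, ← mul_assoc, ← e, map_inv, mul_inv_cancel_right]
    · rintro ⟨τ, v, hv, rfl⟩
      exact ⟨τ, v * u, mul_mem hv hu, by simp only [map_mul, mul_assoc]⟩
  obtain ⟨m, ⟨σ, u, hu, rfl⟩, hmin⟩ := exists_minimalFor_of_wellFoundedLT (fun y => y ∈ D) length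
    ⟨w, 1, 1, one_mem _, by simp⟩
  obtain ⟨u', hu', hmem, c, hc, h⟩ := symmetrizer_stdVec_connected hβ hgen hδ hw σ
  set w' := ofPerm σ * w * ofPerm u' with hw'
  have hle : length w' ≤ length (ofPerm σ * w * ofPerm u) := by
    have := hmem _ (mul_mem (inv_mem hu') hu)
    rwa [hw', map_mul, map_inv, ← mul_assoc, mul_inv_cancel_right] at this
  have hmin' : ∀ y ∈ D, length w' ≤ length y := by
    intro y hy
    refine hle.trans ?_
    rcases le_total (length (ofPerm σ * w * ofPerm u)) (length y) with h | h
    · exact h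
    · exact hmin hy h
  obtain ⟨f, hf⟩ := exists_functional hβ D hDr
  obtain ⟨d, hd, hlead⟩ := stdVec_leading hgen hmem
  have h1 := functional_leading D hf ⟨σ, u', hu', rfl⟩ hmin' hlead
  rw [← functional_symmetrizer D hf hDl, h, map_smul] at h1
  intro h0
  rw [h0, map_zero, smul_zero] at h1
  exact hd h1.symm

/-- The vectors `Q φ_x 1_ζ`, `x ∈ X^β`, span the `W̄`-invariants. -/
theorem invPart_le_iSup (hβ : ζ ∈ tBeta β) (hgen : IsGeneric β ζ) (hδ : ζ (cElt N) ≠ 0) :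
    invPart (N := N) (Y β ζ) ≤
      ⨆ x : XSet β, Submodule.span ℂ {symmetrizer N • stdVec β ζ x} := by
  intro v hv
  rw [← symmetrizer_smul_of_mem hv]
  clear hv
  have hmem : v ∈ ⨆ w : minReps β, Submodule.span ℂ {stdVec β ζ w} := by
    rw [iSup_span_stdVec hgen]
    trivial
  induction hmem using Submodule.iSup_induction' with
  | mem w v hv' =>
    obtain ⟨z, rfl⟩ := Submodule.mem_span_singleton.1 hv'
    rw [smul_comm]
    refine Submodule.smul_mem _ _ ?_
    obtain ⟨ρ, hρ⟩ := exists_mul_mem_XSet w.2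
    obtain ⟨u, hu, hmem, c, hc, h⟩ := symmetrizer_stdVec_connected hβ hgen hδ w.2 ρ
    -- `ρ w` is already in `W^β`, so the correction `u` on the right is trivial.
    have hu1 := minReps_unique (XSet_subset_minReps hρ) (parabolic_index hu) hmem
    rw [hu1, map_one, mul_one] at h
    rw [← Submodule.smul_mem_iff _ hc, ← h]
    exact le_iSup (fun x : XSet β => Submodule.span ℂ {symmetrizer N • stdVec β ζ x}) ⟨_, hρ⟩
      (Submodule.mem_span_singleton_self _)
  | zero => rw [smul_zero]; exact zero_mem _
  | add x y _ _ hx hy => rw [smul_add]; exact add_mem hx hy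

end Induced

end DDAHA

end

/-! ### Decomposition of the `W̄`-invariants -/

theorem mainTheorem3 {N : ℕ} [NeZero N] (β : Composition N) (ζ : DDAHA.TDual N)
    (hβ : ζ ∈ DDAHA.tBeta β) (hgen : DDAHA.IsGeneric β ζ)
    (hδ : ζ (DDAHA.cElt N) ≠ 0) :
    (iSupIndep (fun x : DDAHA.XSet β =>
        DDAHA.invEigen (DDAHA.Y β ζ) (DDAHA.evalChar (DDAHA.affAct (x : DDAHA.W N) ζ))) ∧
      (⨆ x : DDAHA.XSet β,
        DDAHA.invEigen (DDAHA.Y β ζ) (DDAHA.evalChar (DDAHA.affAct (x : DDAHA.W N) ζ))) =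
        DDAHA.invPart (N := N) (DDAHA.Y β ζ)) ∧
    ∀ x ∈ DDAHA.XSet β,
      (∃ (k : ℤ) (L : List (Fin N)), DDAHA.IsReducedExpr x k L) ∧
      ∀ (k : ℤ) (L : List (Fin N)), DDAHA.IsReducedExpr x k L →
        DDAHA.symmetrizer N • DDAHA.phiExpr k L • DDAHA.cyc β ζ ≠ 0 ∧
        DDAHA.invEigen (DDAHA.Y β ζ) (DDAHA.evalChar (DDAHA.affAct x ζ)) =
          Submodule.span ℂ {DDAHA.symmetrizer N • DDAHA.phiExpr k L • DDAHA.cyc β ζ} := by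
  have hind : iSupIndep (fun x : DDAHA.XSet β =>
      DDAHA.invEigen (DDAHA.Y β ζ) (DDAHA.evalChar (DDAHA.affAct (x : DDAHA.W N) ζ))) := by
    refine DDAHA.iSupIndep_eigen (A := DDAHA.symInv N) (fun p => Algebra.lsmul ℂ ℂ (DDAHA.Y β ζ)
      (DDAHA.ofSym (p : SymmetricAlgebra ℂ (DDAHA.TPrime N)) : DDAHA.Hecke N)) ?_
      (χ := fun (x : DDAHA.XSet β) p => DDAHA.evalChar (DDAHA.affAct (x : DDAHA.W N) ζ) p) ?_ ?_
    · intro p q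
      exact (show Commute (DDAHA.ofSym (p : SymmetricAlgebra ℂ (DDAHA.TPrime N)) : DDAHA.Hecke N)
        (DDAHA.ofSym q) from (Commute.all _ _).map _).map _
    · intro x x' h
      obtain ⟨σ, hσ⟩ := DDAHA.exists_perm_of_evalChar_eq (DFunLike.coe_injective h)
      exact Subtype.ext (DDAHA.XSet_unique x.2 x'.2 (DDAHA.eq_of_weight_eq hβ hgen hδ
        (DDAHA.XSet_subset_minReps x.2) (DDAHA.XSet_subset_minReps x'.2) σ hσ))
    · exact fun x v hv p => hv.2 p
  have hle : ∀ x : DDAHA.XSet β,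
      Submodule.span ℂ {DDAHA.symmetrizer N • DDAHA.stdVec β ζ (x : DDAHA.W N)} ≤
        DDAHA.invEigen (DDAHA.Y β ζ) (DDAHA.evalChar (DDAHA.affAct (x : DDAHA.W N) ζ)) :=
    fun x => (Submodule.span_singleton_le_iff_mem _ _).2 (DDAHA.symmetrizer_smul_mem_invEigen
      (DDAHA.stdVec_mem_wtSpace hgen (DDAHA.XSet_subset_minReps x.2)))
  have hinv : (⨆ x : DDAHA.XSet β,
      DDAHA.invEigen (DDAHA.Y β ζ) (DDAHA.evalChar (DDAHA.affAct (x : DDAHA.W N) ζ))) ≤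
      DDAHA.invPart (N := N) (DDAHA.Y β ζ) := iSup_le fun x v (hv : v ∈ _ ∧ _) => hv.1
  have hspan := DDAHA.invPart_le_iSup hβ hgen hδ
  refine ⟨⟨hind, le_antisymm hinv (hspan.trans (iSup_mono hle))⟩, fun x hx =>
    ⟨DDAHA.exists_reduced x, fun k L hL => ?_⟩⟩
  have hm := DDAHA.XSet_subset_minReps hx
  -- Any reduced expression yields a nonzero vector of the weight line spanned by `stdVec`, so it
  -- suffices to treat the chosen expression.
  have h1 := (DDAHA.phiExpr_leading hgen hm hL).1
  rw [DDAHA.wtSpace_eq_span hβ hgen hδ hm, Submodule.mem_span_singleton] at h1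
  obtain ⟨d, hd⟩ := h1
  have hd0 : d ≠ 0 := by
    rintro rfl
    exact DDAHA.phiExpr_smul_cyc_ne_zero hβ hgen hm hL (by rw [← hd, zero_smul])
  rw [← hd, smul_comm]
  refine ⟨smul_ne_zero hd0 (DDAHA.symmetrizer_stdVec_ne_zero hβ hgen hδ hm), ?_⟩
  rw [Submodule.span_singleton_smul_eq (IsUnit.mk0 d hd0)]
  -- The lines lie in independent eigenspaces and span all invariants, hence fill the eigenspaces.
  exact DDAHA.eq_of_iSupIndep hind hle (hinv.trans hspan) ⟨x, hx⟩
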